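/- **Model.** Let $T\in\{0,1,2,\dots\}$, let $(\Omega,\mathcal F,\mathbb P)$ be a probability space carrying the $N$-dimensional discounted stock price process $P=(P_t)_{0\le t\le T}$, and let $\mathcal F_t=\sigma(P_0,\dots,P_t)$. Put $\Delta\tilde P_{t+1}=\mathrm{diag}(P_t)^{-1}(P_{t+1}-P_t)$. All relations between random variables hold a.s. An effort $A=(A_t)_{t<T}$ consists of $\mathcal F_t$-measurable $\mathbb R^N$-valued $A_t$ (dollar amounts invested); it generates the wealth $W^A_t=W_0+\sum_{s<t}A_s\cdot\Delta\tilde P_{s+1}$ ($W_0\in\mathbb R$) and costs $C(A)=\sum_{t<T}c_t(A_t)$, where each $c_t:\mathbb R^N\to\mathbb R$ is strictly convex. Let $\mathcal F^A_t$ be generated by $P_s,W^A_s$, $s\le t$. *Utilities.* For $l\in\{a,p\}$ (Agent, Principal) and $t<T$ let $H^l_t:\mathbb R\to(-\infty,+\infty]$ be convex, lower semicontinuous and nondecreasing, with $(H^l_t)^*(1)=0$, where $H^*(y)=\sup_s(sy-H(s))$. Let $(\mathcal G_t)=(\mathcal F_t)$ for the Agent and $(\mathcal G_t)=(\mathcal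 F^A_t)$ for the Principal. The one-step optimized certainty equivalent of a bounded $\mathcal G_{t+1}$-measurable $X$ is $$\tilde U^l_t(X)=\operatorname{ess\,sup}_{s\in\mathbb R}\{s-\mathbb E[H^l_t(s-X)\mid\mathcal G_t]\},$$ extended to $[-\infty,\infty)$-valued $X$ by $\tilde U^l_t(X)=\lim_{n\to\infty}\lim_{m\to-\infty}\tilde U^l_t((X\wedge n)\vee m)$, and $U^l_t=\tilde U^l_t\circ\tilde U^l_{t+1}\circ\dots\circ\tilde U^l_{T-1}$ (pasting; $U^l_T$ is the identity). *Contracts.* A contract $(\Theta,\beta)$ with recommended effort $A$ consists of a real $\mathcal F_T$-measurable $\Theta$ and real $\mathcal F^A_t$-measurable $\beta_t$, $t<T$; it pays $S(B)=\Theta+\sum_{t<T}\beta_t(W^B_{t+1}-W^B_t)$ to the Agent if he exerts effort $B$. It is *incentive-compatible* if, in the Agent's recursion $V_T=\Theta$, $$V_t=\operatorname{ess\,sup}_{a\in L^0(\mathcal F_t)^N}\{U^a_t(V_{t+1}+\beta_t\,a\cdot\Delta\tilde P_{t+1})-c_t(a)\}\quad(t<T),$$ the essential supremum is attained at $a=A_t$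 for every $t<T$. It is *individually rational* if $\operatorname{ess\,sup}_B U^a_0(S(B)-C(B))\ge R$, where $B$ ranges over all efforts and $R\in\mathbb R$ is the Agent's reservation utility. An incentive-compatible, individually rational contract with effort $A$ is *optimal* if $U^p_0(W^{A'}_T-S'(A'))\le U^p_0(W^A_T-S(A))$ a.s. for every incentive-compatible, individually rational contract $(\Theta',\beta')$ with recommended effort $A'$ and payments $S'$. **Theorem.** Suppose that there are constants $0<p_-\le p_+$ with $p_-\le P^i_t\le p_+$ a.s. for all $i,t$; that for every $t<T$ the functions $H^a_t$ and $H^p_t$ are bounded from below and $1\in\mathrm{int}(\mathrm{dom}\,(H^a_t)^*)\cap\mathrm{int}(\mathrm{dom}\,(H^p_t)^*)$; and that $\lim_{|a|\to\infty}c_t(a)/|a|=\infty$ for every $t<T$. Then the dynamic Principal–Agent problem has an optimal contract $(\Theta,\beta)$ with $\beta_t=1$ for all $t$, in which the Agent keeps the generated wealth and the Principal receives a possibly path-dependent derivative on the prices: there are a Borel function $d$ of the price path and an effort $A$ such that $$S(B)=W^B_T-d(P_0,\dots,P_T)\qquad\text{for every effort }B,$$ and this contract with effort $A$ is optimal. Moreover,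 under it the Agent's optimal utility at time $0$ equals $R$, and the Principal's utility $U^p_0(W^A_T-S(A))=U^p_0(d(P_0,\dots,P_T))$ is a.s. finite. (No Markov or replicability property of $d$ is asserted.) -/

import Mathlib

open MeasureTheory Filter

/-! ### Essential suprema of families of random variables -/

/-- `g` is an `m`-measurable essential supremum of the family `S`: the a.s. smallest `m`-measurable
random variable that dominates every member of `S` almost surely. -/
structure IsEssSup {Ω : Type*} (m : MeasurableSpace Ω) {mΩ : MeasurableSpace Ω} (μ : Measure Ω)
    (S : Set (Ω → EReal)) (g : Ω → EReal) : Prop where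
  measurable : Measurable[m] g
  le : ∀ f ∈ S, f ≤ᵐ[μ] g
  least : ∀ g' : Ω → EReal, Measurable[m] g' → (∀ f ∈ S, f ≤ᵐ[μ] g') → g ≤ᵐ[μ] g'

/-- Essential suprema exist for arbitrary families. -/
theorem exists_isEssSup {Ω : Type*} {m mΩ : MeasurableSpace Ω} (hm : m ≤ mΩ) (μ : Measure Ω)
    [IsFiniteMeasure μ] (S : Set (Ω → EReal)) : ∃ g, IsEssSup m μ S g := by
  let ψ : EReal → ENNReal := fun x => (EReal.exp x + 1)⁻¹
  have hψ_inj : Function.Injective ψ := by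
    intro x y h
    have h1 : EReal.exp x + 1 = EReal.exp y + 1 := inv_injective h
    have h2 : EReal.exp x = EReal.exp y := (ENNReal.add_left_inj ENNReal.one_ne_top).1 h1
    exact EReal.expOrderIso.injective h2
  have hψ_anti : Antitone ψ := by
    intro x y h
    refine ENNReal.inv_le_inv.2 ?_
    gcongr
  have hψ_le : ∀ x, ψ x ≤ 1 := fun x => ENNReal.inv_le_one.2 le_add_self
  have hψ_meas : Measurable ψ := hψ_anti.measurable
  let G : Set (Ω → EReal) := {g | Measurable[m] g ∧ ∀ f ∈ S, f ≤ᵐ[μ] g}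
  let I : Set ENNReal := (fun g : Ω → EReal => ∫⁻ ω, ψ (g ω) ∂μ) '' G
  have hI : I.Nonempty :=
    Set.Nonempty.image _ ⟨fun _ => ⊤, measurable_const, fun f _ => .of_forall fun _ => le_top⟩
  obtain ⟨u, -, hu, huI⟩ := exists_seq_tendsto_sSup hI (OrderTop.bddAbove I)
  choose g hg hgu using huI
  have hG : (fun ω => ⨅ n, g n ω) ∈ G := by
    refine ⟨Measurable.iInf fun n => (hg n).1, fun f hf => ?_⟩
    have h := ae_all_iff.2 fun n => (hg n).2 f hf
    filter_upwards [h] with ω hω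
    exact le_iInf hω
  refine ⟨fun ω => ⨅ n, g n ω, hG.1, hG.2, fun g' hg'm hg'S => ?_⟩
  have hK : (fun ω => min (⨅ n, g n ω) (g' ω)) ∈ G := by
    refine ⟨Measurable.min hG.1 hg'm, fun f hf => ?_⟩
    filter_upwards [hG.2 f hf, hg'S f hf] with ω h1 h2
    exact le_min h1 h2
  have hsup : sSup I ≤ ∫⁻ ω, ψ (⨅ n, g n ω) ∂μ := by
    refine le_of_tendsto' hu fun n => ?_
    rw [← hgu n]
    exact lintegral_mono fun ω => hψ_anti (iInf_le _ n)
  have hle : ∫⁻ ω, ψ (min (⨅ n, g n ω) (g' ω)) ∂μ ≤ ∫⁻ ω, ψ (⨅ n, g n ω) ∂μ :=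
    le_trans (le_sSup (Set.mem_image_of_mem (fun g : Ω → EReal => ∫⁻ ω, ψ (g ω) ∂μ) hK)) hsup
  have hfin : ∫⁻ ω, ψ (⨅ n, g n ω) ∂μ ≠ ⊤ := by
    refine ne_top_of_le_ne_top (measure_ne_top μ Set.univ) ?_
    calc ∫⁻ ω, ψ (⨅ n, g n ω) ∂μ ≤ ∫⁻ _, 1 ∂μ := lintegral_mono fun ω => hψ_le _
      _ = μ Set.univ := by simp
  have hae := ae_eq_of_ae_le_of_lintegral_le
    (.of_forall fun ω => hψ_anti (min_le_left (⨅ n, g n ω) (g' ω))) hfin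
    (hψ_meas.comp (hK.1.mono hm le_rfl)).aemeasurable hle
  filter_upwards [hae] with ω hω
  exact min_eq_left_iff.1 (hψ_inj hω).symm

open Classical in
/-- The essential supremum of a family (a version; it is unique up to a.s. equality). -/
noncomputable def essSupFamily {Ω : Type*} (m : MeasurableSpace Ω) {mΩ : MeasurableSpace Ω}
    (μ : Measure Ω) (S : Set (Ω → EReal)) : Ω → EReal :=
  if h : ∃ g, IsEssSup m μ S g then h.choose else fun _ => ⊤

theorem isEssSup_essSupFamily {Ω : Type*} {m mΩ : MeasurableSpace Ω} (hm : m ≤ mΩ) (μ : Measure Ω)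
    [IsFiniteMeasure μ] (S : Set (Ω → EReal)) : IsEssSup m μ S (essSupFamily m μ S) := by
  have h := exists_isEssSup hm μ S
  rw [essSupFamily, dif_pos h]
  exact h.choose_spec

/-! ### Optimized certainty equivalents -/

/-- Conditional expectation `E[f | m] = E[f⁺ | m] - E[f⁻ | m]` of an extended random variable, used
for `f` bounded from below and possibly equal to `+∞`, for which it takes values in `(-∞, +∞]`. -/
noncomputable def condExpExt {Ω : Type*} (m : MeasurableSpace Ω) {mΩ : MeasurableSpace Ω}
    (μ : Measure Ω) (f : Ω → EReal) : Ω → EReal :=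
  fun ω => ((condLExp m μ (fun ω' => (f ω').toENNReal) ω : ENNReal) : EReal)
    - ((condLExp m μ (fun ω' => (-f ω').toENNReal) ω : ENNReal) : EReal)

/-- The convex conjugate `H*(y) = sup_s (s y - H s)`. -/
noncomputable def convexConj (H : ℝ → EReal) (y : ℝ) : EReal :=
  ⨆ s : ℝ, ((s * y : ℝ) : EReal) - H s

/-- Loss functions of optimized certainty equivalents: convex (convex epigraph), closed (lower
semicontinuous), increasing, with `H*(1) = sup_s (s - H s) = 0`. The last condition forces
`s ≤ H s`, and that `H` is not identically `+∞`; so `H` is proper. -/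
structure IsLossFunction (H : ℝ → EReal) : Prop where
  convex : Convex ℝ {p : ℝ × ℝ | H p.1 ≤ (p.2 : EReal)}
  closed : LowerSemicontinuous H
  mono : Monotone H
  normalized : convexConj H 1 = 0

/-- One-step optimized certainty equivalent of a bounded random variable:
`esssup_{s ∈ ℝ} {s - E[H (s - X) | m]}`. -/
noncomputable def oceBounded {Ω : Type*} (m : MeasurableSpace Ω) {mΩ : MeasurableSpace Ω}
    (μ : Measure Ω) (H : ℝ → EReal) (X : Ω → ℝ) : Ω → EReal :=
  essSupFamily m μ (Set.range fun (s : ℝ) (ω : Ω) =>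
    (s : EReal) - condExpExt m μ (fun ω' => H (s - X ω')) ω)

/-- Extension of the one-step optimized certainty equivalent to random variables with values in
`[-∞, +∞)`, by truncation: `lim_{n → +∞} lim_{k → +∞} U ((X ∧ n) ∨ (-k))`. The inner limit is
decreasing in `k` and the outer one increasing in `n`. -/
noncomputable def oceStep {Ω : Type*} (m : MeasurableSpace Ω) {mΩ : MeasurableSpace Ω}
    (μ : Measure Ω) (H : ℝ → EReal) (X : Ω → EReal) : Ω → EReal :=
  fun ω => ⨆ n : ℕ, ⨅ k : ℕ, oceBounded m μ H
    (fun ω' => (max ((-(k : ℝ) : ℝ) : EReal) (min (X ω') ((n : ℝ) : EReal))).toReal) ω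

/-- Composition `u t ∘ u (t + 1) ∘ ⋯ ∘ u (t + k - 1)` of one-step functionals. -/
def pasteSteps {Ω : Type*} (u : ℕ → (Ω → EReal) → (Ω → EReal)) :
    ℕ → ℕ → (Ω → EReal) → (Ω → EReal)
  | 0, _, X => X
  | k + 1, t, X => u t (pasteSteps u k (t + 1) X)

/-- The utility functional `U_t = u_t ∘ u_{t+1} ∘ ⋯ ∘ u_{T-1}` at time `t`, obtained by pasting the
one-step optimized certainty equivalents `u_t` with loss functions `H t` along the information
flow `𝒢`. -/
noncomputable def oceUtility {Ω : Type*} {mΩ : MeasurableSpace Ω} (μ : Measure Ω)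
    (𝒢 : ℕ → MeasurableSpace Ω) (T : ℕ) (H : ℕ → ℝ → EReal) (t : ℕ) (X : Ω → EReal) : Ω → EReal :=
  pasteSteps (fun s => oceStep (𝒢 s) μ (H s)) (T - t) t X

/-! ### The Principal-Agent model -/

/-- Data of the model: horizon, discounted prices of `N` stocks, cost functions of effort, loss
functions of the Agent and of the Principal, initial wealth, and the Agent's reservation utility.
Times `t ≤ T` matter for prices, times `t < T` for the other processes. -/
structure PAModel (Ω : Type*) (N : ℕ) where
  T : ℕ
  P : ℕ → Ω → EuclideanSpace ℝ (Fin N)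
  c : ℕ → EuclideanSpace ℝ (Fin N) → ℝ
  Ha : ℕ → ℝ → EReal
  Hp : ℕ → ℝ → EReal
  W₀ : ℝ
  R : ℝ

namespace PAModel

/-- The price filtration `F_t = σ(P_0, …, P_t)`. -/
abbrev priceInfo {Ω : Type*} {N : ℕ} (M : PAModel Ω N) (t : ℕ) : MeasurableSpace Ω :=
  ⨆ s : ℕ, ⨆ _ : s ≤ t, MeasurableSpace.comap (M.P s) inferInstance

/-- The gain `a · diag(P_t)⁻¹ (P_{t+1} - P_t)` of the dollar positions `a` held from `t` to
`t + 1`. -/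
noncomputable def gain {Ω : Type*} {N : ℕ} (M : PAModel Ω N) (t : ℕ)
    (a : Ω → EuclideanSpace ℝ (Fin N)) (ω : Ω) : ℝ :=
  ∑ i, a ω i * ((M.P (t + 1) ω i - M.P t ω i) / M.P t ω i)

/-- The wealth `W^A_t` generated by the effort levels `A`. -/
noncomputable def wealth {Ω : Type*} {N : ℕ} (M : PAModel Ω N)
    (A : ℕ → Ω → EuclideanSpace ℝ (Fin N)) (t : ℕ) (ω : Ω) : ℝ :=
  M.W₀ + ∑ s ∈ Finset.range t, M.gain s (A s) ω

/-- The filtration `F^A` generated by prices and by the wealth process `W^A`. -/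
noncomputable abbrev principalInfo {Ω : Type*} {N : ℕ} (M : PAModel Ω N)
    (A : ℕ → Ω → EuclideanSpace ℝ (Fin N)) (t : ℕ) : MeasurableSpace Ω :=
  M.priceInfo t ⊔ ⨆ s : ℕ, ⨆ _ : s ≤ t, MeasurableSpace.comap (M.wealth A s) inferInstance

/-- Effort levels: `A_t` is `F_t`-measurable. -/
def IsEffort {Ω : Type*} {N : ℕ} (M : PAModel Ω N)
    (A : ℕ → Ω → EuclideanSpace ℝ (Fin N)) : Prop :=
  ∀ t < M.T, Measurable[M.priceInfo t] (A t)

/-- The total cost of effort. -/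
noncomputable def cost {Ω : Type*} {N : ℕ} (M : PAModel Ω N)
    (A : ℕ → Ω → EuclideanSpace ℝ (Fin N)) (ω : Ω) : ℝ :=
  ∑ t ∈ Finset.range M.T, M.c t (A t ω)

/-- The payment `S(A) = Θ + ∑_{t < T} β_t (W^A_{t+1} - W^A_t)` to the Agent under the contract
`(Θ, β)`. -/
noncomputable def payment {Ω : Type*} {N : ℕ} (M : PAModel Ω N) (Θ : Ω → ℝ) (β : ℕ → Ω → ℝ)
    (A : ℕ → Ω → EuclideanSpace ℝ (Fin N)) (ω : Ω) : ℝ :=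
  Θ ω + ∑ t ∈ Finset.range M.T, β t ω * (M.wealth A (t + 1) ω - M.wealth A t ω)

/-- The Agent's utility functionals `U^a_t`. -/
noncomputable def agentU {Ω : Type*} {N : ℕ} {mΩ : MeasurableSpace Ω} (M : PAModel Ω N)
    (μ : Measure Ω) (t : ℕ) (X : Ω → EReal) : Ω → EReal :=
  oceUtility μ M.priceInfo M.T M.Ha t X

/-- The Principal's utility functionals `U^p_t`, for her information `F^A`. -/
noncomputable def principalU {Ω : Type*} {N : ℕ} {mΩ : MeasurableSpace Ω} (M : PAModel Ω N)
    (μ : Measure Ω) (A : ℕ → Ω → EuclideanSpace ℝ (Fin N)) (t : ℕ) (X : Ω → EReal) : Ω → EReal :=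
  oceUtility μ (M.principalInfo A) M.T M.Hp t X

/-- The Agent's one-step objective `U^a_t (X + b a ΔP̃_{t+1}) - c_t(a)`. -/
noncomputable def agentObjective {Ω : Type*} {N : ℕ} {mΩ : MeasurableSpace Ω} (M : PAModel Ω N)
    (μ : Measure Ω) (t : ℕ) (X : Ω → EReal) (b : Ω → ℝ) (a : Ω → EuclideanSpace ℝ (Fin N)) :
    Ω → EReal :=
  fun ω => M.agentU μ t (fun ω' => X ω' + ((b ω' * M.gain t a ω' : ℝ) : EReal)) ω
    - ((M.c t (a ω) : ℝ) : EReal)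

/-- `V` solves the Agent's recursion for the contract `(Θ, β)`: `V_T = Θ` and `V_t` is the essential
supremum over `a ∈ L⁰(F_t)^N` of `U^a_t (V_{t+1} + β_t a ΔP̃_{t+1}) - c_t(a)`. -/
def IsAgentValue {Ω : Type*} {N : ℕ} {mΩ : MeasurableSpace Ω} (M : PAModel Ω N)
    (μ : Measure Ω) (Θ : Ω → ℝ) (β : ℕ → Ω → ℝ) (V : ℕ → Ω → EReal) : Prop :=
  (∀ ω, V M.T ω = (Θ ω : EReal)) ∧
  ∀ t < M.T, IsEssSup (M.priceInfo t) μ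
    {Y | ∃ a : Ω → EuclideanSpace ℝ (Fin N), Measurable[M.priceInfo t] a ∧
      Y = M.agentObjective μ t (V (t + 1)) (β t) a} (V t)

/-- `(Θ, β)`, with recommended effort `A`, is a contract that is incentive-compatible: at each time
the essential supremum in the Agent's recursion is attained at `A_t`. -/
structure IsIncentiveCompatible {Ω : Type*} {N : ℕ} {mΩ : MeasurableSpace Ω} (M : PAModel Ω N)
    (μ : Measure Ω) (Θ : Ω → ℝ) (β : ℕ → Ω → ℝ)
    (A : ℕ → Ω → EuclideanSpace ℝ (Fin N)) : Prop where
  payment_measurable : Measurable[M.priceInfo M.T] Θ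
  effort : M.IsEffort A
  share_measurable : ∀ t < M.T, Measurable[M.principalInfo A t] (β t)
  attained : ∃ V : ℕ → Ω → EReal, M.IsAgentValue μ Θ β V ∧
    ∀ t < M.T, M.agentObjective μ t (V (t + 1)) (β t) (A t) =ᵐ[μ] V t

/-- The optimal utility that the Agent can obtain at time `0` from the contract `(Θ, β)`. -/
noncomputable def agentOptimalUtility {Ω : Type*} {N : ℕ} {mΩ : MeasurableSpace Ω}
    (M : PAModel Ω N) (μ : Measure Ω) (Θ : Ω → ℝ) (β : ℕ → Ω → ℝ) : Ω → EReal :=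
  essSupFamily (M.priceInfo 0) μ
    {Y | ∃ A : ℕ → Ω → EuclideanSpace ℝ (Fin N), M.IsEffort A ∧
      Y = M.agentU μ 0 (fun ω => ((M.payment Θ β A ω - M.cost A ω : ℝ) : EReal))}

/-- The contract gives the Agent at least his reservation utility. -/
def IsIndividuallyRational {Ω : Type*} {N : ℕ} {mΩ : MeasurableSpace Ω} (M : PAModel Ω N)
    (μ : Measure Ω) (Θ : Ω → ℝ) (β : ℕ → Ω → ℝ) : Prop :=
  ∀ᵐ ω ∂μ, (M.R : EReal) ≤ M.agentOptimalUtility μ Θ β ω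

/-- The Principal's utility at time `0` from `W^A_T - S(A)`, when the Agent chooses `A` under the
contract `(Θ, β)`. -/
noncomputable def principalUtility {Ω : Type*} {N : ℕ} {mΩ : MeasurableSpace Ω}
    (M : PAModel Ω N) (μ : Measure Ω) (Θ : Ω → ℝ) (β : ℕ → Ω → ℝ)
    (A : ℕ → Ω → EuclideanSpace ℝ (Fin N)) : Ω → EReal :=
  M.principalU μ A 0 (fun ω => ((M.wealth A M.T ω - M.payment Θ β A ω : ℝ) : EReal))

/-- `(Θ, β)`, with effort `A`, solves the dynamic Principal-Agent problem: it is incentive-compatible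
and individually rational, and no other such contract gives the Principal more utility. -/
structure IsOptimalContract {Ω : Type*} {N : ℕ} {mΩ : MeasurableSpace Ω} (M : PAModel Ω N)
    (μ : Measure Ω) (Θ : Ω → ℝ) (β : ℕ → Ω → ℝ)
    (A : ℕ → Ω → EuclideanSpace ℝ (Fin N)) : Prop where
  incentiveCompatible : M.IsIncentiveCompatible μ Θ β A
  individuallyRational : M.IsIndividuallyRational μ Θ β
  optimal : ∀ (Θ' : Ω → ℝ) (β' : ℕ → Ω → ℝ) (A' : ℕ → Ω → EuclideanSpace ℝ (Fin N)),
    M.IsIncentiveCompatible μ Θ' β' A' → M.IsIndividuallyRational μ Θ' β' →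
    M.principalUtility μ Θ' β' A' ≤ᵐ[μ] M.principalUtility μ Θ β A

end PAModel

/-! ### Excess of a loss function over the identity -/

/-! Write `L = H - id` for the excess of a loss function. The normalization of the conjugate at 1
gives `L ≥ 0` with infimum 0, and finiteness of the conjugate near 1 gives `L s ≥ ε|s| - C`. The
certainty equivalent of `X` is the supremum over `s` of `E[X - L (s - X) | m]`; it is monotone and
cash additive.

One period. Let Principal and Agent share `Z = G + b · D`, the Agent receiving `Y`. Adding their
objectives for parameters `s` and `s'` gives the conditional expectation of `Z - Lp (s - (Z - Y)) -
La (s' - Y)`, which is at most that of `Z - L (w - Z)`, where `w = s + s'` and `L` is the infimal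
convolution of `Lp` and `La`. Maximizing this, net of `c b`, over known pairs `(b, w)` is a coercive
convex problem: superlinear cost controls `b` and linear growth of `L` controls `w`. A weak
compactness argument in `L²` yields a bounded maximizer (`exists_social_loss_minimizer`). A
1-Lipschitz selection of minimizers in the infimal convolution
(`IsLossExcess.exists_lipschitz_selector`) splits the total into bounded parts, and the bound is
attained. Hence the two utilities sum to at most `G' + c b`, with equality at some effort `a` and
transfer `X`. A cash shift makes the Agent's utility of `X` equal to `c a` (`exists_risk_sharing`).

Dynamics. Iterating backward from `G_T = 0` gives surpluses `G`, transfers `X` and efforts `A`. For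
any incentive-compatible contract, a backward induction bounds the Principal's utility by `W₀ + G_0
- V_0` (`PAModel.principalUtility_le`), and individual rationality forces `V_0 ≥ R`.

The bound `W₀ + G_0 - R` is reached with full shares and `Θ = R + ∑ (X_t - gain of A_t)`. When the
Agent owns all gains, a deviation `b` leaves the Principal's residual unchanged, still worth `G_t`.
The one-period bound then leaves the deviating Agent a utility of at most `c b`, so deviating does
not pay. Finally, `Θ` is measurable with respect to the prices, hence a Borel function of their
path. -/

/-- The excess `H s - s` of a loss function over the identity. -/
noncomputable def lossExcess (H : ℝ → EReal) (s : ℝ) : ENNReal := (H s - (s : EReal)).toENNReal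

/-- The properties of `lossExcess H` for a loss function `H` with `1 ∈ int (dom H*)`. -/
structure IsLossExcess (L : ℝ → ENNReal) : Prop where
  convex : ∀ x y a b : ℝ, 0 ≤ a → 0 ≤ b → a + b = 1 →
    L (a * x + b * y) ≤ ENNReal.ofReal a * L x + ENNReal.ofReal b * L y
  lsc : LowerSemicontinuous L
  mono : ∀ x y : ℝ, x ≤ y → L x ≤ L y + ENNReal.ofReal (y - x)
  growth : ∃ ε C : ℝ, 0 < ε ∧ ∀ s : ℝ, ENNReal.ofReal (ε * |s| - C) ≤ L s
  small : ∀ δ : ℝ, 0 < δ → ∃ r : ℝ, L r ≤ ENNReal.ofReal δ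

/-- A loss function is the identity plus its excess, and the excess has the listed properties. -/
structure IsCoerciveLoss (H : ℝ → EReal) : Prop where
  excess : IsLossExcess (lossExcess H)
  eq_add : ∀ s : ℝ, H s = (s : EReal) + (lossExcess H s : EReal)

theorem IsLossFunction.le_self {H : ℝ → EReal} (hH : IsLossFunction H) (s : ℝ) :
    (s : EReal) ≤ H s := by
  have h : ((s * 1 : ℝ) : EReal) - H s ≤ convexConj H 1 :=
    le_iSup (fun s : ℝ => ((s * 1 : ℝ) : EReal) - H s) s
  rw [hH.normalized, mul_one] at h
  exact EReal.sub_nonpos.1 h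

theorem IsLossFunction.eq_add_lossExcess {H : ℝ → EReal} (hH : IsLossFunction H) (s : ℝ) :
    H s = (s : EReal) + (lossExcess H s : EReal) := by
  have h := hH.le_self s
  rw [lossExcess, EReal.coe_toENNReal]
  · induction hs : H s with
    | bot => simp
    | top => simp
    | coe x => rw [← EReal.coe_sub, ← EReal.coe_add]; congr 1; ring
  · rw [EReal.sub_nonneg (by simp) (by simp)]
    exact h

/-- Translates bounds on the excess into membership in the epigraph of `H`, the form in which
convexity, closedness, monotonicity and the conjugate of `H` can be used. -/
theorem IsLossFunction.lossExcess_le_iff {H : ℝ → EReal} (hH : IsLossFunction H) (s r : ℝ)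
    (hr : 0 ≤ r) : lossExcess H s ≤ ENNReal.ofReal r ↔ H s ≤ ((s + r : ℝ) : EReal) := by
  rw [hH.eq_add_lossExcess s]
  induction hL : lossExcess H s with
  | top => simpa only [EReal.coe_ennreal_top, EReal.coe_add_top, top_le_iff, ENNReal.ofReal_ne_top,
      false_iff] using EReal.coe_ne_top (s + r)
  | coe x =>
    have : ((x : ENNReal) : EReal) = ((x : ℝ) : EReal) := rfl
    rw [this, ← EReal.coe_add, EReal.coe_le_coe_iff, ENNReal.le_ofReal_iff_toReal_le (by simp) hr, ENNReal.coe_toReal]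
    constructor <;> intro h <;> linarith

theorem ENNReal.le_of_forall_le_ofReal {x y : ENNReal}
    (h : ∀ r : ℝ, 0 ≤ r → y ≤ ENNReal.ofReal r → x ≤ ENNReal.ofReal r) : x ≤ y := by
  rcases eq_or_ne y ⊤ with rfl | hy
  · exact le_top
  · have := h y.toReal ENNReal.toReal_nonneg (by rw [ENNReal.ofReal_toReal hy])
    rwa [ENNReal.ofReal_toReal hy] at this

/-- Subtracting the identity preserves convexity and closedness, and turns monotonicity of `H` into
a slope of at least -1. Smallness is `H*(1) = 0` read as a supremum, and growth comes from the
conjugate on both sides of 1. -/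
theorem IsLossFunction.isLossExcess {H : ℝ → EReal} (hH : IsLossFunction H)
    (h1 : (1 : ℝ) ∈ interior {y : ℝ | convexConj H y < ⊤}) : IsLossExcess (lossExcess H) where
  convex x y a b ha hb hab := by
    rcases ha.eq_or_lt with rfl | ha'
    · obtain rfl : b = 1 := by linarith
      simp
    rcases hb.eq_or_lt with rfl | hb'
    · obtain rfl : a = 1 := by linarith
      simp
    rcases eq_or_ne (lossExcess H x) ⊤ with hx | hx
    · simp [hx, ENNReal.mul_top, ha']
    rcases eq_or_ne (lossExcess H y) ⊤ with hy | hy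
    · simp [hy, ENNReal.mul_top, hb']
    have hx' := (hH.lossExcess_le_iff x _ ENNReal.toReal_nonneg).1 (ENNReal.ofReal_toReal hx).ge
    have hy' := (hH.lossExcess_le_iff y _ ENNReal.toReal_nonneg).1 (ENNReal.ofReal_toReal hy).ge
    set p := (lossExcess H x).toReal with hp
    set q := (lossExcess H y).toReal with hq
    have hp0 : 0 ≤ p := ENNReal.toReal_nonneg
    have hq0 : 0 ≤ q := ENNReal.toReal_nonneg
    have h := hH.convex (x := (x, x + p)) hx' (y := (y, y + q)) hy' ha hb hab
    simp only [Set.mem_ofPred_eq, Prod.smul_mk, Prod.mk_add_mk, smul_eq_mul] at h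
    rw [← ENNReal.ofReal_toReal hx, ← ENNReal.ofReal_toReal hy, ← hp, ← hq,
      ← ENNReal.ofReal_mul ha, ← ENNReal.ofReal_mul hb,
      ← ENNReal.ofReal_add (by positivity) (by positivity),
      hH.lossExcess_le_iff _ _ (by positivity)]
    convert h using 2
    ring
  lsc := by
    intro s y hy
    obtain ⟨z, hyz, hz⟩ := exists_between hy
    have hy' : y ≠ ⊤ := hyz.ne_top
    have hz' : z ≠ ⊤ := hz.ne_top
    have hyz' : y.toReal < z.toReal := (ENNReal.toReal_lt_toReal hy' hz').2 hyz
    have hH' : ((s + z.toReal : ℝ) : EReal) < H s := by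
      by_contra! hcon
      have := (hH.lossExcess_le_iff s _ ENNReal.toReal_nonneg).2 hcon
      rw [ENNReal.ofReal_toReal hz'] at this
      exact absurd hz this.not_gt
    filter_upwards [hH.closed s _ hH', gt_mem_nhds (show s < s + (z.toReal - y.toReal) by linarith)]
      with t ht hts
    by_contra! hcon
    have h2 := (hH.lossExcess_le_iff t y.toReal ENNReal.toReal_nonneg).1
      (by rwa [ENNReal.ofReal_toReal hy'])
    have h3 := ht.trans_le h2
    rw [EReal.coe_lt_coe_iff] at h3
    linarith
  mono x y hxy := by
    refine ENNReal.le_of_forall_le_ofReal fun r hr h => ?_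
    rcases eq_or_ne (lossExcess H y) ⊤ with hy | hy
    · simp [hy] at h
    rw [hH.lossExcess_le_iff x r hr]
    rw [← ENNReal.ofReal_toReal hy, ← ENNReal.ofReal_add ENNReal.toReal_nonneg (by linarith),
      ENNReal.ofReal_le_ofReal_iff hr] at h
    have hy' := (hH.lossExcess_le_iff y _ ENNReal.toReal_nonneg).1 (ENNReal.ofReal_toReal hy).ge
    refine (hH.mono hxy).trans (hy'.trans ?_)
    rw [EReal.coe_le_coe_iff]
    linarith
  growth := by
    obtain ⟨ε, hε, hball⟩ := Metric.mem_nhds_iff.1 (mem_interior_iff_mem_nhds.1 h1)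
    have key : ∀ y : ℝ, y ∈ Metric.ball (1 : ℝ) ε →
        ∃ C : ℝ, ∀ s : ℝ, ENNReal.ofReal (s * (y - 1) - C) ≤ lossExcess H s := by
      intro y hy
      have hlt : convexConj H y < ⊤ := hball hy
      obtain ⟨C, hC, -⟩ := EReal.lt_iff_exists_real_btwn.1 hlt
      refine ⟨C, fun s => ENNReal.le_of_forall_le_ofReal fun r hr h => ?_⟩
      have h2 := (hH.lossExcess_le_iff s r hr).1 h
      have h3 : ((s * y : ℝ) : EReal) - H s < C :=
        (le_iSup (fun s : ℝ => ((s * y : ℝ) : EReal) - H s) s).trans_lt hC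
      have h4 : ((s * y : ℝ) : EReal) - ((s + r : ℝ) : EReal) < C :=
        (EReal.sub_le_sub le_rfl h2).trans_lt h3
      rw [← EReal.coe_sub, EReal.coe_lt_coe_iff] at h4
      refine ENNReal.ofReal_le_ofReal ?_
      linarith
    -- Finiteness of the conjugate at `1 ± ε / 2` gives affine minorants of the excess with slopes
    -- `± ε / 2`, one for each sign of `s`.
    obtain ⟨C₁, hC₁⟩ := key (1 + ε / 2) (by simp [abs_of_pos, hε])
    obtain ⟨C₂, hC₂⟩ := key (1 - ε / 2) (by simp [abs_of_pos, hε])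
    refine ⟨ε / 2, max C₁ C₂, by linarith, fun s => ?_⟩
    rcases abs_cases s with ⟨h, -⟩ | ⟨h, -⟩ <;> rw [h]
    · refine (ENNReal.ofReal_le_ofReal ?_).trans (hC₁ s)
      have := le_max_left C₁ C₂
      linarith
    · refine (ENNReal.ofReal_le_ofReal ?_).trans (hC₂ s)
      have := le_max_right C₁ C₂
      linarith
  small δ hδ := by
    have h : ((-δ : ℝ) : EReal) < convexConj H 1 := by
      rw [hH.normalized]
      exact_mod_cast neg_lt_zero.2 hδ
    obtain ⟨s, hs⟩ := lt_iSup_iff.1 h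
    refine ⟨s, (hH.lossExcess_le_iff s δ hδ.le).2 ?_⟩
    rw [mul_one] at hs
    induction hHs : H s with
    | bot => simp
    | top => simp [hHs] at hs
    | coe x =>
      rw [hHs, ← EReal.coe_sub, EReal.coe_lt_coe_iff] at hs
      rw [EReal.coe_le_coe_iff]
      linarith

theorem IsLossFunction.isCoerciveLoss {H : ℝ → EReal} (hH : IsLossFunction H)
    (h1 : (1 : ℝ) ∈ interior {y : ℝ | convexConj H y < ⊤}) : IsCoerciveLoss H :=
  ⟨hH.isLossExcess h1, hH.eq_add_lossExcess⟩

/-! ### Infimal convolution -/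

namespace IsLossExcess

variable {L L₁ L₂ : ℝ → ENNReal}

theorem measurable (hL : IsLossExcess L) : Measurable L := hL.lsc.measurable

/-- The points `p` and `q` are convex combinations of `x` and `y` with interchanged weights, so the
two convexity inequalities add up. This is the exchange inequality behind the Lipschitz selection.
-/
theorem add_le_add_of_sum_eq (hL : IsLossExcess L) {x y p q : ℝ} (hxp : x ≤ p) (hpy : p ≤ y)
    (h : p + q = x + y) : L p + L q ≤ L x + L y := by
  rcases (hxp.trans hpy).eq_or_lt with rfl | hxy
  · obtain rfl : p = x := le_antisymm hpy hxp
    obtain rfl : q = p := by linarith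
    exact le_rfl
  set a := (y - p) / (y - x) with ha
  set b := (p - x) / (y - x) with hb
  have hd : 0 < y - x := by linarith
  have ha0 : 0 ≤ a := div_nonneg (by linarith) hd.le
  have hb0 : 0 ≤ b := div_nonneg (by linarith) hd.le
  have hab : a + b = 1 := by rw [ha, hb]; field_simp; ring
  have hp : p = a * x + b * y := by rw [ha, hb]; field_simp; ring
  have hq : q = b * x + a * y := by
    obtain rfl : q = x + y - p := by linarith
    rw [ha, hb]; field_simp; ring
  have hs : ENNReal.ofReal a + ENNReal.ofReal b = 1 := by
    rw [← ENNReal.ofReal_add ha0 hb0, hab, ENNReal.ofReal_one]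
  calc L p + L q ≤ (ENNReal.ofReal a * L x + ENNReal.ofReal b * L y)
        + (ENNReal.ofReal b * L x + ENNReal.ofReal a * L y) := by
          rw [hp, hq]
          exact add_le_add (hL.convex x y a b ha0 hb0 hab)
            (hL.convex x y b a hb0 ha0 (by linarith))
    _ = (ENNReal.ofReal a + ENNReal.ofReal b) * L x
        + (ENNReal.ofReal a + ENNReal.ofReal b) * L y := by ring
    _ = L x + L y := by rw [hs, one_mul, one_mul]

/-- Growth of `L₁` and lower semicontinuity make sublevel sets compact. The minimizers themselves
then form a compact set, which has a least element; this choice breaks ties consistently as `w`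
varies. -/
theorem exists_minimal_minimizer (h₁ : IsLossExcess L₁) (h₂ : IsLossExcess L₂) (w : ℝ)
    (hw : ∃ u, L₁ u + L₂ (w - u) ≠ ⊤) :
    ∃ u, (∀ u', L₁ u + L₂ (w - u) ≤ L₁ u' + L₂ (w - u')) ∧
      ∀ v, L₁ v + L₂ (w - v) ≤ L₁ u + L₂ (w - u) → u ≤ v := by
  obtain ⟨u₀, hu₀⟩ := hw
  obtain ⟨ε, C, hε, hC⟩ := h₁.growth
  set f : ℝ → ENNReal := fun u => L₁ u + L₂ (w - u) with hf
  have hf_lsc : LowerSemicontinuous f :=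
    h₁.lsc.add (h₂.lsc.comp (by fun_prop : Continuous fun u : ℝ => w - u))
  set r := (f u₀).toReal
  have hr : f u₀ = ENNReal.ofReal r := (ENNReal.ofReal_toReal hu₀).symm
  have hr0 : 0 ≤ r := ENNReal.toReal_nonneg
  have hbound : ∀ u, f u ≤ f u₀ → u ∈ Set.Icc (-((r + C) / ε)) ((r + C) / ε) := by
    intro u hu
    have h := ((hC u).trans (le_self_add.trans hu)).trans hr.le
    rw [ENNReal.ofReal_le_ofReal_iff hr0] at h
    rw [Set.mem_Icc, ← abs_le, le_div_iff₀ hε]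
    linarith
  set S : Set ℝ := {u | f u ≤ f u₀}
  have hu₀S : u₀ ∈ S := le_refl (f u₀)
  have hScomp : IsCompact S :=
    isCompact_Icc.of_isClosed_subset (hf_lsc.isClosed_preimage (f u₀)) hbound
  obtain ⟨v, hvS, hv⟩ := (hf_lsc.lowerSemicontinuousOn S).exists_isMinOn ⟨u₀, hu₀S⟩ hScomp
  have hmin : ∀ u', f v ≤ f u' := by
    intro u'
    by_cases hu' : u' ∈ S
    · exact hv hu'
    · exact (show f v ≤ f u₀ from hvS).trans (not_le.1 hu').le
  set S' : Set ℝ := {u | f u ≤ f v}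
  have hS'comp : IsCompact S' :=
    hScomp.of_isClosed_subset (hf_lsc.isClosed_preimage (f v)) fun u hu =>
      show f u ≤ f u₀ from (show f u ≤ f v from hu).trans hvS
  obtain ⟨u, huS, hu⟩ := hS'comp.exists_isLeast ⟨v, le_refl (f v)⟩
  exact ⟨u, fun u' => le_trans huS (hmin u'), fun x hx => hu (le_trans hx huS)⟩

/-- A `1`-Lipschitz selection of minimizers in the infimal convolution of `L₁` and `L₂`. -/
theorem exists_lipschitz_selector (h₁ : IsLossExcess L₁) (h₂ : IsLossExcess L₂) :
    ∃ g : ℝ → ℝ, LipschitzWith 1 g ∧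
      ∀ w u, L₁ (g w) + L₂ (w - g w) ≤ L₁ u + L₂ (w - u) := by
  set D : Set ℝ := {w | ∃ u, L₁ u + L₂ (w - u) ≠ ⊤}
  have hsel : ∀ w, ∃ u, w ∈ D → (∀ u', L₁ u + L₂ (w - u) ≤ L₁ u' + L₂ (w - u')) ∧
      ∀ v, L₁ v + L₂ (w - v) ≤ L₁ u + L₂ (w - u) → u ≤ v := by
    intro w
    by_cases hw : w ∈ D
    · obtain ⟨u, hu⟩ := exists_minimal_minimizer h₁ h₂ w hw
      exact ⟨u, fun _ => hu⟩
    · exact ⟨0, fun h => absurd h hw⟩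
  choose φ hφ using hsel
  have hfin : ∀ w ∈ D, L₁ (φ w) + L₂ (w - φ w) ≠ ⊤ := by
    intro w hw
    obtain ⟨u, hu⟩ := hw
    exact ne_top_of_le_ne_top hu ((hφ w ⟨u, hu⟩).1 u)
  -- If `φ w' < φ w`, interchanging the two choices does not increase the total by convexity of
  -- `L₂`, so `φ w'` also minimizes at `w`, against minimality of `φ w`.
  have hle : ∀ w ∈ D, ∀ w' ∈ D, w ≤ w' → φ w ≤ φ w' := by
    intro w hw w' hw' hww'
    by_contra! hlt
    have hex := h₂.add_le_add_of_sum_eq (x := w - φ w) (y := w' - φ w') (p := w - φ w')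
      (q := w' - φ w) (by linarith) (by linarith) (by ring)
    refine absurd ((hφ w hw).2 (φ w') ?_) (not_le.2 hlt)
    refine (ENNReal.add_le_add_iff_right (hfin w' hw')).1 ?_
    calc L₁ (φ w') + L₂ (w - φ w') + (L₁ (φ w') + L₂ (w' - φ w'))
        ≤ L₁ (φ w') + L₂ (w - φ w') + (L₁ (φ w) + L₂ (w' - φ w)) := by
          exact add_le_add le_rfl ((hφ w' hw').1 _)
      _ = L₁ (φ w') + L₁ (φ w) + (L₂ (w - φ w') + L₂ (w' - φ w)) := by ring
      _ ≤ L₁ (φ w') + L₁ (φ w) + (L₂ (w - φ w) + L₂ (w' - φ w')) := by gcongr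
      _ = L₁ (φ w) + L₂ (w - φ w) + (L₁ (φ w') + L₂ (w' - φ w')) := by ring
  -- The same exchange, now with convexity of `L₁`, shows that the other share `w - φ w` is
  -- nondecreasing: otherwise `φ w + (w' - w)` is a smaller minimizer at `w'`.
  have hle' : ∀ w ∈ D, ∀ w' ∈ D, w ≤ w' → φ w' ≤ φ w + (w' - w) := by
    intro w hw w' hw' hww'
    by_contra! hlt
    have hex := h₁.add_le_add_of_sum_eq (x := φ w) (y := φ w') (p := φ w' - (w' - w))
      (q := φ w + (w' - w)) (by linarith) (by linarith) (by ring)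
    refine absurd ((hφ w' hw').2 (φ w + (w' - w)) ?_) (not_le.2 hlt)
    refine (ENNReal.add_le_add_iff_left (hfin w hw)).1 ?_
    have e1 : w' - (φ w + (w' - w)) = w - φ w := by ring
    have e2 : w - (φ w' - (w' - w)) = w' - φ w' := by ring
    calc L₁ (φ w) + L₂ (w - φ w) + (L₁ (φ w + (w' - w)) + L₂ (w' - (φ w + (w' - w))))
        ≤ L₁ (φ w' - (w' - w)) + L₂ (w - (φ w' - (w' - w)))
          + (L₁ (φ w + (w' - w)) + L₂ (w' - (φ w + (w' - w)))) := by
          exact add_le_add ((hφ w hw).1 _) le_rfl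
      _ = L₁ (φ w' - (w' - w)) + L₁ (φ w + (w' - w)) + (L₂ (w' - φ w') + L₂ (w - φ w)) := by
          rw [e1, e2]; ring
      _ ≤ L₁ (φ w) + L₁ (φ w') + (L₂ (w' - φ w') + L₂ (w - φ w)) := by gcongr
      _ = L₁ (φ w) + L₂ (w - φ w) + (L₁ (φ w') + L₂ (w' - φ w')) := by ring
  have hlip : LipschitzOnWith 1 φ D := by
    refine LipschitzOnWith.of_le_add_mul 1 fun x hx y hy => ?_
    rw [NNReal.coe_one, one_mul, Real.dist_eq]
    rcases le_total x y with h | h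
    · have := hle x hx y hy h
      have := abs_nonneg (x - y)
      linarith
    · have := hle' y hy x hx h
      have := le_abs_self (x - y)
      linarith
  -- Outside `D` every split costs `⊤`, so any Lipschitz extension is a selection there too.
  obtain ⟨g, hg, hgφ⟩ := hlip.extend_real
  refine ⟨g, hg, fun w u => ?_⟩
  by_cases hw : w ∈ D
  · rw [← hgφ hw]
    exact (hφ w hw).1 u
  · have : L₁ u + L₂ (w - u) = ⊤ := by
      by_contra h
      exact hw ⟨u, h⟩
    rw [this]
    exact le_top

theorem infConv (h₁ : IsLossExcess L₁) (h₂ : IsLossExcess L₂) {g : ℝ → ℝ} (hg : Continuous g)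
    (hmin : ∀ w u, L₁ (g w) + L₂ (w - g w) ≤ L₁ u + L₂ (w - u)) :
    IsLossExcess fun w => L₁ (g w) + L₂ (w - g w) where
  convex x y a b ha hb hab := by
    refine (hmin _ (a * g x + b * g y)).trans ?_
    have e : a * x + b * y - (a * g x + b * g y) = a * (x - g x) + b * (y - g y) := by ring
    rw [e]
    refine (add_le_add (h₁.convex _ _ a b ha hb hab) (h₂.convex _ _ a b ha hb hab)).trans_eq ?_
    ring
  lsc := (h₁.lsc.comp hg).add (h₂.lsc.comp (by fun_prop))
  mono x y hxy := by
    -- This competitor leaves the argument of `L₂` as it was at `y`, so only `L₁` has to pay for the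
    -- shift.
    refine (hmin x (g y - (y - x))).trans ?_
    have e : x - (g y - (y - x)) = y - g y := by ring
    rw [e]
    refine (add_le_add_left (h₁.mono _ (g y) (by linarith)) _).trans_eq ?_
    rw [sub_sub_cancel]
    ring
  growth := by
    obtain ⟨ε₁, C₁, hε₁, hC₁⟩ := h₁.growth
    obtain ⟨ε₂, C₂, hε₂, hC₂⟩ := h₂.growth
    refine ⟨min ε₁ ε₂, C₁ + C₂, lt_min hε₁ hε₂, fun s => ?_⟩
    refine le_trans ?_ (add_le_add (hC₁ (g s)) (hC₂ (s - g s)))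
    refine le_trans (ENNReal.ofReal_le_ofReal ?_) ENNReal.ofReal_add_le
    have h1 : |s| ≤ |g s| + |s - g s| := by
      calc |s| = |g s + (s - g s)| := by congr 1; ring
        _ ≤ _ := abs_add_le _ _
    have h2 : min ε₁ ε₂ * |s| ≤ min ε₁ ε₂ * |g s| + min ε₁ ε₂ * |s - g s| := by
      rw [← mul_add]
      exact mul_le_mul_of_nonneg_left h1 (lt_min hε₁ hε₂).le
    have h3 : min ε₁ ε₂ * |g s| ≤ ε₁ * |g s| :=
      mul_le_mul_of_nonneg_right (min_le_left _ _) (abs_nonneg _)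
    have h4 : min ε₁ ε₂ * |s - g s| ≤ ε₂ * |s - g s| :=
      mul_le_mul_of_nonneg_right (min_le_right _ _) (abs_nonneg _)
    linarith
  small δ hδ := by
    obtain ⟨r₁, hr₁⟩ := h₁.small (δ / 2) (by linarith)
    obtain ⟨r₂, hr₂⟩ := h₂.small (δ / 2) (by linarith)
    refine ⟨r₁ + r₂, (hmin _ r₁).trans ?_⟩
    rw [add_sub_cancel_left]
    refine (add_le_add hr₁ hr₂).trans_eq ?_
    rw [← ENNReal.ofReal_add (by linarith) (by linarith)]
    congr 1
    ring

end IsLossExcess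

/-! ### Convex minimization in Hilbert spaces -/

/-- A decreasing sequence of nonempty bounded closed convex sets in a Hilbert space has nonempty
intersection. -/
theorem nonempty_iInter_of_antitone_convex {E : Type*} [NormedAddCommGroup E]
    [InnerProductSpace ℝ E] [CompleteSpace E] {C : ℕ → Set E} (hanti : Antitone C)
    (hne : ∀ n, (C n).Nonempty) (hcl : ∀ n, IsClosed (C n)) (hconv : ∀ n, Convex ℝ (C n))
    {K : ℝ} (hK : ∀ x ∈ C 0, ‖x‖ ≤ K) : (⋂ n, C n).Nonempty := by
  have hproj : ∀ n, ∃ v ∈ C n, ∀ w ∈ C n, ‖v‖ ≤ ‖w‖ := by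
    intro n
    obtain ⟨v, hv, hmin⟩ :=
      exists_norm_eq_iInf_of_complete_convex (hne n) (hcl n).isComplete (hconv n) 0
    refine ⟨v, hv, fun w hw => ?_⟩
    have hbdd : BddBelow (Set.range fun w : C n => ‖(0 : E) - w‖) :=
      ⟨0, Set.forall_mem_range.2 fun _ => norm_nonneg _⟩
    have := ciInf_le hbdd ⟨w, hw⟩
    rw [← hmin] at this
    simpa using this
  choose v hvC hvmin using hproj
  have hmono : Monotone fun n => ‖v n‖ := fun n k hnk => hvmin n _ (hanti hnk (hvC k))
  have hbdd : BddAbove (Set.range fun n => ‖v n‖) :=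
    ⟨K, Set.forall_mem_range.2 fun n => hK _ (hanti (Nat.zero_le n) (hvC n))⟩
  have hlim := tendsto_atTop_ciSup hmono hbdd
  set ℓ := ⨆ n, ‖v n‖ with hℓ
  have hle : ∀ n, ‖v n‖ ≤ ℓ := le_ciSup hbdd
  have hdist : ∀ n k, n ≤ k → dist (v n) (v k) ≤ Real.sqrt (2 * (ℓ ^ 2 - ‖v n‖ ^ 2)) := by
    intro n k hnk
    -- The midpoint lies in `C n`, so its norm is at least `‖v n‖`; the parallelogram law turns
    -- convergence of the norms into the Cauchy property.
    have hmid : (1 / 2 : ℝ) • v n + (1 / 2 : ℝ) • v k ∈ C n :=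
      hconv n (hvC n) (hanti hnk (hvC k)) (by norm_num) (by norm_num) (by norm_num)
    have h1 := hvmin n _ hmid
    rw [← smul_add, norm_smul, Real.norm_of_nonneg (by norm_num : (0 : ℝ) ≤ 1 / 2)] at h1
    have h2 := parallelogram_law_with_norm ℝ (v n) (v k)
    have h3 := hle k
    have h4 := norm_nonneg (v n)
    have h5 := norm_nonneg (v k)
    rw [dist_eq_norm]
    refine Real.le_sqrt_of_sq_le ?_
    have h6 : (2 * ‖v n‖) ^ 2 ≤ ‖v n + v k‖ ^ 2 := pow_le_pow_left₀ (by positivity) (by linarith) 2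
    have h7 : ‖v k‖ ^ 2 ≤ ℓ ^ 2 := pow_le_pow_left₀ h5 h3 2
    nlinarith
  have hcauchy : CauchySeq v := by
    refine cauchySeq_of_le_tendsto_0' (fun n => Real.sqrt (2 * (ℓ ^ 2 - ‖v n‖ ^ 2)))
      (fun n k hnk => hdist n k hnk) ?_
    have : Tendsto (fun n => Real.sqrt (2 * (ℓ ^ 2 - ‖v n‖ ^ 2))) atTop
        (nhds (Real.sqrt (2 * (ℓ ^ 2 - ℓ ^ 2)))) :=
      (((hlim.pow 2).const_sub (ℓ ^ 2)).const_mul 2).sqrt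
    simpa using this
  obtain ⟨x, hx⟩ := cauchySeq_tendsto_of_complete hcauchy
  refine ⟨x, Set.mem_iInter.2 fun n => (hcl n).mem_of_tendsto hx ?_⟩
  filter_upwards [eventually_ge_atTop n] with k hk using hanti hk (hvC k)

/-- A functional with closed convex sublevel sets on a bounded set attains its infimum there. -/
theorem exists_forall_le_of_closed_convex_sublevel {E : Type*} [NormedAddCommGroup E]
    [InnerProductSpace ℝ E] [CompleteSpace E] {S : Set E} (hS : S.Nonempty) {K : ℝ}
    (hK : ∀ x ∈ S, ‖x‖ ≤ K) {F : E → ENNReal}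
    (hcl : ∀ r, IsClosed {x | x ∈ S ∧ F x ≤ r}) (hconv : ∀ r, Convex ℝ {x | x ∈ S ∧ F x ≤ r}) :
    ∃ x ∈ S, ∀ y ∈ S, F x ≤ F y := by
  obtain ⟨u, hanti, hlim, hu⟩ := exists_seq_tendsto_sInf (hS.image F) (OrderBot.bddBelow _)
  choose y hyS hyu using hu
  have hne : ∀ n, {x | x ∈ S ∧ F x ≤ u n}.Nonempty := fun n => ⟨y n, hyS n, (hyu n).le⟩
  obtain ⟨x, hx⟩ := nonempty_iInter_of_antitone_convex (C := fun n => {x | x ∈ S ∧ F x ≤ u n})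
    (fun n k hnk x hx => ⟨hx.1, hx.2.trans (hanti hnk)⟩) hne (fun n => hcl _) (fun n => hconv _)
    (fun x hx => hK x hx.1)
  rw [Set.mem_iInter] at hx
  refine ⟨x, (hx 0).1, fun z hz => ?_⟩
  refine (ge_of_tendsto' hlim fun n => (hx n).2).trans (sInf_le (Set.mem_image_of_mem F hz))

/-! ### Measurable convex minimization -/

section Minimizer

variable {Ω : Type*} {m mΩ : MeasurableSpace Ω} {μ : Measure Ω} {E : Type*}
  [NormedAddCommGroup E] [MeasurableSpace E] [BorelSpace E] {ψ : Ω → E → ENNReal}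

/-- Convergence in `L²` gives an almost everywhere convergent subsequence; lower semicontinuity and
Fatou's lemma then pass the bound to the limit. -/
theorem isClosed_setOf_lintegral_le (hm : m ≤ mΩ) [IsFiniteMeasure μ]
    (hψ_meas : ∀ x : Ω → E, Measurable x → Measurable fun ω => ψ ω (x ω))
    (hψ_lsc : ∀ ω, LowerSemicontinuous (ψ ω)) (K : ℝ) (r : ENNReal) :
    IsClosed {f : Lp E 2 (μ.trim hm) |
      (∀ᵐ ω ∂μ, ‖f ω‖ ≤ K) ∧ ∫⁻ ω, ψ ω (f ω) ∂μ ≤ r} := by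
  refine IsSeqClosed.isClosed fun f g hf hfg => ?_
  obtain ⟨ns, -, hns⟩ := (tendstoInMeasure_of_tendsto_Lp hfg).exists_seq_tendsto_ae
  have hns' : ∀ᵐ ω ∂μ, Tendsto (fun i => f (ns i) ω) atTop (nhds (g ω)) := ae_of_ae_trim hm hns
  refine ⟨?_, ?_⟩
  · filter_upwards [hns', ae_all_iff.2 fun i => (hf (ns i)).1] with ω h1 h2
    exact le_of_tendsto' h1.norm h2
  · have hmeas : ∀ i, Measurable fun ω => ψ ω (f (ns i) ω) := fun i =>
      hψ_meas _ ((Lp.stronglyMeasurable (f (ns i))).measurable.mono hm le_rfl)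
    calc ∫⁻ ω, ψ ω (g ω) ∂μ ≤ ∫⁻ ω, liminf (fun i => ψ ω (f (ns i) ω)) atTop ∂μ := by
          refine lintegral_mono_ae ?_
          filter_upwards [hns'] with ω h
          exact ((lowerSemicontinuousAt_iff_le_liminf.1 (hψ_lsc ω (g ω)))).trans
            (liminf_le_liminf_of_le h)
      _ ≤ liminf (fun i => ∫⁻ ω, ψ ω (f (ns i) ω) ∂μ) atTop := lintegral_liminf_le hmeas
      _ ≤ r := liminf_le_of_le (by isBoundedDefault) fun b hb => by
          obtain ⟨i, hi⟩ := hb.exists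
          exact hi.trans (hf (ns i)).2

theorem convex_setOf_lintegral_le [InnerProductSpace ℝ E] (hm : m ≤ mΩ)
    (hψ_meas : ∀ x : Ω → E, Measurable x → Measurable fun ω => ψ ω (x ω))
    (hψ_conv : ∀ ω x y (a b : ℝ), 0 ≤ a → 0 ≤ b → a + b = 1 →
      ψ ω (a • x + b • y) ≤ ENNReal.ofReal a * ψ ω x + ENNReal.ofReal b * ψ ω y)
    (K : ℝ) (r : ENNReal) :
    Convex ℝ {f : Lp E 2 (μ.trim hm) |
      (∀ᵐ ω ∂μ, ‖f ω‖ ≤ K) ∧ ∫⁻ ω, ψ ω (f ω) ∂μ ≤ r} := by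
  intro f hf g hg a b ha hb hab
  have h1 : ∀ᵐ ω ∂μ, (a • f + b • g : Lp E 2 (μ.trim hm)) ω = a • f ω + b • g ω := by
    refine ae_of_ae_trim hm ?_
    filter_upwards [Lp.coeFn_add (a • f) (b • g), Lp.coeFn_smul a f, Lp.coeFn_smul b g]
      with ω h1 h2 h3
    rw [h1, Pi.add_apply, h2, h3, Pi.smul_apply, Pi.smul_apply]
  refine ⟨?_, ?_⟩
  · filter_upwards [h1, hf.1, hg.1] with ω h1 h2 h3
    rw [h1]
    calc ‖a • f ω + b • g ω‖ ≤ ‖a • f ω‖ + ‖b • g ω‖ := norm_add_le _ _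
      _ = a * ‖f ω‖ + b * ‖g ω‖ := by
        rw [norm_smul, norm_smul, Real.norm_of_nonneg ha, Real.norm_of_nonneg hb]
      _ ≤ a * K + b * K := by gcongr
      _ = K := by rw [← add_mul, hab, one_mul]
  · have hmeas : ∀ f : Lp E 2 (μ.trim hm), Measurable fun ω => ψ ω (f ω) := fun f =>
      hψ_meas _ ((Lp.stronglyMeasurable f).measurable.mono hm le_rfl)
    calc ∫⁻ ω, ψ ω ((a • f + b • g : Lp E 2 (μ.trim hm)) ω) ∂μ
        ≤ ∫⁻ ω, (ENNReal.ofReal a * ψ ω (f ω) + ENNReal.ofReal b * ψ ω (g ω)) ∂μ := by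
          refine lintegral_mono_ae ?_
          filter_upwards [h1] with ω h1
          rw [h1]
          exact hψ_conv ω _ _ a b ha hb hab
      _ = ENNReal.ofReal a * ∫⁻ ω, ψ ω (f ω) ∂μ + ENNReal.ofReal b * ∫⁻ ω, ψ ω (g ω) ∂μ := by
          rw [lintegral_add_left ((hmeas f).const_mul _), lintegral_const_mul _ (hmeas f),
            lintegral_const_mul _ (hmeas g)]
      _ ≤ ENNReal.ofReal a * r + ENNReal.ofReal b * r := by
          gcongr
          exacts [hf.2, hg.2]
      _ = r := by rw [← add_mul, ← ENNReal.ofReal_add ha hb, hab, ENNReal.ofReal_one, one_mul]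

/-- Conditional minimization of a coercive convex normal integrand: there is an `m`-measurable
minimizer of the conditional expectation. -/
theorem exists_measurable_condLExp_minimizer [InnerProductSpace ℝ E] [FiniteDimensional ℝ E]
    (hm : m ≤ mΩ) [IsProbabilityMeasure μ]
    (hψ_meas : ∀ x : Ω → E, Measurable x → Measurable fun ω => ψ ω (x ω))
    (hψ_conv : ∀ ω x y (a b : ℝ), 0 ≤ a → 0 ≤ b → a + b = 1 →
      ψ ω (a • x + b • y) ≤ ENNReal.ofReal a * ψ ω x + ENNReal.ofReal b * ψ ω y)
    (hψ_lsc : ∀ ω, LowerSemicontinuous (ψ ω)) (x₀ : E) (C : ENNReal) (hC : C ≠ ⊤) (K : ℝ)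
    (hx₀ : ‖x₀‖ ≤ K) (hψ_x₀ : ∀ᵐ ω ∂μ, ψ ω x₀ ≤ C)
    (hψ_growth : ∀ᵐ ω ∂μ, ∀ x, K < ‖x‖ → C ≤ ψ ω x) :
    ∃ x : Ω → E, Measurable[m] x ∧ (∀ ω, ‖x ω‖ ≤ K) ∧
      ∀ y : Ω → E, Measurable[m] y →
        condLExp m μ (fun ω => ψ ω (x ω)) ≤ᵐ[μ] condLExp m μ (fun ω => ψ ω (y ω)) := by
  have hK0 : 0 ≤ K := (norm_nonneg _).trans hx₀
  -- bounded measurable functions as elements of `L²`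
  have htoLp : ∀ y : Ω → E, Measurable[m] y → (∀ ω, ‖y ω‖ ≤ K) →
      ∃ f : Lp E 2 (μ.trim hm), ∀ᵐ ω ∂μ, f ω = y ω := by
    intro y hy hyK
    have hmem : MemLp y 2 (μ.trim hm) :=
      MemLp.of_bound hy.stronglyMeasurable.aestronglyMeasurable K (.of_forall hyK)
    exact ⟨hmem.toLp y, ae_of_ae_trim hm hmem.coeFn_toLp⟩
  obtain ⟨f₀, hf₀⟩ := htoLp (fun _ => x₀) measurable_const (fun _ => hx₀)
  -- The unconditional integral is minimized over functions valued in a ball. Working over the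
  -- trimmed measure makes every element `m`-measurable.
  set S : Set (Lp E 2 (μ.trim hm)) := {f | ∀ᵐ ω ∂μ, ‖f ω‖ ≤ K} with hS
  obtain ⟨f, hfS, hf⟩ := exists_forall_le_of_closed_convex_sublevel (S := S)
    (F := fun f => ∫⁻ ω, ψ ω (f ω) ∂μ) (K := K)
    ⟨f₀, by filter_upwards [hf₀] with ω h; rw [h]; exact hx₀⟩
    (fun f hf => by
      have h : ∀ᵐ ω ∂(μ.trim hm), ‖f ω‖ ≤ K := by
        exact (StronglyMeasurable.ae_le_trim_iff hm (Lp.stronglyMeasurable f).norm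
          (stronglyMeasurable_const (b := K))).2 hf
      have h1 : measureUnivNNReal (μ.trim hm) = 1 := by
        rw [← ENNReal.coe_inj, coe_measureUnivNNReal, trim_measurableSet_eq hm .univ]
        simp
      simpa [h1] using Lp.norm_le_of_ae_bound hK0 h)
    (fun r => isClosed_setOf_lintegral_le hm hψ_meas hψ_lsc K r)
    (fun r => convex_setOf_lintegral_le hm hψ_meas hψ_conv K r)
  classical
  have hfm : Measurable[m] f := (Lp.stronglyMeasurable f).measurable
  -- The bound on `f` holds only almost everywhere; this version satisfies it everywhere.
  set x : Ω → E := fun ω => if ‖f ω‖ ≤ K then f ω else x₀ with hx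
  have hxm : Measurable[m] x :=
    Measurable.ite ((measurable_norm.comp hfm) measurableSet_Iic) hfm measurable_const
  have hxK : ∀ ω, ‖x ω‖ ≤ K := by
    intro ω
    by_cases h : ‖f ω‖ ≤ K <;> simp [hx, h, hx₀]
  have hxf : ∀ᵐ ω ∂μ, f ω = x ω := by
    filter_upwards [hfS] with ω h
    simp [hx, h]
  have hxmin : ∀ y : Ω → E, Measurable[m] y → (∀ ω, ‖y ω‖ ≤ K) →
      ∫⁻ ω, ψ ω (x ω) ∂μ ≤ ∫⁻ ω, ψ ω (y ω) ∂μ := by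
    intro y hy hyK
    obtain ⟨g, hg⟩ := htoLp y hy hyK
    have h := hf g (by filter_upwards [hg] with ω h; rw [h]; exact hyK ω)
    calc ∫⁻ ω, ψ ω (x ω) ∂μ = ∫⁻ ω, ψ ω (f ω) ∂μ :=
          lintegral_congr_ae (by filter_upwards [hxf] with ω h; rw [h])
      _ ≤ ∫⁻ ω, ψ ω (g ω) ∂μ := h
      _ = ∫⁻ ω, ψ ω (y ω) ∂μ := lintegral_congr_ae (by filter_upwards [hg] with ω h; rw [h])
  have hfin : ∫⁻ ω, ψ ω (x ω) ∂μ ≠ ⊤ := by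
    refine ne_top_of_le_ne_top hC ((hxmin (fun _ => x₀) measurable_const fun _ => hx₀).trans ?_)
    refine (lintegral_mono_ae hψ_x₀).trans ?_
    simp
  refine ⟨x, hxm, hxK, fun y hy => ?_⟩
  refine ae_le_of_ae_le_trim (hm := hm) ?_
  refine ae_le_of_forall_setLIntegral_le_of_sigmaFinite (μ := μ.trim hm)
    (measurable_condLExp m μ _) fun s hs _ => ?_
  rw [setLIntegral_condLExp_trim hm _ _ hs, setLIntegral_condLExp_trim hm _ _ hs]
  -- paste `y`, where it is within the bounds, into the minimizer on `s`
  set y' : Ω → E := fun ω => if ‖y ω‖ ≤ K then y ω else x₀ with hy'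
  have hy'm : Measurable[m] y' :=
    Measurable.ite ((measurable_norm.comp hy) measurableSet_Iic) hy measurable_const
  have hy'K : ∀ ω, ‖y' ω‖ ≤ K := by
    intro ω
    by_cases h : ‖y ω‖ ≤ K <;> simp [hy', h, hx₀]
  set z : Ω → E := s.piecewise y' x with hz
  have hzm : Measurable[m] z := Measurable.piecewise hs hy'm hxm
  have hzK : ∀ ω, ‖z ω‖ ≤ K := by
    intro ω
    by_cases h : ω ∈ s <;> simp [hz, h, hy'K, hxK]
  have hmin := hxmin z hzm hzK
  rw [← lintegral_add_compl _ (hm s hs), ← lintegral_add_compl (fun ω => ψ ω (z ω)) (hm s hs)]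
    at hmin
  have hz1 : ∫⁻ ω in s, ψ ω (z ω) ∂μ = ∫⁻ ω in s, ψ ω (y' ω) ∂μ :=
    setLIntegral_congr_fun (hm s hs) fun ω hω => by simp [hz, hω]
  have hz2 : ∫⁻ ω in sᶜ, ψ ω (z ω) ∂μ = ∫⁻ ω in sᶜ, ψ ω (x ω) ∂μ :=
    setLIntegral_congr_fun (hm s hs).compl fun ω hω => by
      have : ω ∉ s := hω
      simp [hz, this]
  rw [hz1, hz2] at hmin
  have hfin' : ∫⁻ ω in sᶜ, ψ ω (x ω) ∂μ ≠ ⊤ :=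
    ne_top_of_le_ne_top hfin (setLIntegral_le_lintegral _ _)
  refine ((ENNReal.add_le_add_iff_right hfin').1 hmin).trans ?_
  refine lintegral_mono_ae (ae_restrict_of_ae ?_)
  -- Where `y` leaves the ball, `y'` is `x₀`, whose value is at most `C`, and the growth condition
  -- puts `y` above `C`.
  filter_upwards [hψ_x₀, hψ_growth] with ω h1 h2
  by_cases h : ‖y ω‖ ≤ K
  · simp [hy', h]
  · simp only [hy', h, if_false]
    exact h1.trans (h2 _ (not_le.1 h))

end Minimizer

/-! ### Extended real arithmetic -/

theorem EReal.le_coe_sub_comm {x y : EReal} {r : ℝ} (h : x ≤ (r : EReal) - y) :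
    y ≤ (r : EReal) - x := by
  rw [EReal.le_sub_iff_add_le (by simp) (by simp)] at h ⊢
  rwa [add_comm]

theorem EReal.coe_sub_coe_ennreal {K : ℝ} {R : ENNReal} (hR : R ≠ ⊤) :
    (K : EReal) - (R : EReal) = ((K - R.toReal : ℝ) : EReal) := by
  rw [← EReal.coe_ennreal_toReal hR, EReal.coe_sub]

theorem EReal.coe_le_of_forall_sub_le {r : ℝ} {b : EReal}
    (h : ∀ n : ℕ, ((r - 1 / ((n : ℝ) + 1) : ℝ) : EReal) ≤ b) : (r : EReal) ≤ b := by
  have h1 : Tendsto (fun n : ℕ => r - 1 / ((n : ℝ) + 1)) atTop (nhds r) := by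
    simpa using tendsto_one_div_add_atTop_nhds_zero_nat.const_sub r
  exact le_of_tendsto' ((continuous_coe_real_ereal.tendsto r).comp h1) h

theorem EReal.coe_max_real (x y : ℝ) : ((max x y : ℝ) : EReal) = max (x : EReal) y :=
  EReal.coe_strictMono.monotone.map_max

theorem EReal.coe_min_real (x y : ℝ) : ((min x y : ℝ) : EReal) = min (x : EReal) y :=
  EReal.coe_strictMono.monotone.map_min

/-- The truncation `(x ∧ b) ∨ a` of an extended real number, as a real number. -/
noncomputable def truncReal (a b : ℝ) (x : EReal) : ℝ :=
  (max (a : EReal) (min x (b : EReal))).toReal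

theorem truncReal_coe (a b x : ℝ) : truncReal a b (x : EReal) = max a (min x b) := by
  rw [truncReal, ← EReal.coe_min_real, ← EReal.coe_max_real, EReal.toReal_coe]

theorem truncReal_top (a b : ℝ) : truncReal a b ⊤ = max a b := by
  rw [truncReal, min_eq_right le_top, ← EReal.coe_max_real, EReal.toReal_coe]

theorem truncReal_bot (a b : ℝ) : truncReal a b ⊥ = a := by
  rw [truncReal, min_eq_left bot_le, max_eq_left bot_le, EReal.toReal_coe]

theorem coe_truncReal (a b : ℝ) (x : EReal) :
    (truncReal a b x : EReal) = max (a : EReal) (min x (b : EReal)) := by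
  induction x with
  | bot => rw [truncReal_bot, min_eq_left bot_le, max_eq_left bot_le]
  | top => rw [truncReal_top, min_eq_right le_top, EReal.coe_max_real]
  | coe x => rw [truncReal_coe, EReal.coe_max_real, EReal.coe_min_real]

theorem truncReal_mono {a b : ℝ} {x y : EReal} (h : x ≤ y) : truncReal a b x ≤ truncReal a b y := by
  rw [← EReal.coe_le_coe_iff, coe_truncReal, coe_truncReal]
  gcongr

theorem abs_truncReal_le (n k : ℕ) (x : EReal) : |truncReal (-(k : ℝ)) n x| ≤ n + k := by
  have hn : (0 : ℝ) ≤ n := Nat.cast_nonneg n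
  have hk : (0 : ℝ) ≤ k := Nat.cast_nonneg k
  induction x with
  | bot => rw [truncReal_bot, abs_neg, abs_of_nonneg hk]; linarith
  | top => rw [truncReal_top, max_eq_right (by linarith), abs_of_nonneg hn]; linarith
  | coe x =>
    rw [truncReal_coe, abs_le]
    constructor
    · exact le_trans (by linarith) (le_max_left _ _)
    · exact max_le (by linarith) ((min_le_right _ _).trans (by linarith))

theorem measurable_truncReal (a b : ℝ) : Measurable (truncReal a b) :=
  measurable_ereal_toReal.comp (measurable_const.max (measurable_id.min measurable_const))

/-- Widening the truncation window by `j` on the appropriate side absorbs a shift of size at most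
`j`. -/
theorem truncReal_add_le (n k j : ℕ) (x : EReal) {r : ℝ} (hr : |r| ≤ j) :
    truncReal (-((k + j : ℕ) : ℝ)) n (x + (r : EReal)) ≤
      truncReal (-(k : ℝ)) ((n + j : ℕ) : ℝ) x + r := by
  have h := abs_le.1 hr
  push_cast
  induction x with
  | bot => rw [EReal.bot_add, truncReal_bot, truncReal_bot]; linarith
  | top =>
    rw [EReal.top_add_coe, truncReal_top, truncReal_top]
    have := le_max_right (-(k : ℝ)) (n + j)
    have : (0 : ℝ) ≤ n := Nat.cast_nonneg n
    have : (0 : ℝ) ≤ k := Nat.cast_nonneg k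
    exact max_le (by linarith) (by linarith)
  | coe x =>
    rw [← EReal.coe_add, truncReal_coe, truncReal_coe]
    have h1 := le_max_left (-(k : ℝ)) (min x (n + j))
    have h2 := le_max_right (-(k : ℝ)) (min x (n + j))
    refine max_le (by linarith) ?_
    rcases min_cases x ((n : ℝ) + j) with ⟨h3, -⟩ | ⟨h3, -⟩
    · exact (min_le_left _ _).trans (by linarith)
    · exact (min_le_right _ _).trans (by linarith)

/-- Reflection interchanges the two truncation levels: the upper one of `z - y` is matched by the
lower one of `y`, and conversely. The margin `j` absorbs `z`. -/
theorem truncReal_sub_le (n n' j : ℕ) (y : EReal) {z : ℝ} (hz : |z| ≤ j) :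
    truncReal (-((n + j : ℕ) : ℝ)) n' ((z : EReal) - y) ≤
      z - truncReal (-((n' + j : ℕ) : ℝ)) n y := by
  have h := abs_le.1 hz
  have hn : (0 : ℝ) ≤ n := Nat.cast_nonneg n
  have hn' : (0 : ℝ) ≤ n' := Nat.cast_nonneg n'
  push_cast
  induction y with
  | bot =>
    rw [EReal.coe_sub_bot, truncReal_bot, truncReal_top]
    exact max_le (by linarith) (by linarith)
  | top =>
    rw [EReal.sub_top, truncReal_bot, truncReal_top, max_eq_right (by linarith)]
    linarith
  | coe y =>
    rw [← EReal.coe_sub, truncReal_coe, truncReal_coe]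
    rw [le_sub_comm]
    refine max_le ?_ ?_
    · rw [le_sub_comm]
      refine max_le (by linarith) ((min_le_right _ _).trans (by linarith))
    · rw [le_sub_comm]
      refine max_le ?_ ((min_le_left _ _).trans ?_)
      · have := min_le_right y (n : ℝ)
        linarith
      · have := min_le_left y (n : ℝ)
        linarith

/-! ### Conditional expectations of nonnegative random variables -/

section CondLExp

variable {Ω : Type*} {m mΩ : MeasurableSpace Ω} {μ : Measure Ω}

/-- Compare integrals over `A ∩ s` for known events `s`. The localization to `A` lets later
arguments treat unbounded known variables on events where they are bounded. -/
theorem condLExp_mono_on (hm : m ≤ mΩ) [IsFiniteMeasure μ] {f g : Ω → ENNReal} {A : Set Ω}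
    (hA : MeasurableSet[m] A) (h : ∀ᵐ ω ∂μ, ω ∈ A → f ω ≤ g ω) :
    ∀ᵐ ω ∂μ, ω ∈ A → condLExp m μ f ω ≤ condLExp m μ g ω := by
  have key : A.indicator (condLExp m μ f) ≤ᵐ[μ] A.indicator (condLExp m μ g) := by
    refine ae_le_of_ae_le_trim (hm := hm) ?_
    refine ae_le_of_forall_setLIntegral_le_of_sigmaFinite (μ := μ.trim hm)
      ((measurable_condLExp m μ f).indicator hA) fun s hs _ => ?_
    rw [setLIntegral_indicator hA, setLIntegral_indicator hA,
      setLIntegral_condLExp_trim hm _ _ (hA.inter hs),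
      setLIntegral_condLExp_trim hm _ _ (hA.inter hs)]
    refine setLIntegral_mono_ae' (hm _ (hA.inter hs)) ?_
    filter_upwards [h] with ω hω hωA using hω hωA.1
  filter_upwards [key] with ω hω hωA
  simpa [hωA] using hω

theorem condLExp_add_measurable (hm : m ≤ mΩ) [IsFiniteMeasure μ] (f : Ω → ENNReal)
    {g : Ω → ENNReal} (hg : Measurable[m] g) :
    condLExp m μ (fun ω => f ω + g ω) =ᵐ[μ] fun ω => condLExp m μ f ω + g ω := by
  have h := condLExp_add_right (mΩ := m) (P := μ) f (hg.mono hm le_rfl).aemeasurable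
  rw [condLExp_eq_self hm μ hg] at h
  exact h

end CondLExp

/-! ### Optimized certainty equivalents of bounded random variables -/

section OceBounded

variable {Ω : Type*} {m mΩ : MeasurableSpace Ω} {μ : Measure Ω} [IsProbabilityMeasure μ]
  {H : ℝ → EReal}

/-- For `|X| ≤ K` and constant `σ = s`, the conditional expectation of the nonnegative random
variable `(K - s) + H (s - X)`. -/
noncomputable def condLoss (m : MeasurableSpace Ω) {mΩ : MeasurableSpace Ω} (μ : Measure Ω)
    (L : ℝ → ENNReal) (K : ℝ) (X σ : Ω → ℝ) : Ω → ENNReal :=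
  condLExp m μ fun ω => ENNReal.ofReal (K - X ω) + L (σ ω - X ω)

/-- This is `s - H (s - x) = K - ((K - x) + L (s - x))`, with all negative parts moved across so
that every term lies in `ENNReal`. -/
theorem lossExcess_add_eq (hH : IsCoerciveLoss H) {K x s : ℝ} (hx : |x| ≤ K) :
    (ENNReal.ofReal (K - x) + lossExcess H (s - x))
        + ((-H (s - x)).toENNReal + ENNReal.ofReal (s - K))
      = (H (s - x)).toENNReal + ENNReal.ofReal (K - s) := by
  rw [hH.eq_add (s - x)]
  have hxK := le_trans (le_abs_self x) hx
  induction hL : lossExcess H (s - x) with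
  | top =>
    rw [EReal.coe_ennreal_top, EReal.coe_add_top]
    simp
  | coe l =>
    have hl : (((l : NNReal) : ENNReal) : EReal) = ((l : ℝ) : EReal) := rfl
    rw [hl, ← EReal.coe_add, ← EReal.coe_neg, EReal.toENNReal_of_ne_top (EReal.coe_ne_top _),
      EReal.toENNReal_of_ne_top (EReal.coe_ne_top _), EReal.toReal_coe, EReal.toReal_coe,
      ← ENNReal.toReal_eq_toReal_iff' (by finiteness) (by finiteness)]
    repeat rw [ENNReal.toReal_add (by finiteness) (by finiteness)]
    simp only [ENNReal.toReal_ofReal', ENNReal.coe_toReal]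
    have hl0 : (0 : ℝ) ≤ l := l.2
    rw [max_eq_left (by linarith : (0 : ℝ) ≤ K - x)]
    rcases max_cases (-(s - x + (l : ℝ))) 0 with ⟨h1, h1'⟩ | ⟨h1, h1'⟩ <;>
    rcases max_cases (s - x + (l : ℝ)) 0 with ⟨h2, h2'⟩ | ⟨h2, h2'⟩ <;>
    rcases max_cases (s - K) 0 with ⟨h3, h3'⟩ | ⟨h3, h3'⟩ <;>
    rcases max_cases (K - s) 0 with ⟨h4, h4'⟩ | ⟨h4, h4'⟩ <;>
    rw [h1, h2, h3, h4] <;> linarith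

theorem coe_sub_condExpExt (hm : m ≤ mΩ) (hH : IsCoerciveLoss H) {X : Ω → ℝ} (hX : Measurable X)
    {K : ℝ} (hK : ∀ ω, |X ω| ≤ K) (s : ℝ) :
    ∀ᵐ ω ∂μ, (s : EReal) - condExpExt m μ (fun ω' => H (s - X ω')) ω
      = (K : EReal) - (condLoss m μ (lossExcess H) K X (fun _ => s) ω : EReal) := by
  have hHmeas : Measurable H := by
    have : H = fun s : ℝ => (s : EReal) + (lossExcess H s : EReal) := funext hH.eq_add
    rw [this]
    exact measurable_coe_real_ereal.add hH.excess.measurable.coe_ereal_ennreal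
  have hHX : Measurable fun ω => H (s - X ω) := hHmeas.comp (hX.const_sub s)
  have hneg : Measurable fun ω => (-H (s - X ω)).toENNReal := hHX.neg.ereal_toENNReal
  -- Since `H (s - X) ≥ s - X ≥ -(|s| + K)`, the negative part is bounded and no `∞ - ∞` can occur.
  have hfin : ∀ᵐ ω ∂μ, condLExp m μ (fun ω => (-H (s - X ω)).toENNReal) ω ≠ ⊤ := by
    have hle : ∀ ω, (-H (s - X ω)).toENNReal ≤ ENNReal.ofReal (|s| + K) := by
      intro ω
      have h1 : ((-(|s| + K) : ℝ) : EReal) ≤ H (s - X ω) := by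
        rw [hH.eq_add]
        refine le_trans ?_ (le_add_of_nonneg_right (EReal.coe_ennreal_nonneg _))
        rw [EReal.coe_le_coe_iff]
        have := abs_le.1 (hK ω)
        have := neg_abs_le s
        linarith
      have h2 : -H (s - X ω) ≤ ((|s| + K : ℝ) : EReal) := by
        rw [EReal.neg_le, ← EReal.coe_neg]
        exact h1
      refine (EReal.toENNReal_le_toENNReal h2).trans_eq ?_
      rw [EReal.toENNReal_of_ne_top (EReal.coe_ne_top _), EReal.toReal_coe]
    refine condLExp_ne_top (ne_top_of_le_ne_top ?_ (lintegral_mono hle))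
    simp
  have hid : condLExp m μ (fun ω => (ENNReal.ofReal (K - X ω) + lossExcess H (s - X ω))
        + ((-H (s - X ω)).toENNReal + ENNReal.ofReal (s - K)))
      = condLExp m μ (fun ω => (H (s - X ω)).toENNReal + ENNReal.ofReal (K - s)) := by
    congr 1
    ext ω
    exact lossExcess_add_eq hH (hK ω)
  have h1 := condLExp_add_right (mΩ := m) (P := μ)
    (fun ω => ENNReal.ofReal (K - X ω) + lossExcess H (s - X ω))
    (Y := fun ω => (-H (s - X ω)).toENNReal + ENNReal.ofReal (s - K))
    (hneg.add measurable_const).aemeasurable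
  have h2 := condLExp_add_measurable (μ := μ) hm (fun ω => (-H (s - X ω)).toENNReal)
    (g := fun _ => ENNReal.ofReal (s - K)) measurable_const
  have h3 := condLExp_add_measurable (μ := μ) hm (fun ω => (H (s - X ω)).toENNReal)
    (g := fun _ => ENNReal.ofReal (K - s)) measurable_const
  filter_upwards [hfin, h1, h2, h3] with ω hfin h1 h2 h3
  have h4 := congrFun hid ω
  rw [h3] at h4
  change condLExp m μ ((fun ω => ENNReal.ofReal (K - X ω) + lossExcess H (s - X ω)) +
    fun ω => (-H (s - X ω)).toENNReal + ENNReal.ofReal (s - K)) ω = _ at h4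
  rw [h1, Pi.add_apply, h2] at h4
  unfold condExpExt condLoss
  beta_reduce
  generalize condLExp m μ (fun ω => ENNReal.ofReal (K - X ω) + lossExcess H (s - X ω)) ω = R at h4 ⊢
  generalize condLExp m μ (fun ω => (-H (s - X ω)).toENNReal) ω = B at h4 hfin ⊢
  generalize condLExp m μ (fun ω => (H (s - X ω)).toENNReal) ω = A at h4 ⊢
  by_cases hA : A = ⊤
  · have hR : R = ⊤ := by
      by_contra hR
      rw [hA, top_add] at h4
      exact absurd h4 (by finiteness)
    rw [hA, hR, ← EReal.coe_ennreal_toReal hfin]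
    simp
  · have hR : R ≠ ⊤ := by
      intro hR
      rw [hR, top_add] at h4
      exact absurd h4.symm (by finiteness)
    rw [EReal.coe_sub_coe_ennreal hR, ← EReal.coe_ennreal_toReal hA, EReal.coe_sub_coe_ennreal hfin,
      ← EReal.coe_sub, EReal.coe_eq_coe_iff]
    have h5 := congrArg ENNReal.toReal h4
    repeat rw [ENNReal.toReal_add (by finiteness) (by finiteness)] at h5
    simp only [ENNReal.toReal_ofReal'] at h5
    rcases max_cases (s - K) 0 with ⟨h3, h3'⟩ | ⟨h3, h3'⟩ <;>
    rcases max_cases (K - s) 0 with ⟨h4, h4'⟩ | ⟨h4, h4'⟩ <;>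
    rw [h3, h4] at h5 <;> linarith

theorem measurable_oceBounded (hm : m ≤ mΩ) (X : Ω → ℝ) : Measurable[m] (oceBounded m μ H X) :=
  (isEssSup_essSupFamily hm μ _).measurable

theorem oceBounded_le (hm : m ≤ mΩ) (hH : IsCoerciveLoss H) {X : Ω → ℝ} (hX : Measurable X)
    {K : ℝ} (hK : ∀ ω, |X ω| ≤ K) {g : Ω → EReal} (hg : Measurable[m] g)
    (h : ∀ s : ℝ, ∀ᵐ ω ∂μ,
      (K : EReal) - (condLoss m μ (lossExcess H) K X (fun _ => s) ω : EReal) ≤ g ω) :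
    oceBounded m μ H X ≤ᵐ[μ] g := by
  refine (isEssSup_essSupFamily hm μ _).least g hg ?_
  rintro _ ⟨s, rfl⟩
  filter_upwards [h s, coe_sub_condExpExt (μ := μ) hm hH hX hK s] with ω h1 h2
  rw [h2]
  exact h1

theorem le_oceBounded_const (hm : m ≤ mΩ) (hH : IsCoerciveLoss H) {X : Ω → ℝ} (hX : Measurable X)
    {K : ℝ} (hK : ∀ ω, |X ω| ≤ K) (s : ℝ) :
    ∀ᵐ ω ∂μ, (K : EReal) - (condLoss m μ (lossExcess H) K X (fun _ => s) ω : EReal)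
      ≤ oceBounded m μ H X ω := by
  filter_upwards [(isEssSup_essSupFamily hm μ _).le _ (Set.mem_range_self (f := fun (s : ℝ) (ω : Ω) =>
    (s : EReal) - condExpExt m μ (fun ω' => H (s - X ω')) ω) s),
    coe_sub_condExpExt (μ := μ) hm hH hX hK s] with ω h1 h2
  rw [← h2]
  exact h1

/-- In the optimized certainty equivalent, `s` may be any random variable known at the time. -/
theorem le_oceBounded (hm : m ≤ mΩ) (hH : IsCoerciveLoss H) {X : Ω → ℝ} (hX : Measurable X)
    {K : ℝ} (hK : ∀ ω, |X ω| ≤ K) {σ : Ω → ℝ} (hσ : Measurable[m] σ) :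
    ∀ᵐ ω ∂μ, (K : EReal) - (condLoss m μ (lossExcess H) K X σ ω : EReal)
      ≤ oceBounded m μ H X ω := by
  -- Round `σ` down to the grid of mesh `1 / (n + 1)`. On each level event it becomes a constant,
  -- and the excess grows by at most the mesh because its slope is at least -1.
  have h1 : ∀ (n : ℕ) (q : ℤ), ∀ᵐ ω ∂μ, ⌊σ ω * ((n : ℝ) + 1)⌋ = q →
      condLoss m μ (lossExcess H) K X (fun _ => (q : ℝ) / ((n : ℝ) + 1)) ω
        ≤ condLoss m μ (lossExcess H) K X σ ω + ENNReal.ofReal (1 / ((n : ℝ) + 1)) := by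
    intro n q
    have hn : (0 : ℝ) < (n : ℝ) + 1 := by positivity
    set A : Set Ω := {ω | ⌊σ ω * ((n : ℝ) + 1)⌋ = q}
    have hA : MeasurableSet[m] A :=
      (Int.measurable_floor.comp (measurable_id.mul_const ((n : ℝ) + 1))).comp hσ
        (measurableSet_singleton q)
    have h2 := condLExp_mono_on (μ := μ) hm hA
      (f := fun ω => ENNReal.ofReal (K - X ω) + lossExcess H ((q : ℝ) / ((n : ℝ) + 1) - X ω))
      (g := fun ω => ENNReal.ofReal (K - X ω) + lossExcess H (σ ω - X ω)
        + ENNReal.ofReal (1 / ((n : ℝ) + 1))) (.of_forall fun ω hω => ?_)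
    · have h3 := condLExp_add_measurable (μ := μ) hm
        (fun ω => ENNReal.ofReal (K - X ω) + lossExcess H (σ ω - X ω))
        (g := fun _ => ENNReal.ofReal (1 / ((n : ℝ) + 1))) measurable_const
      filter_upwards [h2, h3] with ω h2 h3 hω
      have := h2 hω
      rwa [h3] at this
    · have hω' : ⌊σ ω * ((n : ℝ) + 1)⌋ = q := hω
      have h4 : (q : ℝ) / ((n : ℝ) + 1) ≤ σ ω := by
        rw [div_le_iff₀ hn, ← hω']
        exact Int.floor_le _
      have h5 : σ ω ≤ (q : ℝ) / ((n : ℝ) + 1) + 1 / ((n : ℝ) + 1) := by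
        rw [← add_div, le_div_iff₀ hn, ← hω']
        exact (Int.lt_floor_add_one _).le
      rw [add_assoc]
      gcongr
      refine (hH.excess.mono _ (σ ω - X ω) (by linarith)).trans ?_
      gcongr
      linarith
  have h2 : ∀ᵐ ω ∂μ, ∀ (n : ℕ) (q : ℤ),
      (K : EReal) - (condLoss m μ (lossExcess H) K X (fun _ => (q : ℝ) / ((n : ℝ) + 1)) ω : EReal)
        ≤ oceBounded m μ H X ω :=
    ae_all_iff.2 fun n => ae_all_iff.2 fun q => le_oceBounded_const hm hH hX hK _
  filter_upwards [ae_all_iff.2 fun n => ae_all_iff.2 fun q => h1 n q, h2] with ω h1 h2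
  by_cases hR : condLoss m μ (lossExcess H) K X σ ω = ⊤
  · rw [hR]
    simp
  rw [EReal.coe_sub_coe_ennreal hR]
  refine EReal.coe_le_of_forall_sub_le fun n => ?_
  have h3 := h1 n _ rfl
  refine le_trans ?_ (h2 n ⌊σ ω * ((n : ℝ) + 1)⌋)
  have hfin : condLoss m μ (lossExcess H) K X σ ω + ENNReal.ofReal (1 / ((n : ℝ) + 1)) ≠ ⊤ := by
    finiteness
  rw [EReal.coe_sub_coe_ennreal (ne_top_of_le_ne_top hfin h3), EReal.coe_le_coe_iff]
  have h4 := ENNReal.toReal_mono hfin h3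
  rw [ENNReal.toReal_add hR (by finiteness), ENNReal.toReal_ofReal (by positivity)] at h4
  linarith

/-- For fixed `s` the integrand `X - L (s - X)` is nondecreasing in `X`, again by the slope bound.
Comparing with a function equal to `⊤` off `A` localizes the essential supremum. -/
theorem oceBounded_mono_on (hm : m ≤ mΩ) (hH : IsCoerciveLoss H) {X Y : Ω → ℝ} (hX : Measurable X)
    (hY : Measurable Y) {K : ℝ} (hXK : ∀ ω, |X ω| ≤ K) (hYK : ∀ ω, |Y ω| ≤ K) {A : Set Ω}
    (hA : MeasurableSet[m] A) (h : ∀ᵐ ω ∂μ, ω ∈ A → X ω ≤ Y ω) :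
    ∀ᵐ ω ∂μ, ω ∈ A → oceBounded m μ H X ω ≤ oceBounded m μ H Y ω := by
  classical
  have key := oceBounded_le (μ := μ) hm hH hX hXK
    (g := A.piecewise (oceBounded m μ H Y) fun _ => ⊤)
    (Measurable.piecewise hA (measurable_oceBounded hm Y) measurable_const) fun s => ?_
  · filter_upwards [key] with ω h1 hω
    simpa [hω] using h1
  · have h2 := condLExp_mono_on (μ := μ) hm hA
      (f := fun ω => ENNReal.ofReal (K - Y ω) + lossExcess H (s - Y ω))
      (g := fun ω => ENNReal.ofReal (K - X ω) + lossExcess H (s - X ω)) (by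
        filter_upwards [h] with ω hω hωA
        have hle := hω hωA
        have hYK' := le_trans (le_abs_self _) (hYK ω)
        calc ENNReal.ofReal (K - Y ω) + lossExcess H (s - Y ω)
            ≤ ENNReal.ofReal (K - Y ω)
              + (lossExcess H (s - X ω) + ENNReal.ofReal (s - X ω - (s - Y ω))) := by
              gcongr
              exact hH.excess.mono _ _ (by linarith)
          _ = ENNReal.ofReal (K - Y ω) + ENNReal.ofReal (Y ω - X ω) + lossExcess H (s - X ω) := by
              rw [show s - X ω - (s - Y ω) = Y ω - X ω by ring]
              ring
          _ = ENNReal.ofReal (K - X ω) + lossExcess H (s - X ω) := by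
              rw [← ENNReal.ofReal_add (by linarith) (by linarith)]
              congr 2
              ring)
    filter_upwards [h2, le_oceBounded_const (μ := μ) hm hH hY hYK s] with ω h2 h3
    by_cases hω : ω ∈ A
    · rw [Set.piecewise_eq_of_mem _ _ _ hω]
      refine le_trans (EReal.sub_le_sub le_rfl ?_) h3
      exact EReal.coe_ennreal_le_coe_ennreal_iff.2 (h2 hω)
    · rw [Set.piecewise_eq_of_notMem _ _ _ hω]
      exact le_top

/-- Substitute `s - r` for `s`; this is a random but known parameter, which `le_oceBounded` admits.
-/
theorem oceBounded_add_le (hm : m ≤ mΩ) (hH : IsCoerciveLoss H) {X r : Ω → ℝ} (hX : Measurable X)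
    (hr : Measurable[m] r) {K Kr : ℝ} (hXK : ∀ ω, |X ω| ≤ K) (hrK : ∀ ω, |r ω| ≤ Kr) :
    ∀ᵐ ω ∂μ, oceBounded m μ H (fun ω => X ω + r ω) ω ≤ oceBounded m μ H X ω + (r ω : EReal) := by
  refine oceBounded_le (K := K + Kr) hm hH (hX.add (hr.mono hm le_rfl))
    (fun ω => (abs_add_le _ _).trans (add_le_add (hXK ω) (hrK ω)))
    ((measurable_oceBounded hm X).add (measurable_coe_real_ereal.comp hr)) fun s => ?_
  change ∀ᵐ ω ∂μ, ((K + Kr : ℝ) : EReal) - (condLoss m μ (lossExcess H) (K + Kr)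
    (fun ω => X ω + r ω) (fun _ => s) ω : EReal) ≤ oceBounded m μ H X ω + (r ω : EReal)
  have h1 := le_oceBounded (μ := μ) hm hH hX hXK
    (σ := fun ω => s - r ω) (measurable_const.sub hr)
  have h2 := condLExp_add_measurable (μ := μ) hm
    (fun ω => ENNReal.ofReal (K - X ω) + lossExcess H (s - r ω - X ω))
    (g := fun ω => ENNReal.ofReal (Kr - r ω))
    (ENNReal.measurable_ofReal.comp (measurable_const.sub hr))
  have h3 : condLoss m μ (lossExcess H) (K + Kr) (fun ω => X ω + r ω) (fun _ => s)
      = condLExp m μ (fun ω => ENNReal.ofReal (K - X ω) + lossExcess H (s - r ω - X ω)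
        + ENNReal.ofReal (Kr - r ω)) := by
    unfold condLoss
    congr 1
    ext ω
    have hXK' := le_trans (le_abs_self _) (hXK ω)
    have hrK' := le_trans (le_abs_self _) (hrK ω)
    rw [show K + Kr - (X ω + r ω) = (K - X ω) + (Kr - r ω) by ring,
      ENNReal.ofReal_add (by linarith) (by linarith),
      show s - (X ω + r ω) = s - r ω - X ω by ring]
    ring
  rw [h3]
  filter_upwards [h1, h2] with ω h1 h2
  rw [h2]
  refine le_trans ?_ (add_le_add_left h1 _)
  change _ ≤ (K : EReal) - (condLExp m μ
    (fun ω => ENNReal.ofReal (K - X ω) + lossExcess H (s - r ω - X ω)) ω : EReal) + (r ω : EReal)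
  generalize condLExp m μ
    (fun ω => ENNReal.ofReal (K - X ω) + lossExcess H (s - r ω - X ω)) ω = R
  by_cases hR : R = ⊤
  · simp [hR]
  have hrK' := le_trans (le_abs_self _) (hrK ω)
  rw [EReal.coe_sub_coe_ennreal hR, EReal.coe_sub_coe_ennreal (by finiteness), ← EReal.coe_add,
    EReal.coe_le_coe_iff, ENNReal.toReal_add hR (by finiteness),
    ENNReal.toReal_ofReal (by linarith)]
  linarith

/-- The upper bound is `L ≥ 0`. For the lower bound take the known parameter `X + q` with `L q` as
small as desired. -/
theorem oceBounded_of_measurable (hm : m ≤ mΩ) (hH : IsCoerciveLoss H) {X : Ω → ℝ}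
    (hX : Measurable[m] X) {K : ℝ} (hK : ∀ ω, |X ω| ≤ K) :
    ∀ᵐ ω ∂μ, oceBounded m μ H X ω = (X ω : EReal) := by
  have hK' : ∀ ω, X ω ≤ K := fun ω => le_trans (le_abs_self _) (hK ω)
  have hofReal : Measurable[m] fun ω => ENNReal.ofReal (K - X ω) :=
    ENNReal.measurable_ofReal.comp (measurable_const.sub hX)
  have hle : ∀ᵐ ω ∂μ, oceBounded m μ H X ω ≤ (X ω : EReal) := by
    refine oceBounded_le hm hH (hX.mono hm le_rfl) hK (measurable_coe_real_ereal.comp hX)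
      fun s => ?_
    have h1 := condLExp_mono (mΩ := m) (P := μ) (X := fun ω => ENNReal.ofReal (K - X ω))
      (Y := fun ω => ENNReal.ofReal (K - X ω) + lossExcess H (s - X ω))
      (.of_forall fun ω => le_self_add)
    rw [condLExp_eq_self hm μ hofReal] at h1
    filter_upwards [h1] with ω h1
    refine le_trans (EReal.sub_le_sub le_rfl (EReal.coe_ennreal_le_coe_ennreal_iff.2 h1)) ?_
    rw [EReal.coe_sub_coe_ennreal (by finiteness), EReal.coe_le_coe_iff,
      ENNReal.toReal_ofReal (by linarith [hK' ω])]
    linarith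
  have hge : ∀ᵐ ω ∂μ, ∀ n : ℕ,
      ((X ω - 1 / ((n : ℝ) + 1) : ℝ) : EReal) ≤ oceBounded m μ H X ω := by
    refine ae_all_iff.2 fun n => ?_
    obtain ⟨q, hq⟩ := hH.excess.small (1 / ((n : ℝ) + 1)) (by positivity)
    have h1 := le_oceBounded (μ := μ) hm hH (hX.mono hm le_rfl) hK
      (σ := fun ω => X ω + q) (hX.add measurable_const)
    filter_upwards [h1] with ω h1
    refine le_trans ?_ h1
    have h2 : condLoss m μ (lossExcess H) K X (fun ω => X ω + q) ω
        = ENNReal.ofReal (K - X ω) + lossExcess H q := by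
      unfold condLoss
      simp only [add_sub_cancel_left]
      exact congrFun (condLExp_eq_self hm μ (hofReal.add measurable_const)) ω
    have h3 : lossExcess H q ≠ ⊤ := ne_top_of_le_ne_top (by finiteness) hq
    have h4 := ENNReal.toReal_mono (by finiteness) hq
    rw [ENNReal.toReal_ofReal (by positivity)] at h4
    rw [h2, EReal.coe_sub_coe_ennreal (by finiteness), EReal.coe_le_coe_iff,
      ENNReal.toReal_add (by finiteness) h3, ENNReal.toReal_ofReal (by linarith [hK' ω])]
    linarith
  filter_upwards [hle, hge] with ω h1 h2
  exact le_antisymm h1 (EReal.coe_le_of_forall_sub_le h2)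

end OceBounded

/-! ### The one-step utility on extended real random variables -/

section OceStep

variable {Ω : Type*} {m mΩ : MeasurableSpace Ω} {μ : Measure Ω} {H : ℝ → EReal}

theorem oceStep_eq (X : Ω → EReal) (ω : Ω) : oceStep m μ H X ω = ⨆ n : ℕ, ⨅ k : ℕ,
    oceBounded m μ H (fun ω' => truncReal (-(k : ℝ)) n (X ω')) ω := rfl

variable [IsProbabilityMeasure μ]

theorem measurable_oceStep (hm : m ≤ mΩ) (X : Ω → EReal) : Measurable[m] (oceStep m μ H X) :=
  Measurable.iSup fun _ => Measurable.iInf fun _ => measurable_oceBounded hm _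

theorem oceStep_mono_on (hm : m ≤ mΩ) (hH : IsCoerciveLoss H) {X Y : Ω → EReal}
    (hX : Measurable X) (hY : Measurable Y) {A : Set Ω} (hA : MeasurableSet[m] A)
    (h : ∀ᵐ ω ∂μ, ω ∈ A → X ω ≤ Y ω) :
    ∀ᵐ ω ∂μ, ω ∈ A → oceStep m μ H X ω ≤ oceStep m μ H Y ω := by
  have h1 : ∀ n k : ℕ, ∀ᵐ ω ∂μ, ω ∈ A →
      oceBounded m μ H (fun ω' => truncReal (-(k : ℝ)) n (X ω')) ω
        ≤ oceBounded m μ H (fun ω' => truncReal (-(k : ℝ)) n (Y ω')) ω := fun n k =>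
    oceBounded_mono_on hm hH ((measurable_truncReal _ _).comp hX)
      ((measurable_truncReal _ _).comp hY) (fun ω => abs_truncReal_le n k (X ω))
      (fun ω => abs_truncReal_le n k (Y ω)) hA
      (by filter_upwards [h] with ω h hω using truncReal_mono (h hω))
  filter_upwards [ae_all_iff.2 fun n => ae_all_iff.2 fun k => h1 n k] with ω h1 hω
  rw [oceStep_eq, oceStep_eq]
  exact iSup_mono fun n => iInf_mono fun k => h1 n k hω

theorem oceStep_mono (hm : m ≤ mΩ) (hH : IsCoerciveLoss H) {X Y : Ω → EReal}
    (hX : Measurable X) (hY : Measurable Y) (h : X ≤ᵐ[μ] Y) :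
    oceStep m μ H X ≤ᵐ[μ] oceStep m μ H Y := by
  filter_upwards [oceStep_mono_on hm hH hX hY (A := Set.univ) .univ
    (by filter_upwards [h] with ω h _ using h)] with ω h using h trivial

theorem oceStep_congr (hm : m ≤ mΩ) (hH : IsCoerciveLoss H) {X Y : Ω → EReal}
    (hX : Measurable X) (hY : Measurable Y) (h : X =ᵐ[μ] Y) :
    oceStep m μ H X =ᵐ[μ] oceStep m μ H Y :=
  (oceStep_mono hm hH hX hY h.le).antisymm (oceStep_mono hm hH hY hX h.symm.le)

theorem oceStep_of_measurable (hm : m ≤ mΩ) (hH : IsCoerciveLoss H) {X : Ω → EReal}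
    (hX : Measurable[m] X) : oceStep m μ H X =ᵐ[μ] X := by
  have h1 : ∀ n k : ℕ, ∀ᵐ ω ∂μ,
      oceBounded m μ H (fun ω' => truncReal (-(k : ℝ)) n (X ω')) ω
        = ((truncReal (-(k : ℝ)) n (X ω) : ℝ) : EReal) := fun n k =>
    oceBounded_of_measurable hm hH ((measurable_truncReal _ _).comp hX)
      fun ω => abs_truncReal_le n k (X ω)
  filter_upwards [ae_all_iff.2 fun n => ae_all_iff.2 fun k => h1 n k] with ω h1
  rw [oceStep_eq]
  simp_rw [h1, coe_truncReal]
  have hinf : ∀ n : ℕ, ⨅ k : ℕ, max ((-(k : ℝ) : ℝ) : EReal) (min (X ω) ((n : ℝ) : EReal))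
      = min (X ω) ((n : ℝ) : EReal) := by
    intro n
    refine le_antisymm ?_ (le_iInf fun k => le_max_right _ _)
    refine le_of_forall_gt fun y hy => ?_
    obtain ⟨r, hr1, hr2⟩ := EReal.lt_iff_exists_real_btwn.1 hy
    obtain ⟨k, hk⟩ := exists_nat_gt (-r)
    refine (iInf_le _ k).trans_lt (max_lt (lt_trans ?_ hr2) hy)
    rw [EReal.coe_lt_coe_iff]
    linarith
  simp_rw [hinf]
  refine le_antisymm (iSup_le fun n => min_le_left _ _) ?_
  refine le_of_forall_lt fun y hy => ?_
  obtain ⟨r, hr1, hr2⟩ := EReal.lt_iff_exists_real_btwn.1 hy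
  obtain ⟨n, hn⟩ := exists_nat_gt r
  refine lt_of_lt_of_le (lt_min hy (hr1.trans ?_)) (le_iSup (fun n : ℕ =>
    min (X ω) ((n : ℝ) : EReal)) n)
  rwa [EReal.coe_lt_coe_iff]

theorem oceStep_add_le (hm : m ≤ mΩ) (hH : IsCoerciveLoss H) {X : Ω → EReal} (hX : Measurable X)
    {r : Ω → ℝ} (hr : Measurable[m] r) :
    ∀ᵐ ω ∂μ, oceStep m μ H (fun ω => X ω + (r ω : EReal)) ω
      ≤ oceStep m μ H X ω + (r ω : EReal) := by
  classical
  have hrΩ : Measurable r := hr.mono hm le_rfl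
  have h1 : ∀ j n k : ℕ, ∀ᵐ ω ∂μ, |r ω| ≤ j →
      oceBounded m μ H
          (fun ω' => truncReal (-((k + j : ℕ) : ℝ)) n (X ω' + (r ω' : EReal))) ω
        ≤ oceBounded m μ H (fun ω' => truncReal (-(k : ℝ)) ((n + j : ℕ) : ℝ) (X ω')) ω
          + (r ω : EReal) := by
    intro j n k
    -- Cash additivity is proved on the events where `r` is bounded by `j`; these exhaust the space.
    set A : Set Ω := {ω | |r ω| ≤ j}
    have hA : MeasurableSet[m] A := (continuous_abs.measurable.comp hr) measurableSet_Iic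
    set r' : Ω → ℝ := A.indicator r
    have hr' : Measurable[m] r' := hr.indicator hA
    have hr'j : ∀ ω, |r' ω| ≤ j := by
      intro ω
      by_cases h : ω ∈ A
      · rw [show r' ω = r ω from Set.indicator_of_mem h _]
        exact h
      · rw [show r' ω = 0 from Set.indicator_of_notMem h _, abs_zero]
        exact Nat.cast_nonneg j
    have hT : Measurable fun ω' => truncReal (-(k : ℝ)) ((n + j : ℕ) : ℝ) (X ω') :=
      (measurable_truncReal _ _).comp hX
    have h2 := oceBounded_mono_on (μ := μ) hm hH (A := A)
      (X := fun ω' => truncReal (-((k + j : ℕ) : ℝ)) n (X ω' + (r ω' : EReal)))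
      (Y := fun ω' => truncReal (-(k : ℝ)) ((n + j : ℕ) : ℝ) (X ω') + r' ω')
      ((measurable_truncReal _ _).comp (hX.add (measurable_coe_real_ereal.comp hrΩ)))
      (hT.add (hr'.mono hm le_rfl)) (K := ((n + j : ℕ) : ℝ) + k + j)
      (fun ω => (abs_truncReal_le n (k + j) _).trans (by push_cast; linarith [(Nat.cast_nonneg j : (0 : ℝ) ≤ j)]))
      (fun ω => (abs_add_le _ _).trans (add_le_add (abs_truncReal_le _ _ _) (hr'j ω))) hA
      (.of_forall fun ω hω => by
        rw [show r' ω = r ω from Set.indicator_of_mem hω _]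
        exact truncReal_add_le n k j (X ω) hω)
    have h3 := oceBounded_add_le (μ := μ) hm hH hT hr'
      (fun ω => abs_truncReal_le (n + j) k (X ω)) hr'j
    filter_upwards [h2, h3] with ω h2 h3 hω
    refine (h2 hω).trans (h3.trans_eq ?_)
    rw [show r' ω = r ω from Set.indicator_of_mem (show ω ∈ A from hω) _]
  filter_upwards [ae_all_iff.2 fun j => ae_all_iff.2 fun n => ae_all_iff.2 fun k => h1 j n k]
    with ω h1
  obtain ⟨j, hj⟩ := exists_nat_ge |r ω|
  rw [oceStep_eq, oceStep_eq]
  refine iSup_le fun n => ?_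
  rw [← EReal.sub_le_iff_le_add (by simp) (by simp)]
  refine le_trans ?_ (le_iSup _ (n + j))
  refine le_iInf fun k => ?_
  rw [EReal.sub_le_iff_le_add (by simp) (by simp)]
  exact (iInf_le _ (k + j)).trans (h1 j n k hj)

/-- Cash additivity. -/
theorem oceStep_add (hm : m ≤ mΩ) (hH : IsCoerciveLoss H) {X : Ω → EReal} (hX : Measurable X)
    {r : Ω → ℝ} (hr : Measurable[m] r) :
    ∀ᵐ ω ∂μ, oceStep m μ H (fun ω => X ω + (r ω : EReal)) ω
      = oceStep m μ H X ω + (r ω : EReal) := by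
  have hrE : Measurable fun ω => (r ω : EReal) := measurable_coe_real_ereal.comp (hr.mono hm le_rfl)
  have h2 := oceStep_add_le (μ := μ) hm hH (hX.add hrE) (r := fun ω => - r ω) hr.neg
  have h3 : (fun ω => (X ω + (r ω : EReal)) + ((- r ω : ℝ) : EReal)) = X := by
    ext ω
    rw [add_assoc, ← EReal.coe_add, add_neg_cancel, EReal.coe_zero, add_zero]
  change ∀ᵐ ω ∂μ, oceStep m μ H (fun ω => (X ω + (r ω : EReal)) + ((- r ω : ℝ) : EReal)) ω
    ≤ oceStep m μ H (fun ω => X ω + (r ω : EReal)) ω + ((- r ω : ℝ) : EReal) at h2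
  rw [h3] at h2
  filter_upwards [oceStep_add_le hm hH hX hr, h2] with ω h1 h2
  refine le_antisymm h1 ?_
  rw [EReal.coe_neg, ← sub_eq_add_neg,
    EReal.le_sub_iff_add_le (by simp) (by simp)] at h2
  exact h2

theorem oceStep_of_bounded (hm : m ≤ mΩ) (hH : IsCoerciveLoss H) {X : Ω → ℝ} (hX : Measurable X)
    {K : ℝ} (hK : ∀ ω, |X ω| ≤ K) :
    ∀ᵐ ω ∂μ, oceStep m μ H (fun ω => (X ω : EReal)) ω = oceBounded m μ H X ω := by
  have htrunc : ∀ n k : ℕ, ∀ ω, truncReal (-(k : ℝ)) n (X ω : EReal) = max (-(k : ℝ)) (min (X ω) n) :=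
    fun n k ω => truncReal_coe _ _ _
  have hTm : ∀ n k : ℕ, Measurable fun ω => truncReal (-(k : ℝ)) n (X ω : EReal) := fun n k =>
    (measurable_truncReal _ _).comp (measurable_coe_real_ereal.comp hX)
  have hb : ∀ n k : ℕ, ∀ ω, |X ω| ≤ |K| + n + k := fun n k ω =>
    (hK ω).trans (by linarith [le_abs_self K, (Nat.cast_nonneg n : (0 : ℝ) ≤ n),
      (Nat.cast_nonneg k : (0 : ℝ) ≤ k)])
  have hb' : ∀ n k : ℕ, ∀ ω, |truncReal (-(k : ℝ)) n (X ω : EReal)| ≤ |K| + n + k := fun n k ω =>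
    (abs_truncReal_le n k _).trans (by linarith [abs_nonneg K])
  have h1 : ∀ n k : ℕ, K ≤ n → ∀ᵐ ω ∂μ, oceBounded m μ H X ω
      ≤ oceBounded m μ H (fun ω => truncReal (-(k : ℝ)) n (X ω : EReal)) ω := by
    intro n k hn
    filter_upwards [oceBounded_mono_on (μ := μ) hm hH hX (hTm n k) (hb n k) (hb' n k)
      (A := Set.univ) .univ (.of_forall fun ω _ => by
        rw [htrunc, min_eq_left (le_trans (le_abs_self _) ((hK ω).trans hn))]
        exact le_max_right _ _)] with ω h using h trivial
  have h2 : ∀ n k : ℕ, K ≤ k → ∀ᵐ ω ∂μ,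
      oceBounded m μ H (fun ω => truncReal (-(k : ℝ)) n (X ω : EReal)) ω ≤ oceBounded m μ H X ω := by
    intro n k hk
    filter_upwards [oceBounded_mono_on (μ := μ) hm hH (hTm n k) hX (hb' n k) (hb n k)
      (A := Set.univ) .univ (.of_forall fun ω _ => by
        rw [htrunc]
        refine max_le ?_ (min_le_left _ _)
        linarith [neg_abs_le (X ω), hK ω])] with ω h using h trivial
  have h1' : ∀ᵐ ω ∂μ, ∀ n k : ℕ, K ≤ n → oceBounded m μ H X ω
      ≤ oceBounded m μ H (fun ω => truncReal (-(k : ℝ)) n (X ω : EReal)) ω := by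
    refine ae_all_iff.2 fun n => ae_all_iff.2 fun k => ?_
    by_cases h : K ≤ n
    · filter_upwards [h1 n k h] with ω h _ using h
    · exact .of_forall fun ω h' => absurd h' h
  have h2' : ∀ᵐ ω ∂μ, ∀ n k : ℕ, K ≤ k →
      oceBounded m μ H (fun ω => truncReal (-(k : ℝ)) n (X ω : EReal)) ω ≤ oceBounded m μ H X ω := by
    refine ae_all_iff.2 fun n => ae_all_iff.2 fun k => ?_
    by_cases h : K ≤ k
    · filter_upwards [h2 n k h] with ω h _ using h
    · exact .of_forall fun ω h' => absurd h' h
  obtain ⟨j, hj⟩ := exists_nat_ge K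
  filter_upwards [h1', h2'] with ω h1 h2
  rw [oceStep_eq]
  refine le_antisymm (iSup_le fun n => (iInf_le _ j).trans (h2 n j hj)) ?_
  exact le_trans (le_iInf fun k => h1 j k hj) (le_iSup (fun n : ℕ => ⨅ k : ℕ,
    oceBounded m μ H (fun ω' => truncReal (-(k : ℝ)) n (X ω' : EReal)) ω) j)

/-- A bound on risk sharing between two agents extends from bounded to extended real transfers. -/
theorem oceStep_coe_sub_le (hm : m ≤ mΩ) {H₁ H₂ : ℝ → EReal} (hH₁ : IsCoerciveLoss H₁) {Z : Ω → ℝ} (hZ : Measurable Z) {K : ℝ}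
    (hK : ∀ ω, |Z ω| ≤ K) {ρ : Ω → ℝ}
    (hb : ∀ Y : Ω → ℝ, Measurable Y → (∃ C, ∀ ω, |Y ω| ≤ C) → ∀ᵐ ω ∂μ,
      oceBounded m μ H₁ (fun ω => Z ω - Y ω) ω ≤ (ρ ω : EReal) - oceBounded m μ H₂ Y ω)
    {Y : Ω → EReal} (hY : Measurable Y) :
    ∀ᵐ ω ∂μ, oceStep m μ H₁ (fun ω => (Z ω : EReal) - Y ω) ω
      ≤ (ρ ω : EReal) - oceStep m μ H₂ Y ω := by
  obtain ⟨j, hj⟩ := exists_nat_ge K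
  have hZj : ∀ ω, |Z ω| ≤ j := fun ω => (hK ω).trans hj
  have h1 : ∀ n n' : ℕ, ∀ᵐ ω ∂μ,
      oceBounded m μ H₁ (fun ω => truncReal (-((n + j : ℕ) : ℝ)) n' ((Z ω : EReal) - Y ω)) ω
        ≤ (ρ ω : EReal)
          - oceBounded m μ H₂ (fun ω => truncReal (-((n' + j : ℕ) : ℝ)) n (Y ω)) ω := by
    intro n n'
    have hT : Measurable fun ω => truncReal (-((n' + j : ℕ) : ℝ)) n (Y ω) :=
      (measurable_truncReal _ _).comp hY
    have hZY : Measurable fun ω => (Z ω : EReal) - Y ω := by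
      simp only [sub_eq_add_neg]
      exact (measurable_coe_real_ereal.comp hZ).add hY.neg
    have h2 := oceBounded_mono_on (μ := μ) hm hH₁ (A := Set.univ)
      (X := fun ω => truncReal (-((n + j : ℕ) : ℝ)) n' ((Z ω : EReal) - Y ω))
      (Y := fun ω => Z ω - truncReal (-((n' + j : ℕ) : ℝ)) n (Y ω))
      ((measurable_truncReal _ _).comp hZY) (hZ.sub hT)
      (K := j + (n + (n' + j : ℕ)))
      (fun ω => (abs_truncReal_le n' (n + j) _).trans (by push_cast; linarith [(Nat.cast_nonneg j : (0 : ℝ) ≤ j)]))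
      (fun ω => (abs_sub _ _).trans (add_le_add (hZj ω) (abs_truncReal_le _ _ _))) .univ
      (.of_forall fun ω _ => truncReal_sub_le n n' j (Y ω) (hZj ω))
    filter_upwards [h2, hb _ hT ⟨_, fun ω => abs_truncReal_le _ _ _⟩] with ω h2 h3
    exact (h2 trivial).trans h3
  filter_upwards [ae_all_iff.2 fun n => ae_all_iff.2 fun n' => h1 n n'] with ω h1
  -- For fixed upper levels `n'` and `n`, each infimum is bounded by its member at the matching
  -- lower level, `n + j` or `n' + j`. Interchanging the sides of the inequality puts each supremum
  -- in turn on the left.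
  rw [oceStep_eq]
  refine iSup_le fun n' => EReal.le_coe_sub_comm ?_
  rw [oceStep_eq]
  refine iSup_le fun n => EReal.le_coe_sub_comm ?_
  refine (iInf_le _ (n + j)).trans ((h1 n n').trans ?_)
  exact EReal.sub_le_sub le_rfl (iInf_le _ (n' + j))

end OceStep

/-! ### Optimal risk sharing over one period -/

section RiskSharing

variable {E : Type*} [NormedAddCommGroup E] [InnerProductSpace ℝ E] [FiniteDimensional ℝ E]

/-- Superlinearity gives the bound outside a ball; continuity of a finite convex function bounds the
rest on the compact ball. -/
theorem exists_mul_norm_sub_le_of_superlinear {c : E → ℝ} (hc : ConvexOn ℝ Set.univ c)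
    (hc_superlinear : Tendsto (fun a => c a / ‖a‖) (Bornology.cobounded E) atTop) (κ : ℝ) :
    ∃ C : ℝ, 0 ≤ C ∧ ∀ a, κ * ‖a‖ - C ≤ c a := by
  have hcont : Continuous c := by
    rw [← continuousOn_univ]
    exact hc.continuousOn isOpen_univ
  have h1 : ∀ᶠ a in Bornology.cobounded E, κ ≤ c a / ‖a‖ :=
    hc_superlinear.eventually (eventually_ge_atTop κ)
  obtain ⟨r, -, hr⟩ := (hasBasis_cobounded_norm (E := E)).eventually_iff.1 h1
  obtain ⟨B, hB⟩ := (isCompact_closedBall (0 : E) (max r 1)).exists_bound_of_continuousOn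
    (f := fun a => κ * ‖a‖ - c a) (by fun_prop)
  refine ⟨|B|, abs_nonneg B, fun a => ?_⟩
  by_cases ha : ‖a‖ ≤ max r 1
  · have := hB a (by simpa using ha)
    have := le_trans (le_trans (le_abs_self _) this) (le_abs_self B)
    linarith
  · have hlt := not_le.1 ha
    have hpos : 0 < ‖a‖ := lt_of_lt_of_le one_pos ((le_max_right r 1).trans hlt.le)
    have := hr (show r ≤ ‖a‖ from (le_max_left r 1).trans hlt.le)
    rw [le_div_iff₀ hpos] at this
    linarith [abs_nonneg B]

theorem ENNReal.ofReal_convexComb_le {a b x y : ℝ} (ha : 0 ≤ a) (hb : 0 ≤ b) :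
    ENNReal.ofReal (a * x + b * y)
      ≤ ENNReal.ofReal a * ENNReal.ofReal x + ENNReal.ofReal b * ENNReal.ofReal y := by
  rw [← ENNReal.ofReal_mul ha, ← ENNReal.ofReal_mul hb]
  exact ENNReal.ofReal_add_le

variable [MeasurableSpace E] [BorelSpace E]
  {Ω : Type*} {m mΩ : MeasurableSpace Ω} {μ : Measure Ω} [IsProbabilityMeasure μ]

/-- The effort and the total payoff shift that minimize the conditional social loss. -/
theorem exists_social_loss_minimizer (hm : m ≤ mΩ) {L : ℝ → ENNReal} (hL : IsLossExcess L)
    {D : Ω → E} (hD : Measurable D) {κ : ℝ} (hDκ : ∀ ω, ‖D ω‖ ≤ κ) {c : E → ℝ}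
    (hc : ConvexOn ℝ Set.univ c)
    (hc_superlinear : Tendsto (fun a => c a / ‖a‖) (Bornology.cobounded E) atTop)
    {G : Ω → ℝ} (hG : Measurable G) {κG : ℝ} (hGκ : ∀ ω, |G ω| ≤ κG) :
    ∃ (a : Ω → E) (σ : Ω → ℝ) (C C₁ K : ℝ), Measurable[m] a ∧ Measurable[m] σ ∧
      (∀ ω, ‖a ω‖ ≤ K) ∧ (∀ ω, |σ ω| ≤ K) ∧
      (∀ b ω, 0 ≤ c b + C - (G ω + inner ℝ b (D ω))) ∧
      (∀ᵐ ω ∂μ, condLExp m μ (fun ω => ENNReal.ofReal (c (a ω) + C - (G ω + inner ℝ (a ω) (D ω)))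
        + L (σ ω - (G ω + inner ℝ (a ω) (D ω)))) ω ≤ ENNReal.ofReal C₁) ∧
      ∀ (b : Ω → E) (τ : Ω → ℝ), Measurable[m] b → Measurable[m] τ → ∀ᵐ ω ∂μ,
        condLExp m μ (fun ω => ENNReal.ofReal (c (a ω) + C - (G ω + inner ℝ (a ω) (D ω)))
          + L (σ ω - (G ω + inner ℝ (a ω) (D ω)))) ω
        ≤ condLExp m μ (fun ω => ENNReal.ofReal (c (b ω) + C - (G ω + inner ℝ (b ω) (D ω)))
          + L (τ ω - (G ω + inner ℝ (b ω) (D ω)))) ω := by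
  have hcont : Continuous c := by
    rw [← continuousOn_univ]
    exact hc.continuousOn isOpen_univ
  obtain ⟨ω₀⟩ : Nonempty Ω := nonempty_of_isProbabilityMeasure μ
  have hκ0 : 0 ≤ κ := (norm_nonneg _).trans (hDκ ω₀)
  have hκG0 : 0 ≤ κG := (abs_nonneg _).trans (hGκ ω₀)
  -- Slope `κ` absorbs the return term; the additional 1 leaves `‖b‖` as a lower bound, whence
  -- coercivity in the effort.
  obtain ⟨C₀, hC₀, hcC₀⟩ := exists_mul_norm_sub_le_of_superlinear hc hc_superlinear (κ + 1)
  obtain ⟨w₀, hw₀⟩ := hL.small 1 one_pos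
  obtain ⟨ε, CL, hε, hCL⟩ := hL.growth
  have hinner : ∀ b ω, |(inner ℝ b (D ω) : ℝ)| ≤ κ * ‖b‖ := fun b ω =>
    (abs_real_inner_le_norm b (D ω)).trans (by
      rw [mul_comm]
      exact mul_le_mul_of_nonneg_right (hDκ ω) (norm_nonneg b))
  set C := C₀ + κG with hC
  have hlow : ∀ b ω, ‖b‖ ≤ c b + C - (G ω + inner ℝ b (D ω)) := by
    intro b ω
    have h1 := hcC₀ b
    have h2 := le_trans (le_abs_self _) (hinner b ω)
    have h3 := le_trans (le_abs_self _) (hGκ ω)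
    linarith
  -- The effort and the sum of the two certainty-equivalent parameters are minimized jointly; the
  -- `L²` product norm makes the space of pairs Hilbert.
  set ψ : Ω → WithLp 2 (E × ℝ) → ENNReal := fun ω x =>
    ENNReal.ofReal (c x.fst + C - (G ω + inner ℝ x.fst (D ω)))
      + L (x.snd - (G ω + inner ℝ x.fst (D ω))) with hψ
  -- Zero effort, with `w₀` lowered by `κG` so that the argument of `L` lies below `w₀` by at most
  -- `2 * κG`; the slope bound then keeps the loss below `C₁`.
  set x₀ : WithLp 2 (E × ℝ) := WithLp.toLp 2 (0, w₀ - κG) with hx₀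
  set C₁ := |c 0| + C + κG + (1 + 2 * κG) with hC₁
  have hC₁0 : 0 ≤ C₁ := by positivity
  -- Beyond radius `K`, either the effort has norm at least `C₁` and the first term of `ψ` exceeds
  -- `C₁`, or the argument of `L` is at least `(|CL| + C₁) / ε` in size and the growth of `L` does
  -- it. The last summand puts `x₀` inside the ball.
  set K := C₁ + κG + κ * C₁ + (|CL| + C₁) / ε + ‖x₀‖ with hK
  have hsum : ∀ x : WithLp 2 (E × ℝ), ‖x‖ ≤ ‖x.fst‖ + |x.snd| := by
    intro x
    refine abs_le_of_sq_le_sq' ?_ (by positivity) |>.2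
    have h1 := WithLp.prod_norm_sq_eq_of_L2 x
    rw [Real.norm_eq_abs] at h1
    nlinarith [norm_nonneg x.fst, abs_nonneg x.snd]
  have hfst : ∀ x : WithLp 2 (E × ℝ), ‖x.fst‖ ≤ ‖x‖ := by
    intro x
    refine abs_le_of_sq_le_sq' ?_ (by positivity) |>.2
    have h1 := WithLp.prod_norm_sq_eq_of_L2 x
    nlinarith [sq_nonneg ‖x.snd‖]
  have hsnd : ∀ x : WithLp 2 (E × ℝ), |x.snd| ≤ ‖x‖ := by
    intro x
    refine abs_le_of_sq_le_sq' ?_ (by positivity) |>.2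
    have h1 := WithLp.prod_norm_sq_eq_of_L2 x
    rw [Real.norm_eq_abs x.snd] at h1
    nlinarith [sq_nonneg ‖x.fst‖]
  have hcfst : Continuous fun x : WithLp 2 (E × ℝ) => x.fst :=
    continuous_fst.comp (WithLp.prod_continuous_ofLp 2 E ℝ)
  have hcsnd : Continuous fun x : WithLp 2 (E × ℝ) => x.snd :=
    continuous_snd.comp (WithLp.prod_continuous_ofLp 2 E ℝ)
  have hψ_x₀ : ∀ ω, ψ ω x₀ ≤ ENNReal.ofReal C₁ := by
    intro ω
    have e1 : x₀.fst = 0 := rfl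
    have e2 : x₀.snd = w₀ - κG := rfl
    simp only [hψ]
    rw [e1, e2, inner_zero_left, add_zero]
    have h1 := abs_le.1 (hGκ ω)
    have h2 := hL.mono (w₀ - κG - G ω) w₀ (by linarith)
    rw [hC₁, ENNReal.ofReal_add (by positivity) (by positivity)]
    refine add_le_add (ENNReal.ofReal_le_ofReal ?_) (h2.trans ((add_le_add_left hw₀ _).trans ?_))
    · linarith [le_abs_self (c 0)]
    · rw [← ENNReal.ofReal_add one_pos.le (by linarith)]
      exact ENNReal.ofReal_le_ofReal (by linarith)
  obtain ⟨x, hxm, hxK, hxmin⟩ := exists_measurable_condLExp_minimizer (μ := μ) (ψ := ψ) hm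
    (fun x hx => by
      have h1 : Measurable fun ω => (x ω).fst := hcfst.measurable.comp hx
      have h2 : Measurable fun ω => (x ω).snd := hcsnd.measurable.comp hx
      have h3 : Measurable fun ω => G ω + inner ℝ (x ω).fst (D ω) := hG.add (h1.inner hD)
      exact (((hcont.measurable.comp h1).add_const C).sub h3).ennreal_ofReal.add
        (hL.measurable.comp (h2.sub h3)))
    (fun ω x y a b ha hb hab => by
      have e1 : (a • x + b • y).fst = a • x.fst + b • y.fst := rfl
      have e2 : (a • x + b • y).snd = a * x.snd + b * y.snd := rfl
      have e3 : G ω + inner ℝ (a • x.fst + b • y.fst) (D ω)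
          = a * (G ω + inner ℝ x.fst (D ω)) + b * (G ω + inner ℝ y.fst (D ω)) := by
        rw [inner_add_left, real_inner_smul_left, real_inner_smul_left]
        linear_combination (-G ω) * hab
      simp only [hψ]
      rw [e1, e2, e3]
      have h1 := hc.2 (Set.mem_univ x.fst) (Set.mem_univ y.fst) ha hb hab
      simp only [smul_eq_mul] at h1
      calc _ ≤ ENNReal.ofReal (a * (c x.fst + C - (G ω + inner ℝ x.fst (D ω)))
              + b * (c y.fst + C - (G ω + inner ℝ y.fst (D ω))))
            + L (a * (x.snd - (G ω + inner ℝ x.fst (D ω)))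
              + b * (y.snd - (G ω + inner ℝ y.fst (D ω)))) := by
            refine add_le_add (ENNReal.ofReal_le_ofReal ?_) (le_of_eq (congrArg L ?_))
            · have : C = a * C + b * C := by rw [← add_mul, hab, one_mul]
              linarith
            · ring
        _ ≤ _ := add_le_add (ENNReal.ofReal_convexComb_le ha hb) (hL.convex _ _ a b ha hb hab)
        _ = _ := by ring)
    (fun ω => by
      refine LowerSemicontinuous.add (Continuous.lowerSemicontinuous ?_) (hL.lsc.comp ?_)
      · exact ENNReal.continuous_ofReal.comp (((hcont.comp hcfst).add_const C).sub
          (continuous_const.add (hcfst.inner continuous_const)))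
      · exact hcsnd.sub (continuous_const.add (hcfst.inner continuous_const)))
    x₀ (ENNReal.ofReal C₁) ENNReal.ofReal_ne_top K
    (by
      have : 0 ≤ C₁ + κG + κ * C₁ + (|CL| + C₁) / ε := by positivity
      rw [hK]; linarith)
    (.of_forall hψ_x₀)
    (.of_forall fun ω x hx => by
      simp only [hψ]
      by_cases ha : C₁ ≤ ‖x.fst‖
      · exact le_trans (ENNReal.ofReal_le_ofReal (ha.trans (hlow _ ω))) le_self_add
      · have ha' := (not_le.1 ha).le
        refine le_trans (le_trans (ENNReal.ofReal_le_ofReal ?_) (hCL _)) le_add_self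
        have h1 := hsum x
        have h2 : |x.snd| ≤ |x.snd - (G ω + inner ℝ x.fst (D ω))|
            + (|G ω| + |(inner ℝ x.fst (D ω) : ℝ)|) := by
          calc |x.snd| = |(x.snd - (G ω + inner ℝ x.fst (D ω)))
                + (G ω + inner ℝ x.fst (D ω))| := by congr 1; ring
            _ ≤ _ := (abs_add_le _ _).trans (add_le_add le_rfl (abs_add_le _ _))
        have h3 := hinner x.fst ω
        have h4 : κ * ‖x.fst‖ ≤ κ * C₁ := mul_le_mul_of_nonneg_left ha' hκ0
        have h5 := hGκ ω
        have h6 : (|CL| + C₁) / ε ≤ |x.snd - (G ω + inner ℝ x.fst (D ω))| := by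
          have := norm_nonneg x₀
          linarith
        rw [div_le_iff₀ hε] at h6
        linarith [le_abs_self CL])
  refine ⟨fun ω => (x ω).fst, fun ω => (x ω).snd, C, C₁, K, hcfst.measurable.comp hxm,
    hcsnd.measurable.comp hxm, fun ω => (hfst _).trans (hxK ω), fun ω => (hsnd _).trans (hxK ω),
    fun b ω => (norm_nonneg b).trans (hlow b ω), ?_, fun b τ hb hτ => ?_⟩
  · have h1 := hxmin (fun _ => x₀) measurable_const
    have h2 := condLExp_mono (mΩ := m) (P := μ) (X := fun ω => ψ ω x₀)
      (Y := fun _ => ENNReal.ofReal C₁) (.of_forall hψ_x₀)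
    rw [condLExp_const hm] at h2
    filter_upwards [h1, h2] with ω h1 h2 using h1.trans h2
  · refine hxmin (fun ω => WithLp.toLp 2 (b ω, τ ω)) ?_
    exact (WithLp.prod_continuous_toLp 2 E ℝ).measurable.comp (hb.prodMk hτ)

end RiskSharing

section RiskSharing

variable {Ω : Type*} {m m' mΩ : MeasurableSpace Ω} {μ : Measure Ω} [IsProbabilityMeasure μ]

/-- The linear terms satisfy `(γ - Z) + M = (K₁ - (Z - X)) + (K₂ - X) + (γ + M - (K₁ + K₂))`; `M`
only serves to make the last, known, term nonnegative. -/
theorem condLoss_add_condLoss (hm : m ≤ mΩ) {L₁ L₂ : ℝ → ENNReal}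
    (h₂ : IsLossExcess L₂) {Z X σ σ' γ : Ω → ℝ} (hX : Measurable X)
    (hσ : Measurable[m] σ) (hσ' : Measurable[m] σ') (hγ : Measurable[m] γ) {K₁ K₂ M : ℝ}
    (hM : 0 ≤ M) (hK₁ : ∀ ω, Z ω - X ω ≤ K₁) (hK₂ : ∀ ω, X ω ≤ K₂) (hZγ : ∀ ω, Z ω ≤ γ ω)
    (hγM : ∀ ω, K₁ + K₂ ≤ γ ω + M) :
    ∀ᵐ ω ∂μ, condLExp m μ (fun ω => ENNReal.ofReal (γ ω - Z ω)
        + (L₁ (σ ω - (Z ω - X ω)) + L₂ (σ' ω - X ω))) ω + ENNReal.ofReal M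
      = condLoss m μ L₁ K₁ (fun ω => Z ω - X ω) σ ω + condLoss m μ L₂ K₂ X σ' ω
        + ENNReal.ofReal (γ ω + M - (K₁ + K₂)) := by
  have hσΩ : Measurable σ := hσ.mono hm le_rfl
  have hσ'Ω : Measurable σ' := hσ'.mono hm le_rfl
  have e1 := condLExp_add_measurable (μ := μ) hm (fun ω => ENNReal.ofReal (γ ω - Z ω)
    + (L₁ (σ ω - (Z ω - X ω)) + L₂ (σ' ω - X ω))) (g := fun _ => ENNReal.ofReal M) measurable_const
  have e2 := condLExp_add_measurable (μ := μ) hm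
    (fun ω => (ENNReal.ofReal (K₁ - (Z ω - X ω)) + L₁ (σ ω - (Z ω - X ω)))
      + (ENNReal.ofReal (K₂ - X ω) + L₂ (σ' ω - X ω)))
    (g := fun ω => ENNReal.ofReal (γ ω + M - (K₁ + K₂)))
    (ENNReal.measurable_ofReal.comp ((hγ.add measurable_const).sub measurable_const))
  have e3 := condLExp_add_right (mΩ := m) (P := μ)
    (fun ω => ENNReal.ofReal (K₁ - (Z ω - X ω)) + L₁ (σ ω - (Z ω - X ω)))
    (Y := fun ω => ENNReal.ofReal (K₂ - X ω) + L₂ (σ' ω - X ω))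
    ((hX.const_sub K₂).ennreal_ofReal.add (h₂.measurable.comp (hσ'Ω.sub hX))).aemeasurable
  have e4 : (fun ω => ENNReal.ofReal (γ ω - Z ω)
        + (L₁ (σ ω - (Z ω - X ω)) + L₂ (σ' ω - X ω)) + ENNReal.ofReal M)
      = fun ω => (ENNReal.ofReal (K₁ - (Z ω - X ω)) + L₁ (σ ω - (Z ω - X ω)))
        + (ENNReal.ofReal (K₂ - X ω) + L₂ (σ' ω - X ω))
        + ENNReal.ofReal (γ ω + M - (K₁ + K₂)) := by
    ext ω
    have h1 := hK₁ ω
    have h2 := hK₂ ω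
    have h3 := hZγ ω
    have h4 := hγM ω
    have h5 : ENNReal.ofReal (γ ω - Z ω) + ENNReal.ofReal M
        = ENNReal.ofReal (K₁ - (Z ω - X ω)) + ENNReal.ofReal (K₂ - X ω)
          + ENNReal.ofReal (γ ω + M - (K₁ + K₂)) := by
      rw [← ENNReal.ofReal_add (by linarith) hM, ← ENNReal.ofReal_add (by linarith) (by linarith),
        ← ENNReal.ofReal_add (by linarith) (by linarith)]
      congr 1
      ring
    calc _ = (ENNReal.ofReal (γ ω - Z ω) + ENNReal.ofReal M)
          + (L₁ (σ ω - (Z ω - X ω)) + L₂ (σ' ω - X ω)) := by ring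
      _ = _ := by rw [h5]; ring
  rw [e4] at e1
  filter_upwards [e1, e2, e3] with ω e1 e2 e3
  rw [← e1, e2]
  congr 1

variable {E : Type*} [NormedAddCommGroup E] [InnerProductSpace ℝ E] [FiniteDimensional ℝ E]
  [MeasurableSpace E] [BorelSpace E]

/-- The sum of the two one-step objectives is bounded through the infimal convolution of the
excesses. Splitting according to the selection `g` turns this bound into an equality at the social
minimizer. -/
theorem exists_bounded_risk_sharing (hmm' : m ≤ m') (hm' : m' ≤ mΩ)
    {Hp Ha : ℝ → EReal} (hHp : IsCoerciveLoss Hp) (hHa : IsCoerciveLoss Ha) {D : Ω → E}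
    (hD : Measurable[m'] D) {κ : ℝ} (hDκ : ∀ ω, ‖D ω‖ ≤ κ) {c : E → ℝ}
    (hc : ConvexOn ℝ Set.univ c)
    (hc_superlinear : Tendsto (fun a => c a / ‖a‖) (Bornology.cobounded E) atTop)
    {G : Ω → ℝ} (hG : Measurable[m'] G) {κG : ℝ} (hGκ : ∀ ω, |G ω| ≤ κG) :
    ∃ (a : Ω → E) (X G' : Ω → ℝ), Measurable[m] a ∧ Measurable[m'] X ∧ Measurable[m] G' ∧
      (∃ C, ∀ ω, |G' ω| ≤ C) ∧
      (∀ᵐ ω ∂μ, oceStep m μ Ha (fun ω => (X ω : EReal)) ω = (c (a ω) : EReal)) ∧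
      (∀ᵐ ω ∂μ, oceStep m μ Hp
        (fun ω => ((G ω + inner ℝ (a ω) (D ω) - X ω : ℝ) : EReal)) ω = (G' ω : EReal)) ∧
      ∀ b : Ω → E, Measurable[m] b → (∃ C, ∀ ω, ‖b ω‖ ≤ C) →
        ∀ Y : Ω → ℝ, Measurable Y → (∃ C, ∀ ω, |Y ω| ≤ C) → ∀ᵐ ω ∂μ,
          oceBounded m μ Hp (fun ω => G ω + inner ℝ (b ω) (D ω) - Y ω) ω
            ≤ ((G' ω + c (b ω) : ℝ) : EReal) - oceBounded m μ Ha Y ω := by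
  have hm : m ≤ mΩ := hmm'.trans hm'
  have hcont : Continuous c := by
    rw [← continuousOn_univ]
    exact hc.continuousOn isOpen_univ
  have hDΩ : Measurable D := hD.mono hm' le_rfl
  have hGΩ : Measurable G := hG.mono hm' le_rfl
  obtain ⟨g, hg, hgmin⟩ := hHp.excess.exists_lipschitz_selector hHa.excess
  have hL := hHp.excess.infConv hHa.excess hg.continuous hgmin
  obtain ⟨a, σ, C, C₁, K, ha, hσ, haK, hσK, hpos, hΛC₁, hmin⟩ :=
    exists_social_loss_minimizer (μ := μ) hm hL hDΩ hDκ hc hc_superlinear hGΩ hGκ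
  set Λ : Ω → ENNReal := condLExp m μ (fun ω =>
    ENNReal.ofReal (c (a ω) + C - (G ω + inner ℝ (a ω) (D ω)))
      + (lossExcess Hp (g (σ ω - (G ω + inner ℝ (a ω) (D ω))))
        + lossExcess Ha (σ ω - (G ω + inner ℝ (a ω) (D ω))
          - g (σ ω - (G ω + inner ℝ (a ω) (D ω)))))) with hΛ
  have hΛm : Measurable[m] Λ := measurable_condLExp _ _ _
  -- Clipping at `C₁` is almost surely without effect and makes the surplus bounded everywhere, as
  -- the backward iteration requires.
  set G' : Ω → ℝ := fun ω => C - (min (Λ ω) (ENNReal.ofReal C₁)).toReal with hG'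
  have hG'm : Measurable[m] G' :=
    measurable_const.sub ((hΛm.min measurable_const).ennreal_toReal)
  have hΛfin : ∀ᵐ ω ∂μ, Λ ω ≠ ⊤ ∧ G' ω = C - (Λ ω).toReal := by
    filter_upwards [hΛC₁] with ω h
    refine ⟨ne_top_of_le_ne_top ENNReal.ofReal_ne_top h, ?_⟩
    rw [hG']
    simp only
    rw [min_eq_left h]
  have hG'b : ∀ ω, |G' ω| ≤ |C| + |C₁| := by
    intro ω
    refine (abs_sub _ _).trans (add_le_add le_rfl ?_)
    rw [abs_of_nonneg ENNReal.toReal_nonneg]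
    refine (ENNReal.toReal_mono ENNReal.ofReal_ne_top (min_le_right _ _)).trans ?_
    rw [ENNReal.toReal_ofReal']
    exact max_le (le_abs_self _) (abs_nonneg _)
  have hcost : ∀ b ω, -C - κG ≤ c b - inner ℝ b (D ω) := by
    intro b ω
    have h1 := hpos b ω
    have h2 := abs_le.1 (hGκ ω)
    linarith
  have hinner : ∀ (b : Ω → E) (B : ℝ), (∀ ω, ‖b ω‖ ≤ B) → ∀ ω, |(inner ℝ (b ω) (D ω) : ℝ)| ≤ B * κ :=
    fun b B hB ω => (abs_real_inner_le_norm _ _).trans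
      (mul_le_mul (hB ω) (hDκ ω) (norm_nonneg _) ((norm_nonneg _).trans (hB ω)))
  have hupper : ∀ b : Ω → E, Measurable[m] b → (∃ C, ∀ ω, ‖b ω‖ ≤ C) →
        ∀ Y : Ω → ℝ, Measurable Y → (∃ C, ∀ ω, |Y ω| ≤ C) → ∀ᵐ ω ∂μ,
          oceBounded m μ Hp (fun ω => G ω + inner ℝ (b ω) (D ω) - Y ω) ω
            ≤ ((G' ω + c (b ω) : ℝ) : EReal) - oceBounded m μ Ha Y ω := by
    rintro b hb ⟨B, hB⟩ Y hY ⟨KY, hKY⟩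
    have hcb : Measurable[m] fun ω => c (b ω) := hcont.measurable.comp hb
    have hρ : Measurable[m] fun ω => ((G' ω + c (b ω) : ℝ) : EReal) :=
      measurable_coe_real_ereal.comp (hG'm.add hcb)
    have hZm : Measurable fun ω => G ω + inner ℝ (b ω) (D ω) :=
      hGΩ.add ((hb.mono hm le_rfl).inner hDΩ)
    have hZYm : Measurable fun ω => G ω + inner ℝ (b ω) (D ω) - Y ω := hZm.sub hY
    set K₁ := κG + B * κ + KY with hK₁
    have hZYK : ∀ ω, |G ω + inner ℝ (b ω) (D ω) - Y ω| ≤ K₁ := fun ω =>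
      (abs_sub _ _).trans (add_le_add
        ((abs_add_le _ _).trans (add_le_add (hGκ ω) (hinner b B hB ω))) (hKY ω))
    set M := |K₁ + KY + κG + B * κ| with hMdef
    -- Only constant parameters are needed for the upper bound, since both certainty equivalents are
    -- essential suprema over constants; the two suprema are then taken one after the other.
    have hstep : ∀ s s' : ℝ, ∀ᵐ ω ∂μ,
        (K₁ : EReal) - (condLoss m μ (lossExcess Hp) K₁
          (fun ω => G ω + inner ℝ (b ω) (D ω) - Y ω) (fun _ => s) ω : EReal)
        ≤ ((G' ω + c (b ω) : ℝ) : EReal)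
          - ((KY : EReal) - (condLoss m μ (lossExcess Ha) KY Y (fun _ => s') ω : EReal)) := by
      intro s s'
      have e1 := condLoss_add_condLoss (μ := μ) hm (L₁ := lossExcess Hp) hHa.excess
        (Z := fun ω => G ω + inner ℝ (b ω) (D ω)) (X := Y) (σ := fun _ => s) (σ' := fun _ => s')
        (γ := fun ω => c (b ω) + C) (K₁ := K₁) (K₂ := KY) (M := M) hY measurable_const
        measurable_const (hcb.add measurable_const) (abs_nonneg _)
        (fun ω => (le_abs_self _).trans (hZYK ω)) (fun ω => (le_abs_self _).trans (hKY ω))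
        (fun ω => by have := hpos (b ω) ω; linarith)
        (fun ω => by
          have h1 := hcost (b ω) ω
          have h2 := abs_le.1 (hinner b B hB ω)
          have h3 := le_abs_self (K₁ + KY + κG + B * κ)
          linarith)
      have e2 := hmin b (fun _ => s + s') hb measurable_const
      have e3 := condLExp_mono (mΩ := m) (P := μ)
        (X := fun ω => ENNReal.ofReal (c (b ω) + C - (G ω + inner ℝ (b ω) (D ω)))
          + (lossExcess Hp (g (s + s' - (G ω + inner ℝ (b ω) (D ω))))
            + lossExcess Ha (s + s' - (G ω + inner ℝ (b ω) (D ω))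
              - g (s + s' - (G ω + inner ℝ (b ω) (D ω))))))
        (Y := fun ω => ENNReal.ofReal (c (b ω) + C - (G ω + inner ℝ (b ω) (D ω)))
          + (lossExcess Hp (s - (G ω + inner ℝ (b ω) (D ω) - Y ω)) + lossExcess Ha (s' - Y ω)))
        (.of_forall fun ω => by
          refine add_le_add le_rfl ((hgmin _ (s - (G ω + inner ℝ (b ω) (D ω) - Y ω))).trans_eq ?_)
          congr 2
          ring)
      filter_upwards [e1, e2, e3, hΛfin] with ω e1 e2 e3 hΛω
      obtain ⟨hΛω, hG'ω⟩ := hΛω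
      have e4 := add_le_add_left (e2.trans e3) (ENNReal.ofReal M)
      rw [e1] at e4
      change Λ ω + _ ≤ _ at e4
      generalize condLoss m μ (lossExcess Hp) K₁
          (fun ω => G ω + inner ℝ (b ω) (D ω) - Y ω) (fun _ => s) ω = R₁ at e4 ⊢
      generalize condLoss m μ (lossExcess Ha) KY Y (fun _ => s') ω = R₂ at e4 ⊢
      by_cases hR₁ : R₁ = ⊤
      · simp [hR₁]
      by_cases hR₂ : R₂ = ⊤
      · simp [hR₂]
      have h1 := hcost (b ω) ω
      have h2 := abs_le.1 (hinner b B hB ω)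
      have h3 := le_abs_self (K₁ + KY + κG + B * κ)
      have h4 := ENNReal.toReal_mono (by finiteness) e4
      rw [ENNReal.toReal_add hΛω (by finiteness), ENNReal.toReal_add (by finiteness) (by finiteness),
        ENNReal.toReal_add hR₁ hR₂, ENNReal.toReal_ofReal (abs_nonneg _),
        ENNReal.toReal_ofReal (by linarith)] at h4
      rw [EReal.coe_sub_coe_ennreal hR₁, EReal.coe_sub_coe_ennreal hR₂, ← EReal.coe_sub,
        EReal.coe_le_coe_iff, hG'ω]
      linarith
    have hhalf : ∀ s' : ℝ, ∀ᵐ ω ∂μ, oceBounded m μ Hp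
          (fun ω => G ω + inner ℝ (b ω) (D ω) - Y ω) ω
        ≤ ((G' ω + c (b ω) : ℝ) : EReal)
          - ((KY : EReal) - (condLoss m μ (lossExcess Ha) KY Y (fun _ => s') ω : EReal)) := by
      intro s'
      refine oceBounded_le hm hHp hZYm hZYK ?_ fun s => hstep s s'
      have hR : Measurable[m] (condLoss m μ (lossExcess Ha) KY Y (fun _ => s')) :=
        measurable_condLExp _ _ _
      simp only [sub_eq_add_neg]
      exact hρ.add (measurable_const.add hR.coe_ereal_ennreal.neg).neg
    have hfull : oceBounded m μ Ha Y ≤ᵐ[μ] fun ω => ((G' ω + c (b ω) : ℝ) : EReal)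
        - oceBounded m μ Hp (fun ω => G ω + inner ℝ (b ω) (D ω) - Y ω) ω := by
      refine oceBounded_le hm hHa hY hKY ?_ fun s' => ?_
      · simp only [sub_eq_add_neg]
        exact hρ.add (measurable_oceBounded hm _).neg
      · filter_upwards [hhalf s'] with ω h using EReal.le_coe_sub_comm h
    filter_upwards [hfull] with ω h using EReal.le_coe_sub_comm h
  -- the optimal transfer before normalization
  set Z : Ω → ℝ := fun ω => G ω + inner ℝ (a ω) (D ω) with hZdef
  have hZm' : Measurable[m'] Z := hG.add ((ha.mono hmm' le_rfl).inner hD)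
  have hZm : Measurable Z := hZm'.mono hm' le_rfl
  have hZK : ∀ ω, |Z ω| ≤ κG + K * κ := fun ω =>
    (abs_add_le _ _).trans (add_le_add (hGκ ω) (hinner a K haK ω))
  -- With parameters `σ` for the Principal and 0 for the Agent, the arguments of the excesses become
  -- `g (σ - Z)` and `(σ - Z) - g (σ - Z)`, the optimal split. Boundedness follows from the
  -- Lipschitz property of `g`.
  set X₀ : Ω → ℝ := fun ω => g (σ ω - Z ω) - (σ ω - Z ω) with hX₀def
  have hw : Measurable[m'] fun ω => σ ω - Z ω := (hσ.mono hmm' le_rfl).sub hZm'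
  have hX₀m' : Measurable[m'] X₀ := (hg.continuous.measurable.comp hw).sub hw
  have hX₀m : Measurable X₀ := hX₀m'.mono hm' le_rfl
  set KX := |g 0| + 2 * (K + (κG + K * κ)) with hKX
  have hX₀K : ∀ ω, |X₀ ω| ≤ KX := by
    intro ω
    have h1 : |σ ω - Z ω| ≤ K + (κG + K * κ) :=
      (abs_sub _ _).trans (add_le_add (hσK ω) (hZK ω))
    have h2 := hg.dist_le_mul (σ ω - Z ω) 0
    rw [Real.dist_eq, Real.dist_eq, NNReal.coe_one, one_mul, sub_zero] at h2
    have h3 : |g (σ ω - Z ω)| ≤ |g 0| + |σ ω - Z ω| := by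
      have := abs_sub_abs_le_abs_sub (g (σ ω - Z ω)) (g 0)
      linarith
    refine (abs_sub _ _).trans ?_
    linarith
  have hcam : Measurable[m] fun ω => c (a ω) := hcont.measurable.comp ha
  set K₁ := κG + K * κ + KX with hK₁
  have hZXK : ∀ ω, |Z ω - X₀ ω| ≤ K₁ := fun ω =>
    (abs_sub _ _).trans (add_le_add (hZK ω) (hX₀K ω))
  have hZXm : Measurable fun ω => Z ω - X₀ ω := hZm.sub hX₀m
  set M := |K₁ + KX + κG + K * κ| with hMdef
  have hcM : ∀ ω, K₁ + KX ≤ c (a ω) + C + M := fun ω => by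
    have h1 := hcost (a ω) ω
    have h2 := abs_le.1 (hinner a K haK ω)
    have h3 := le_abs_self (K₁ + KX + κG + K * κ)
    linarith
  have e1 := condLoss_add_condLoss (μ := μ) hm (L₁ := lossExcess Hp) hHa.excess
    (Z := Z) (X := X₀) (σ := σ) (σ' := fun _ => 0)
    (γ := fun ω => c (a ω) + C) (K₁ := K₁) (K₂ := KX) (M := M) hX₀m hσ
    measurable_const (hcam.add measurable_const) (abs_nonneg _)
    (fun ω => (le_abs_self _).trans (hZXK ω)) (fun ω => (le_abs_self _).trans (hX₀K ω))
    (fun ω => by have := hpos (a ω) ω; simp only [hZdef]; linarith) hcM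
  have hΛ' : condLExp m μ (fun ω => ENNReal.ofReal (c (a ω) + C - Z ω)
        + (lossExcess Hp (σ ω - (Z ω - X₀ ω)) + lossExcess Ha (0 - X₀ ω))) = Λ := by
    rw [hΛ]
    congr 1
    ext ω
    simp only [hX₀def, hZdef]
    congr 3 <;> ring
  rw [hΛ'] at e1
  have hlow₁ := le_oceBounded (μ := μ) hm hHp hZXm hZXK hσ
  have hlow₂ := le_oceBounded_const (μ := μ) hm hHa hX₀m hX₀K 0
  -- The lower bounds given by these parameters add up exactly to the upper bound for the sum, so
  -- both are equalities and both utilities are finite.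
  have hopt : ∀ᵐ ω ∂μ, ∃ u : ℝ, oceBounded m μ Ha X₀ ω = (u : EReal) ∧
      oceBounded m μ Hp (fun ω => Z ω - X₀ ω) ω = ((G' ω + c (a ω) - u : ℝ) : EReal) := by
    filter_upwards [e1, hlow₁, hlow₂, hΛfin, hupper a ha ⟨K, haK⟩ X₀ hX₀m ⟨KX, hX₀K⟩]
      with ω e1 h1 h2 hΛω h3
    obtain ⟨hΛω, hG'ω⟩ := hΛω
    have hfin : condLoss m μ (lossExcess Hp) K₁ (fun ω => Z ω - X₀ ω) σ ω
        + condLoss m μ (lossExcess Ha) KX X₀ (fun _ => 0) ω ≠ ⊤ := by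
      intro h
      rw [h, top_add] at e1
      exact absurd e1 (by finiteness)
    obtain ⟨hR₁, hR₂⟩ := ENNReal.add_ne_top.1 hfin
    change oceBounded m μ Hp (fun ω => Z ω - X₀ ω) ω ≤ _ at h3
    generalize condLoss m μ (lossExcess Hp) K₁ (fun ω => Z ω - X₀ ω) σ ω = R₁ at *
    generalize condLoss m μ (lossExcess Ha) KX X₀ (fun _ => 0) ω = R₂ at *
    have h4 := congrArg ENNReal.toReal e1
    rw [ENNReal.toReal_add hΛω (by finiteness), ENNReal.toReal_add (by finiteness) (by finiteness),
      ENNReal.toReal_add hR₁ hR₂, ENNReal.toReal_ofReal (abs_nonneg _),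
      ENNReal.toReal_ofReal (by linarith [hcM ω])] at h4
    rw [EReal.coe_sub_coe_ennreal hR₁] at h1
    rw [EReal.coe_sub_coe_ennreal hR₂] at h2
    have h5 := EReal.le_coe_sub_comm (h1.trans h3)
    rw [← EReal.coe_sub] at h5
    have hkey : G' ω + c (a ω) - (K₁ - R₁.toReal) = KX - R₂.toReal := by
      rw [hG'ω]
      linarith
    rw [hkey] at h5
    have hA := le_antisymm h5 h2
    rw [hA, ← EReal.coe_sub] at h3
    refine ⟨_, hA, le_antisymm h3 (le_trans ?_ h1)⟩
    rw [EReal.coe_le_coe_iff]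
    linarith
  -- This known cash amount brings the Agent to `c (a ω)`; by cash additivity the Principal is left
  -- with `G'`.
  set r : Ω → ℝ := fun ω => c (a ω) - (oceBounded m μ Ha X₀ ω).toReal with hr
  have hrm : Measurable[m] r :=
    hcam.sub (measurable_ereal_toReal.comp (measurable_oceBounded hm X₀))
  refine ⟨a, fun ω => X₀ ω + r ω, G', ha, hX₀m'.add (hrm.mono hmm' le_rfl), hG'm, ⟨_, hG'b⟩,
    ?_, ?_, hupper⟩
  · have h1 := oceStep_add (μ := μ) hm hHa (X := fun ω => (X₀ ω : EReal))
      (measurable_coe_real_ereal.comp hX₀m) hrm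
    filter_upwards [h1, oceStep_of_bounded (μ := μ) hm hHa hX₀m hX₀K, hopt] with ω h1 h2 h3
    obtain ⟨u, hu, -⟩ := h3
    simp only [EReal.coe_add]
    rw [h1, h2, hr]
    simp only
    rw [hu, EReal.toReal_coe, ← EReal.coe_add]
    congr 1
    ring
  · have h1 := oceStep_add (μ := μ) hm hHp (X := fun ω => ((Z ω - X₀ ω : ℝ) : EReal))
      (measurable_coe_real_ereal.comp hZXm) (r := fun ω => - r ω) hrm.neg
    have h4 : (fun ω => ((Z ω - (X₀ ω + r ω) : ℝ) : EReal))
        = fun ω => ((Z ω - X₀ ω : ℝ) : EReal) + ((- r ω : ℝ) : EReal) := by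
      ext ω
      rw [← EReal.coe_add]
      congr 1
      ring
    change ∀ᵐ ω ∂μ, oceStep m μ Hp (fun ω => ((Z ω - (X₀ ω + r ω) : ℝ) : EReal)) ω = _
    rw [h4]
    filter_upwards [h1, oceStep_of_bounded (μ := μ) hm hHp hZXm hZXK, hopt] with ω h1 h2 h3
    obtain ⟨u, hu, hv⟩ := h3
    rw [h1, h2, hv, hr]
    simp only
    rw [hu, EReal.toReal_coe, ← EReal.coe_add]
    congr 1
    ring

end RiskSharing

section RiskSharing

variable {Ω : Type*} {m m' mΩ : MeasurableSpace Ω} {μ : Measure Ω} [IsProbabilityMeasure μ]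
  {E : Type*} [NormedAddCommGroup E] [InnerProductSpace ℝ E] [FiniteDimensional ℝ E]
  [MeasurableSpace E] [BorelSpace E]

/-- Optimal risk sharing over one period: the effort `a` and the Agent's payoff `X` maximize the sum
of the utilities net of the cost of effort; `X` is normalized so that it just covers the cost. -/
theorem exists_risk_sharing (hmm' : m ≤ m') (hm' : m' ≤ mΩ)
    {Hp Ha : ℝ → EReal} (hHp : IsCoerciveLoss Hp) (hHa : IsCoerciveLoss Ha) {D : Ω → E}
    (hD : Measurable[m'] D) {κ : ℝ} (hDκ : ∀ᵐ ω ∂μ, ‖D ω‖ ≤ κ) {c : E → ℝ}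
    (hc : ConvexOn ℝ Set.univ c)
    (hc_superlinear : Tendsto (fun a => c a / ‖a‖) (Bornology.cobounded E) atTop)
    {G : Ω → ℝ} (hG : Measurable[m'] G) (hGb : ∃ C, ∀ ω, |G ω| ≤ C) :
    ∃ (a : Ω → E) (X G' : Ω → ℝ), Measurable[m] a ∧ Measurable[m'] X ∧ Measurable[m] G' ∧
      (∃ C, ∀ ω, |G' ω| ≤ C) ∧
      (∀ᵐ ω ∂μ, oceStep m μ Ha (fun ω => (X ω : EReal)) ω = (c (a ω) : EReal)) ∧
      (∀ᵐ ω ∂μ, oceStep m μ Hp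
        (fun ω => ((G ω + inner ℝ (a ω) (D ω) - X ω : ℝ) : EReal)) ω = (G' ω : EReal)) ∧
      ∀ b : Ω → E, Measurable[m] b → ∀ Y : Ω → EReal, Measurable Y → ∀ᵐ ω ∂μ,
          oceStep m μ Hp (fun ω => ((G ω + inner ℝ (b ω) (D ω) : ℝ) : EReal) - Y ω) ω
            ≤ ((G' ω + c (b ω) : ℝ) : EReal) - oceStep m μ Ha Y ω := by
  classical
  have hm : m ≤ mΩ := hmm'.trans hm'
  obtain ⟨κG, hκG⟩ := hGb
  -- Returns are bounded only almost surely; a modification on a null set makes them bounded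
  -- everywhere.
  set D' : Ω → E := fun ω => if ‖D ω‖ ≤ κ then D ω else 0 with hD'def
  have hD' : Measurable[m'] D' :=
    Measurable.ite ((measurable_norm.comp hD) measurableSet_Iic) hD measurable_const
  have hD'D : ∀ᵐ ω ∂μ, D' ω = D ω := by
    filter_upwards [hDκ] with ω h
    simp [hD'def, h]
  have hD'κ : ∀ ω, ‖D' ω‖ ≤ |κ| := by
    intro ω
    by_cases h : ‖D ω‖ ≤ κ
    · simpa [hD'def, h] using h.trans (le_abs_self κ)
    · simp [hD'def, h]
  have hDΩ : Measurable D := hD.mono hm' le_rfl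
  have hD'Ω : Measurable D' := hD'.mono hm' le_rfl
  have hGΩ : Measurable G := hG.mono hm' le_rfl
  have hZm : ∀ b : Ω → E, Measurable[m] b → Measurable fun ω => G ω + inner ℝ (b ω) (D ω) :=
    fun b hb => hGΩ.add ((hb.mono hm le_rfl).inner hDΩ)
  have hZm' : ∀ b : Ω → E, Measurable[m] b → Measurable fun ω => G ω + inner ℝ (b ω) (D' ω) :=
    fun b hb => hGΩ.add ((hb.mono hm le_rfl).inner hD'Ω)
  obtain ⟨a, X, G', ha, hX, hG', hG'b, hXa, hXp, hub⟩ :=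
    exists_bounded_risk_sharing (μ := μ) hmm' hm' hHp hHa hD' hD'κ hc hc_superlinear hG hκG
  have hXΩ : Measurable X := hX.mono hm' le_rfl
  refine ⟨a, X, G', ha, hX, hG', hG'b, hXa, ?_, fun b hb Y hY => ?_⟩
  · have h := oceStep_congr (μ := μ) hm hHp
      (X := fun ω => ((G ω + inner ℝ (a ω) (D ω) - X ω : ℝ) : EReal))
      (Y := fun ω => ((G ω + inner ℝ (a ω) (D' ω) - X ω : ℝ) : EReal))
      (measurable_coe_real_ereal.comp ((hZm a ha).sub hXΩ))
      (measurable_coe_real_ereal.comp ((hZm' a ha).sub hXΩ))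
      (by filter_upwards [hD'D] with ω h; rw [h])
    filter_upwards [h, hXp] with ω h1 h2
    rw [h1, h2]
  · have hsub : ∀ Z : Ω → ℝ, Measurable Z → Measurable fun ω => (Z ω : EReal) - Y ω := by
      intro Z hZ
      simp only [sub_eq_add_neg]
      exact (measurable_coe_real_ereal.comp hZ).add hY.neg
    -- An arbitrary effort is cut off outside the known event `‖b‖ ≤ j`; the bound is local, and the
    -- events exhaust the space.
    have key : ∀ j : ℕ, ∀ᵐ ω ∂μ, ‖b ω‖ ≤ j →
        oceStep m μ Hp (fun ω => ((G ω + inner ℝ (b ω) (D ω) : ℝ) : EReal) - Y ω) ω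
            ≤ ((G' ω + c (b ω) : ℝ) : EReal) - oceStep m μ Ha Y ω := by
      intro j
      set A : Set Ω := {ω | ‖b ω‖ ≤ j}
      have hA : MeasurableSet[m] A := (measurable_norm.comp hb) measurableSet_Iic
      set b' : Ω → E := A.indicator b
      have hb' : Measurable[m] b' := hb.indicator hA
      have hb'A : ∀ ω ∈ A, b' ω = b ω := fun ω hω => Set.indicator_of_mem hω b
      have hb'j : ∀ ω, ‖b' ω‖ ≤ j := by
        intro ω
        by_cases h : ω ∈ A
        · rw [hb'A ω h]
          exact h
        · rw [show b' ω = 0 from Set.indicator_of_notMem h b, norm_zero]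
          exact Nat.cast_nonneg j
      have hZb : ∀ ω, |G ω + inner ℝ (b' ω) (D' ω)| ≤ κG + j * |κ| := fun ω =>
        (abs_add_le _ _).trans (add_le_add (hκG ω) ((abs_real_inner_le_norm _ _).trans
          (mul_le_mul (hb'j ω) (hD'κ ω) (norm_nonneg _) (Nat.cast_nonneg j))))
      have h1 := oceStep_coe_sub_le (μ := μ) hm hHp (H₂ := Ha) (hZm' b' hb') hZb
        (ρ := fun ω => G' ω + c (b' ω)) (fun Y hY hYb => hub b' hb' ⟨j, hb'j⟩ Y hY hYb) hY
      have h2 := oceStep_mono_on (μ := μ) hm hHp (hsub _ (hZm b hb)) (hsub _ (hZm' b' hb')) hA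
        (by
          filter_upwards [hD'D] with ω hω hωA
          rw [hb'A ω hωA, hω])
      filter_upwards [h1, h2] with ω h1 h2 hω
      refine (h2 hω).trans (h1.trans_eq ?_)
      rw [hb'A ω hω]
    filter_upwards [ae_all_iff.2 key] with ω h
    obtain ⟨j, hj⟩ := exists_nat_ge ‖b ω‖
    exact h j hj

end RiskSharing

/-! ### Pasted utilities -/

/-- Backward recursion with choices. -/
theorem exists_backward_recursion {α : Type*} (T : ℕ) {Q : ℕ → α → Prop} {S : ℕ → α → α → Prop}
    {x₀ : α} (h0 : Q T x₀) (hstep : ∀ t < T, ∀ x, Q (t + 1) x → ∃ y, Q t y ∧ S t y x) :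
    ∃ f : ℕ → α, f T = x₀ ∧ (∀ t ≤ T, Q t (f t)) ∧ ∀ t < T, S t (f t) (f (t + 1)) := by
  have hstep' : ∀ t x, ∃ y, t < T → Q (t + 1) x → Q t y ∧ S t y x := by
    intro t x
    by_cases h : t < T ∧ Q (t + 1) x
    · obtain ⟨y, hy⟩ := hstep t h.1 x h.2
      exact ⟨y, fun _ _ => hy⟩
    · exact ⟨x, fun h1 h2 => absurd ⟨h1, h2⟩ h⟩
  choose φ hφ using hstep'
  -- Indexed by the time to maturity `j = T - t`; the value at `j + 1` is chosen at time `T - (j +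
  -- 1)`.
  let g : ℕ → α := fun j => Nat.rec x₀ (fun j x => φ (T - (j + 1)) x) j
  have hf : ∀ t < T, g (T - t) = φ t (g (T - (t + 1))) := by
    intro t ht
    have e1 : T - t = (T - (t + 1)) + 1 := by omega
    have e2 : T - ((T - (t + 1)) + 1) = t := by omega
    rw [e1]
    change φ (T - ((T - (t + 1)) + 1)) (g (T - (t + 1))) = _
    rw [e2]
  have hQ : ∀ j ≤ T, Q (T - j) (g j) := by
    intro j
    induction j with
    | zero => exact fun _ => h0
    | succ j ih =>
      intro hj
      have h1 := ih (by omega)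
      have e : T - j = T - (j + 1) + 1 := by omega
      rw [e] at h1
      exact (hφ (T - (j + 1)) (g j) (by omega) h1).1
  have hQ' : ∀ t ≤ T, Q t (g (T - t)) := by
    intro t ht
    have h1 := hQ (T - t) (by omega)
    rwa [show T - (T - t) = t by omega] at h1
  refine ⟨fun t => g (T - t), by simp [g], hQ', fun t ht => ?_⟩
  simp only
  rw [hf t ht]
  exact (hφ t _ ht (hQ' (t + 1) ht)).2

theorem pasteSteps_congr {Ω : Type*} {u u' : ℕ → (Ω → EReal) → (Ω → EReal)} (k : ℕ) :
    ∀ (t : ℕ) (X : Ω → EReal), (∀ s, t ≤ s → s < t + k → u s = u' s) →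
      pasteSteps u k t X = pasteSteps u' k t X := by
  induction k with
  | zero => exact fun _ _ _ => rfl
  | succ k ih =>
    intro t X h
    rw [pasteSteps, pasteSteps, ih (t + 1) X fun s h1 h2 => h s (by omega) (by omega),
      h t le_rfl (by omega)]

section OceUtility

variable {Ω : Type*} {mΩ : MeasurableSpace Ω} {μ : Measure Ω}
  {𝒢 : ℕ → MeasurableSpace Ω} {T : ℕ} {H : ℕ → ℝ → EReal}

theorem oceUtility_self (X : Ω → EReal) : oceUtility μ 𝒢 T H T X = X := by
  rw [oceUtility, Nat.sub_self, pasteSteps]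

theorem oceUtility_of_lt {t : ℕ} (ht : t < T) (X : Ω → EReal) :
    oceUtility μ 𝒢 T H t X = oceStep (𝒢 t) μ (H t) (oceUtility μ 𝒢 T H (t + 1) X) := by
  rw [oceUtility, oceUtility, show T - t = (T - (t + 1)) + 1 by omega, pasteSteps]

variable [IsProbabilityMeasure μ]

theorem measurable_oceUtility (h𝒢 : ∀ t < T, 𝒢 t ≤ mΩ) {X : Ω → EReal} (hX : Measurable X)
    {t : ℕ} (ht : t ≤ T) : Measurable (oceUtility μ 𝒢 T H t X) := by
  rcases ht.eq_or_lt with rfl | ht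
  · rwa [oceUtility_self]
  · rw [oceUtility_of_lt ht]
    exact (measurable_oceStep (h𝒢 t ht) _).mono (h𝒢 t ht) le_rfl

/-- Verification principle: monotonicity carries the terminal inequality backward along a
supersolution `J` of the recursion. `le_oceUtility` is the counterpart for subsolutions. -/
theorem oceUtility_le (h𝒢 : ∀ t < T, 𝒢 t ≤ mΩ) (hH : ∀ t < T, IsCoerciveLoss (H t))
    {X : Ω → EReal} (hX : Measurable X) {J : ℕ → Ω → EReal} (hJ : ∀ t ≤ T, Measurable (J t))
    (hJT : X ≤ᵐ[μ] J T) (hstep : ∀ t < T, oceStep (𝒢 t) μ (H t) (J (t + 1)) ≤ᵐ[μ] J t)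
    {t : ℕ} (ht : t ≤ T) : oceUtility μ 𝒢 T H t X ≤ᵐ[μ] J t := by
  induction ht using Nat.decreasingInduction with
  | self => rwa [oceUtility_self]
  | of_succ t ht ih =>
    rw [oceUtility_of_lt ht]
    exact (oceStep_mono (h𝒢 t ht) (hH t ht) (measurable_oceUtility h𝒢 hX ht) (hJ _ ht) ih).trans
      (hstep t ht)

theorem le_oceUtility (h𝒢 : ∀ t < T, 𝒢 t ≤ mΩ) (hH : ∀ t < T, IsCoerciveLoss (H t))
    {X : Ω → EReal} (hX : Measurable X) {J : ℕ → Ω → EReal} (hJ : ∀ t ≤ T, Measurable (J t))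
    (hJT : J T ≤ᵐ[μ] X) (hstep : ∀ t < T, J t ≤ᵐ[μ] oceStep (𝒢 t) μ (H t) (J (t + 1)))
    {t : ℕ} (ht : t ≤ T) : J t ≤ᵐ[μ] oceUtility μ 𝒢 T H t X := by
  induction ht using Nat.decreasingInduction with
  | self => rwa [oceUtility_self]
  | of_succ t ht ih =>
    rw [oceUtility_of_lt ht]
    exact (hstep t ht).trans
      (oceStep_mono (h𝒢 t ht) (hH t ht) (hJ _ ht) (measurable_oceUtility h𝒢 hX ht) ih)

theorem oceUtility_of_measurable (h𝒢 : ∀ t < T, 𝒢 t ≤ mΩ) (h𝒢_mono : ∀ t < T, 𝒢 t ≤ 𝒢 (t + 1))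
    (hH : ∀ t < T, IsCoerciveLoss (H t)) {X : Ω → EReal} (hXΩ : Measurable X) {t : ℕ} (ht : t ≤ T)
    (hX : Measurable[𝒢 t] X) : oceUtility μ 𝒢 T H t X =ᵐ[μ] X := by
  induction ht using Nat.decreasingInduction with
  | self => rw [oceUtility_self]
  | of_succ t ht ih =>
    rw [oceUtility_of_lt ht]
    have h1 := ih (hX.mono (h𝒢_mono t ht) le_rfl)
    exact (oceStep_congr (h𝒢 t ht) (hH t ht) (measurable_oceUtility h𝒢 hXΩ ht) hXΩ h1).trans
      (oceStep_of_measurable (h𝒢 t ht) (hH t ht) hX)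

end OceUtility

/-! ### The Principal-Agent model -/

theorem EReal.coe_add_sub_sub_eq (x y z : ℝ) (v : EReal) :
    ((x + y - z : ℝ) : EReal) - v = ((x : EReal) - (v + (z : EReal))) + (y : EReal) := by
  induction v with
  | bot => rw [EReal.bot_add, EReal.coe_sub_bot, EReal.coe_sub_bot, EReal.top_add_coe]
  | top => rw [EReal.top_add_coe, EReal.sub_top, EReal.sub_top, EReal.bot_add]
  | coe v =>
    rw [← EReal.coe_add, ← EReal.coe_sub, ← EReal.coe_sub, ← EReal.coe_add]
    congr 1
    ring

theorem EReal.eq_add_coe_of_sub_coe_eq {x v : EReal} {r : ℝ} (h : x - (r : EReal) = v) :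
    x = v + (r : EReal) := by
  rw [← h, sub_eq_add_neg, add_assoc, ← EReal.coe_neg, ← EReal.coe_add, neg_add_cancel,
    EReal.coe_zero, add_zero]

namespace PAModel

variable {Ω : Type*} {N : ℕ} (M : PAModel Ω N)

theorem wealth_succ_sub (A : ℕ → Ω → EuclideanSpace ℝ (Fin N)) (t : ℕ) (ω : Ω) :
    M.wealth A (t + 1) ω - M.wealth A t ω = M.gain t (A t) ω := by
  rw [wealth, wealth, Finset.sum_range_succ]
  ring

theorem payment_eq (Θ : Ω → ℝ) (β : ℕ → Ω → ℝ) (A : ℕ → Ω → EuclideanSpace ℝ (Fin N)) (ω : Ω) :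
    M.payment Θ β A ω = Θ ω + ∑ t ∈ Finset.range M.T, β t ω * M.gain t (A t) ω := by
  simp only [payment, wealth_succ_sub]

theorem payment_one (Θ : Ω → ℝ) (A : ℕ → Ω → EuclideanSpace ℝ (Fin N)) (ω : Ω) :
    M.payment Θ (fun _ _ => 1) A ω = Θ ω + (M.wealth A M.T ω - M.W₀) := by
  simp [payment_eq, wealth]

/-- The returns `diag(P_t)⁻¹ (P_{t+1} - P_t)`. -/
noncomputable def returns (t : ℕ) (ω : Ω) : EuclideanSpace ℝ (Fin N) :=
  WithLp.toLp 2 fun i => (M.P (t + 1) ω i - M.P t ω i) / M.P t ω i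

theorem gain_eq_inner (t : ℕ) (a : Ω → EuclideanSpace ℝ (Fin N)) (ω : Ω) :
    M.gain t a ω = inner ℝ (a ω) (M.returns t ω) := by
  rw [gain, PiLp.inner_apply]
  refine Finset.sum_congr rfl fun i _ => ?_
  rw [returns]
  simp [mul_comm]

theorem norm_returns_le {p q : ℝ} (hp : 0 < p) {t : ℕ} {ω : Ω}
    (h0 : ∀ i, p ≤ M.P t ω i ∧ M.P t ω i ≤ q)
    (h1 : ∀ i, p ≤ M.P (t + 1) ω i ∧ M.P (t + 1) ω i ≤ q) :
    ‖M.returns t ω‖ ≤ Real.sqrt (∑ _i : Fin N, ((q - p) / p) ^ 2) := by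
  rw [EuclideanSpace.norm_eq]
  refine Real.sqrt_le_sqrt (Finset.sum_le_sum fun i _ => ?_)
  have h2 := h0 i
  have h3 := h1 i
  have hpos : 0 < M.P t ω i := hp.trans_le h2.1
  have h4 : ‖M.returns t ω i‖ ≤ (q - p) / p := by
    change |(M.P (t + 1) ω i - M.P t ω i) / M.P t ω i| ≤ (q - p) / p
    rw [abs_div, abs_of_pos hpos]
    refine div_le_div₀ (by linarith) (abs_le.2 ⟨by linarith, by linarith⟩) hp h2.1
  exact pow_le_pow_left₀ (norm_nonneg _) h4 2

theorem priceInfo_mono {s t : ℕ} (h : s ≤ t) : M.priceInfo s ≤ M.priceInfo t :=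
  iSup_le fun r => iSup_le fun hr => le_iSup₂_of_le r (hr.trans h) le_rfl

theorem measurable_price {s t : ℕ} (h : s ≤ t) : Measurable[M.priceInfo t] (M.P s) :=
  Measurable.of_comap_le (le_iSup₂_of_le s h le_rfl)

theorem measurable_returns (t : ℕ) : Measurable[M.priceInfo (t + 1)] (M.returns t) := by
  have hcoord : ∀ s ≤ t + 1, ∀ i, Measurable[M.priceInfo (t + 1)] fun ω => M.P s ω i :=
    fun s hs i => (measurable_pi_apply i).comp
      ((PiLp.continuous_ofLp 2 _).measurable.comp (M.measurable_price hs))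
  refine (PiLp.continuous_toLp 2 _).measurable.comp
    (@measurable_pi_lambda _ _ _ (M.priceInfo (t + 1)) _ _ fun i => ?_)
  exact ((hcoord _ le_rfl i).sub (hcoord _ (Nat.le_succ t) i)).div (hcoord _ (Nat.le_succ t) i)

theorem measurable_gain {t : ℕ} {a : Ω → EuclideanSpace ℝ (Fin N)}
    (ha : Measurable[M.priceInfo t] a) : Measurable[M.priceInfo (t + 1)] (M.gain t a) := by
  have h : M.gain t a = fun ω => inner ℝ (a ω) (M.returns t ω) := funext (M.gain_eq_inner t a)
  rw [h]
  exact (continuous_inner (𝕜 := ℝ)).measurable.comp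
    ((ha.mono (M.priceInfo_mono (Nat.le_succ t)) le_rfl).prodMk (M.measurable_returns t))

/-- Cumulated sums of one-period random variables are known at the end of the last period. -/
theorem measurable_sum_range {x : ℕ → Ω → ℝ} {t : ℕ}
    (hx : ∀ s < t, Measurable[M.priceInfo (s + 1)] (x s)) :
    Measurable[M.priceInfo t] fun ω => ∑ s ∈ Finset.range t, x s ω :=
  Finset.measurable_fun_sum _ fun s hs =>
    (hx s (Finset.mem_range.1 hs)).mono (M.priceInfo_mono (Finset.mem_range.1 hs)) le_rfl

theorem measurable_wealth {A : ℕ → Ω → EuclideanSpace ℝ (Fin N)} (hA : M.IsEffort A) {t : ℕ}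
    (ht : t ≤ M.T) : Measurable[M.priceInfo t] (M.wealth A t) :=
  measurable_const.add (M.measurable_sum_range fun s hs => M.measurable_gain (hA s (by omega)))

/-- Wealth generated by a price-adapted effort is itself price-adapted, so observing it adds
nothing: Principal and Agent condition on the same information. -/
theorem principalInfo_eq {A : ℕ → Ω → EuclideanSpace ℝ (Fin N)} (hA : M.IsEffort A) {t : ℕ}
    (ht : t ≤ M.T) : M.principalInfo A t = M.priceInfo t := by
  refine sup_eq_left.2 (iSup₂_le fun s hs => ?_)
  exact ((M.measurable_wealth hA (hs.trans ht)).mono (M.priceInfo_mono hs) le_rfl).comap_le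

/-- A random variable known at time `T` is a function of the price path. -/
theorem exists_eq_function_of_path {Θ : Ω → ℝ} (hΘ : Measurable[M.priceInfo M.T] Θ) :
    ∃ d : (Fin (M.T + 1) → EuclideanSpace ℝ (Fin N)) → ℝ, Measurable d ∧
      ∀ ω, Θ ω = d fun s => M.P (s : ℕ) ω := by
  set path : Ω → Fin (M.T + 1) → EuclideanSpace ℝ (Fin N) := fun ω s => M.P (s : ℕ) ω
  have hle : M.priceInfo M.T ≤ MeasurableSpace.comap path inferInstance := by
    refine iSup₂_le fun s hs => ?_
    have h1 : Measurable[MeasurableSpace.comap path inferInstance] (M.P s) :=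
      (measurable_pi_apply (⟨s, by omega⟩ : Fin (M.T + 1))).comp (comap_measurable path)
    exact h1.comap_le
  obtain ⟨d, hd, h⟩ := (hΘ.mono hle le_rfl).exists_eq_measurable_comp
  exact ⟨d, hd, fun ω => congrFun h ω⟩

variable {mΩ : MeasurableSpace Ω} {μ : Measure Ω}

theorem priceInfo_le (hP : ∀ t ≤ M.T, Measurable (M.P t)) {t : ℕ} (ht : t ≤ M.T) :
    M.priceInfo t ≤ mΩ :=
  iSup₂_le fun s hs => (hP s (hs.trans ht)).comap_le

theorem principalU_eq {A : ℕ → Ω → EuclideanSpace ℝ (Fin N)} (hA : M.IsEffort A)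
    (X : Ω → EReal) : M.principalU μ A 0 X = oceUtility μ M.priceInfo M.T M.Hp 0 X :=
  pasteSteps_congr _ _ _ fun s _ hs => by
    rw [M.principalInfo_eq hA (by omega)]

theorem IsAgentValue.measurable {M : PAModel Ω N} {Θ : Ω → ℝ} {β : ℕ → Ω → ℝ} {V : ℕ → Ω → EReal}
    (hV : M.IsAgentValue μ Θ β V) (hΘ : Measurable[M.priceInfo M.T] Θ) {t : ℕ} (ht : t ≤ M.T) :
    Measurable[M.priceInfo t] (V t) := by
  rcases ht.eq_or_lt with rfl | ht
  · rw [show V M.T = fun ω => (Θ ω : EReal) from funext hV.1]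
    exact measurable_coe_real_ereal.comp hΘ
  · exact (hV.2 t ht).measurable

/-! ### The Agent's recursion along a fixed effort -/

section

variable [IsProbabilityMeasure μ]

/-- The pasted utility acts on a payoff known at time `t + 1`, which the later steps leave
unchanged; only the step at `t` remains. -/
theorem agentObjective_eq (hP : ∀ t ≤ M.T, Measurable (M.P t))
    (hHa : ∀ t < M.T, IsCoerciveLoss (M.Ha t)) {t : ℕ} (ht : t < M.T) {X : Ω → EReal}
    (hX : Measurable[M.priceInfo (t + 1)] X) {b : Ω → ℝ} (hb : Measurable[M.priceInfo t] b)
    {a : Ω → EuclideanSpace ℝ (Fin N)} (ha : Measurable[M.priceInfo t] a) :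
    ∀ᵐ ω ∂μ, M.agentObjective μ t X b a ω
      = oceStep (M.priceInfo t) μ (M.Ha t)
          (fun ω' => X ω' + ((b ω' * M.gain t a ω' : ℝ) : EReal)) ω - (M.c t (a ω) : EReal) := by
  have h𝒢 : ∀ s < M.T, M.priceInfo s ≤ mΩ := fun s hs => M.priceInfo_le hP hs.le
  have hY : Measurable[M.priceInfo (t + 1)]
      fun ω' => X ω' + ((b ω' * M.gain t a ω' : ℝ) : EReal) :=
    hX.add (measurable_coe_real_ereal.comp
      ((hb.mono (M.priceInfo_mono (Nat.le_succ t)) le_rfl).mul (M.measurable_gain ha)))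
  have hYΩ := hY.mono (M.priceInfo_le hP ht) le_rfl
  have h1 := oceUtility_of_measurable (μ := μ) h𝒢
    (fun s _ => M.priceInfo_mono (Nat.le_succ s)) hHa hYΩ ht hY
  have h2 := oceStep_congr (μ := μ) (h𝒢 t ht) (hHa t ht) (measurable_oceUtility h𝒢 hYΩ ht) hYΩ h1
  filter_upwards [h2] with ω h2
  rw [agentObjective, agentU, oceUtility_of_lt ht, h2]

/-- The gains from the contract and the costs up to time `t`. -/
noncomputable def netGains (β : ℕ → Ω → ℝ) (B : ℕ → Ω → EuclideanSpace ℝ (Fin N)) (t : ℕ) (ω : Ω) :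
    ℝ :=
  ∑ s ∈ Finset.range t, (β s ω * M.gain s (B s) ω - M.c s (B s ω))

theorem measurable_netGains
    {β : ℕ → Ω → ℝ} {B : ℕ → Ω → EuclideanSpace ℝ (Fin N)} (hc : ∀ t < M.T, Measurable (M.c t))
    (hβ : ∀ t < M.T, Measurable[M.priceInfo t] (β t)) (hB : M.IsEffort B) {t : ℕ} (ht : t ≤ M.T) :
    Measurable[M.priceInfo t] (M.netGains β B t) := by
  refine M.measurable_sum_range fun s hs => ?_
  have hs' : s < M.T := by omega
  have hle := M.priceInfo_mono (Nat.le_succ s)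
  exact (((hβ s hs').mono hle le_rfl).mul (M.measurable_gain (hB s hs'))).sub
    ((hc s hs').comp ((hB s hs').mono hle le_rfl))

theorem payment_sub_cost_eq
    {Θ : Ω → ℝ} {β : ℕ → Ω → ℝ} {V : ℕ → Ω → EReal} {B : ℕ → Ω → EuclideanSpace ℝ (Fin N)}
    (hΘ : ∀ ω, V M.T ω = (Θ ω : EReal))
    (ω : Ω) : ((M.payment Θ β B ω - M.cost B ω : ℝ) : EReal)
    = V M.T ω + (M.netGains β B M.T ω : EReal) := by
  rw [hΘ, ← EReal.coe_add, payment_eq, cost, netGains, Finset.sum_sub_distrib]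
  congr 1
  ring

/-- Past net gains and the current cost are known at time `t`, so cash additivity takes them out of
the one-step utility. This makes `V + netGains` the candidate for verification. -/
theorem oceStep_add_netGains
    {β : ℕ → Ω → ℝ} {V : ℕ → Ω → EReal} {B : ℕ → Ω → EuclideanSpace ℝ (Fin N)}
    (hP : ∀ t ≤ M.T, Measurable (M.P t)) (hHa : ∀ t < M.T, IsCoerciveLoss (M.Ha t))
    (hc : ∀ t < M.T, Measurable (M.c t)) (hV : ∀ t ≤ M.T, Measurable[M.priceInfo t] (V t))
    (hβ : ∀ t < M.T, Measurable[M.priceInfo t] (β t)) (hB : M.IsEffort B) {t : ℕ} (ht : t < M.T) :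
    oceStep (M.priceInfo t) μ (M.Ha t)
        (fun ω => V (t + 1) ω + (M.netGains β B (t + 1) ω : EReal))
      =ᵐ[μ] fun ω => M.agentObjective μ t (V (t + 1)) (β t) (B t) ω
        + (M.netGains β B t ω : EReal) := by
  have hct : Measurable[M.priceInfo t] fun ω => M.c t (B t ω) := (hc t ht).comp (hB t ht)
  have hg : Measurable[M.priceInfo (t + 1)]
      fun ω => V (t + 1) ω + ((β t ω * M.gain t (B t) ω : ℝ) : EReal) :=
    (hV (t + 1) ht).add (measurable_coe_real_ereal.comp
      (((hβ t ht).mono (M.priceInfo_mono (Nat.le_succ t)) le_rfl).mul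
        (M.measurable_gain (hB t ht))))
  have h1 := oceStep_add (μ := μ) (M.priceInfo_le hP ht.le) (hHa t ht)
    (hg.mono (M.priceInfo_le hP ht) le_rfl) (r := fun ω => M.netGains β B t ω - M.c t (B t ω))
    ((M.measurable_netGains hc hβ hB ht.le).sub hct)
  have h2 : (fun ω => V (t + 1) ω + (M.netGains β B (t + 1) ω : EReal))
      = fun ω => (V (t + 1) ω + ((β t ω * M.gain t (B t) ω : ℝ) : EReal))
        + ((M.netGains β B t ω - M.c t (B t ω) : ℝ) : EReal) := by
    ext ω
    rw [add_assoc, ← EReal.coe_add, netGains, Finset.sum_range_succ, ← netGains]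
    congr 2
    ring
  rw [h2]
  filter_upwards [h1, M.agentObjective_eq (μ := μ) hP hHa ht (hV (t + 1) ht) (hβ t ht) (hB t ht)]
    with ω h1 h3
  rw [h1, h3, sub_eq_add_neg (oceStep _ _ _ _ _), add_assoc, ← EReal.coe_neg, ← EReal.coe_add]
  congr 2
  ring

/-- Under any effort whose objectives stay below `V`, the process `V + netGains` is a supersolution;
it starts at `V 0` and ends at payment minus cost. -/
theorem agentU_le_value
    {Θ : Ω → ℝ} {β : ℕ → Ω → ℝ} {V : ℕ → Ω → EReal} {B : ℕ → Ω → EuclideanSpace ℝ (Fin N)}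
    (hP : ∀ t ≤ M.T, Measurable (M.P t)) (hHa : ∀ t < M.T, IsCoerciveLoss (M.Ha t))
    (hc : ∀ t < M.T, Measurable (M.c t)) (hΘ : ∀ ω, V M.T ω = (Θ ω : EReal))
    (hV : ∀ t ≤ M.T, Measurable[M.priceInfo t] (V t))
    (hβ : ∀ t < M.T, Measurable[M.priceInfo t] (β t)) (hB : M.IsEffort B)
    (hobj : ∀ t < M.T, M.agentObjective μ t (V (t + 1)) (β t) (B t) ≤ᵐ[μ] V t) :
    M.agentU μ 0 (fun ω => ((M.payment Θ β B ω - M.cost B ω : ℝ) : EReal)) ≤ᵐ[μ] V 0 := by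
  have hJ : ∀ t ≤ M.T, Measurable fun ω => V t ω + (M.netGains β B t ω : EReal) := fun t ht =>
    ((hV t ht).add (measurable_coe_real_ereal.comp (M.measurable_netGains hc hβ hB ht))).mono
      (M.priceInfo_le hP ht) le_rfl
  simp only [M.payment_sub_cost_eq hΘ]
  refine (oceUtility_le (μ := μ) (fun s hs => M.priceInfo_le hP hs.le) hHa (hJ _ le_rfl) hJ
    (Filter.EventuallyLE.refl _ _) (fun t ht => ?_) (Nat.zero_le _)).trans ?_
  · filter_upwards [M.oceStep_add_netGains (μ := μ) hP hHa hc hV hβ hB ht, hobj t ht] with ω h1 h2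
    rw [h1]
    gcongr
  · exact .of_forall fun ω => by simp [netGains]

theorem value_le_agentU
    {Θ : Ω → ℝ} {β : ℕ → Ω → ℝ} {V : ℕ → Ω → EReal} {B : ℕ → Ω → EuclideanSpace ℝ (Fin N)}
    (hP : ∀ t ≤ M.T, Measurable (M.P t)) (hHa : ∀ t < M.T, IsCoerciveLoss (M.Ha t))
    (hc : ∀ t < M.T, Measurable (M.c t)) (hΘ : ∀ ω, V M.T ω = (Θ ω : EReal))
    (hV : ∀ t ≤ M.T, Measurable[M.priceInfo t] (V t))
    (hβ : ∀ t < M.T, Measurable[M.priceInfo t] (β t)) (hB : M.IsEffort B)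
    (hobj : ∀ t < M.T,
      V t ≤ᵐ[μ] M.agentObjective μ t (V (t + 1)) (β t) (B t)) :
    V 0 ≤ᵐ[μ] M.agentU μ 0 (fun ω => ((M.payment Θ β B ω - M.cost B ω : ℝ) : EReal)) := by
  have hJ : ∀ t ≤ M.T, Measurable fun ω => V t ω + (M.netGains β B t ω : EReal) := fun t ht =>
    ((hV t ht).add (measurable_coe_real_ereal.comp (M.measurable_netGains hc hβ hB ht))).mono
      (M.priceInfo_le hP ht) le_rfl
  simp only [M.payment_sub_cost_eq hΘ]
  refine Filter.EventuallyLE.trans ?_ (le_oceUtility (μ := μ)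
    (fun s hs => M.priceInfo_le hP hs.le) hHa (hJ _ le_rfl) hJ
    (Filter.EventuallyLE.refl _ _) (fun t ht => ?_) (Nat.zero_le _))
  · exact .of_forall fun ω => by simp [netGains]
  · filter_upwards [M.oceStep_add_netGains (μ := μ) hP hHa hc hV hβ hB ht, hobj t ht] with ω h1 h2
    rw [h1]
    gcongr

end

/-! ### Efficient risk sharing and the optimal contract -/

/-- The gains that the contract passes on to the Agent up to time `t`. -/
noncomputable def sharedGains (β : ℕ → Ω → ℝ) (A : ℕ → Ω → EuclideanSpace ℝ (Fin N)) (t : ℕ)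
    (ω : Ω) : ℝ :=
  ∑ s ∈ Finset.range t, β s ω * M.gain s (A s) ω

theorem measurable_sharedGains {β : ℕ → Ω → ℝ} {A : ℕ → Ω → EuclideanSpace ℝ (Fin N)}
    (hβ : ∀ t < M.T, Measurable[M.priceInfo t] (β t)) (hA : M.IsEffort A) {t : ℕ} (ht : t ≤ M.T) :
    Measurable[M.priceInfo t] (M.sharedGains β A t) :=
  M.measurable_sum_range fun s hs =>
    ((hβ s (by omega)).mono (M.priceInfo_mono (Nat.le_succ s)) le_rfl).mul
      (M.measurable_gain (hA s (by omega)))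

/-- The process `G` bounds the sum of the one-step utilities that the Principal and the Agent can
derive from the future gains, net of the costs. -/
def IsSocialBound (μ : Measure Ω) (G : ℕ → Ω → ℝ) : Prop :=
  ∀ t < M.T, ∀ b : Ω → EuclideanSpace ℝ (Fin N), Measurable[M.priceInfo t] b →
    ∀ Y : Ω → EReal, Measurable Y → ∀ᵐ ω ∂μ,
      oceStep (M.priceInfo t) μ (M.Hp t)
          (fun ω => ((G (t + 1) ω + M.gain t b ω : ℝ) : EReal) - Y ω) ω
        ≤ ((G t ω + M.c t (b ω) : ℝ) : EReal) - oceStep (M.priceInfo t) μ (M.Ha t) Y ω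

section

variable [IsProbabilityMeasure μ]

/-- The Principal's utility is at most the social surplus that the Agent's utility leaves over. -/
theorem principalUtility_le {G : ℕ → Ω → ℝ} (hP : ∀ t ≤ M.T, Measurable (M.P t))
    (hHa : ∀ t < M.T, IsCoerciveLoss (M.Ha t)) (hHp : ∀ t < M.T, IsCoerciveLoss (M.Hp t))
    (hGT : G M.T = 0) (hG : ∀ t ≤ M.T, Measurable[M.priceInfo t] (G t))
    (hGb : M.IsSocialBound μ G)
    {Θ : Ω → ℝ} {β : ℕ → Ω → ℝ} {V : ℕ → Ω → EReal} {A : ℕ → Ω → EuclideanSpace ℝ (Fin N)}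
    (hΘ : ∀ ω, V M.T ω = (Θ ω : EReal)) (hV : ∀ t ≤ M.T, Measurable[M.priceInfo t] (V t))
    (hβ : ∀ t < M.T, Measurable[M.priceInfo t] (β t)) (hA : M.IsEffort A)
    (hobj : ∀ t < M.T, M.agentObjective μ t (V (t + 1)) (β t) (A t) =ᵐ[μ] V t) :
    M.principalUtility μ Θ β A ≤ᵐ[μ] fun ω => ((M.W₀ + G 0 ω : ℝ) : EReal) - V 0 ω := by
  -- The candidate bound: wealth so far plus remaining surplus, less the gains already shared and
  -- the Agent's continuation value.
  let J : ℕ → Ω → EReal := fun t ω =>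
    ((M.wealth A t ω + G t ω - M.sharedGains β A t ω : ℝ) : EReal) - V t ω
  have hmeas : ∀ {t : ℕ} {x : Ω → ℝ} {y : Ω → EReal}, t ≤ M.T → Measurable[M.priceInfo t] x →
      Measurable[M.priceInfo t] y → Measurable fun ω => (x ω : EReal) - y ω := by
    intro t x y ht hx hy
    simp only [sub_eq_add_neg]
    exact ((measurable_coe_real_ereal.comp hx).add (continuous_neg.measurable.comp hy)).mono
      (M.priceInfo_le hP ht) le_rfl
  have hJ : ∀ t ≤ M.T, Measurable (J t) := fun t ht => hmeas ht
    (((M.measurable_wealth hA ht).add (hG t ht)).sub (M.measurable_sharedGains hβ hA ht)) (hV t ht)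
  have hX : (fun ω => ((M.wealth A M.T ω - M.payment Θ β A ω : ℝ) : EReal)) = J M.T := by
    ext ω
    simp only [J]
    rw [hΘ, ← EReal.coe_sub, payment_eq, ← sharedGains, hGT, Pi.zero_apply]
    congr 1
    ring
  rw [principalUtility, M.principalU_eq hA, hX]
  refine (oceUtility_le (fun t ht => M.priceInfo_le hP ht.le) hHp (hJ _ le_rfl) hJ
    (EventuallyLE.refl _ _) (fun t ht => ?_) (Nat.zero_le _)).trans ?_
  · have hle := M.priceInfo_mono (Nat.le_succ t)
    have hgain := M.measurable_gain (hA t ht)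
    have hY : Measurable[M.priceInfo (t + 1)]
        fun ω => V (t + 1) ω + ((β t ω * M.gain t (A t) ω : ℝ) : EReal) :=
      (hV (t + 1) ht).add (measurable_coe_real_ereal.comp (((hβ t ht).mono hle le_rfl).mul hgain))
    have h1 : J (t + 1) = fun ω => (((G (t + 1) ω + M.gain t (A t) ω : ℝ) : EReal)
        - (V (t + 1) ω + ((β t ω * M.gain t (A t) ω : ℝ) : EReal)))
        + ((M.wealth A t ω - M.sharedGains β A t ω : ℝ) : EReal) := by
      ext ω
      rw [← EReal.coe_add_sub_sub_eq]
      simp only [J, sharedGains, Finset.sum_range_succ]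
      rw [← sub_add_cancel (M.wealth A (t + 1) ω) (M.wealth A t ω), wealth_succ_sub]
      congr 2
      ring
    have h2 := oceStep_add (μ := μ) (M.priceInfo_le hP ht.le) (hHp t ht)
      (hmeas ht ((hG (t + 1) ht).add hgain) hY)
      ((M.measurable_wealth hA ht.le).sub (M.measurable_sharedGains hβ hA ht.le))
    -- The social bound is applied to the Agent's continuation payoff including his share of the
    -- gain. By incentive compatibility its utility to him is `V t` plus the cost of `A t`, and the
    -- costs cancel.
    filter_upwards [h2, hGb t ht (A t) (hA t ht) _ (hY.mono (M.priceInfo_le hP ht) le_rfl),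
      M.agentObjective_eq (μ := μ) hP hHa ht (hV (t + 1) ht) (hβ t ht) (hA t ht), hobj t ht]
      with ω h2 h3 h4 h5
    rw [EReal.eq_add_coe_of_sub_coe_eq (h4.symm.trans h5)] at h3
    rw [h1]
    refine h2.trans_le ((add_le_add_left h3 _).trans_eq ?_)
    rw [← EReal.coe_add_sub_sub_eq]
    simp only [J, Pi.sub_apply]
    congr 2
    ring
  · exact .of_forall fun ω => by simp [J, wealth, sharedGains]

/-- An incentive-compatible contract gives the Agent at most the initial value of his recursion. -/
theorem IsAgentValue.agentOptimalUtility_le {M : PAModel Ω N} {Θ : Ω → ℝ} {β : ℕ → Ω → ℝ}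
    {V : ℕ → Ω → EReal} (hVal : M.IsAgentValue μ Θ β V) (hP : ∀ t ≤ M.T, Measurable (M.P t))
    (hHa : ∀ t < M.T, IsCoerciveLoss (M.Ha t)) (hc : ∀ t < M.T, Measurable (M.c t))
    (hΘ : Measurable[M.priceInfo M.T] Θ) (hβ : ∀ t < M.T, Measurable[M.priceInfo t] (β t)) :
    M.agentOptimalUtility μ Θ β ≤ᵐ[μ] V 0 := by
  refine (isEssSup_essSupFamily (M.priceInfo_le hP (Nat.zero_le _)) μ _).least _
    (hVal.measurable hΘ (Nat.zero_le _)) ?_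
  rintro _ ⟨B, hB, rfl⟩
  exact M.agentU_le_value hP hHa hc hVal.1 (fun t ht => hVal.measurable hΘ ht) hβ hB
    fun t ht => (hVal.2 t ht).le _ ⟨B t, hB t ht, rfl⟩

/-- Efforts and one-step risk transfers that share the future gains efficiently. -/
structure IsEfficientSharing (M : PAModel Ω N) (μ : Measure Ω) (G X : ℕ → Ω → ℝ)
    (A : ℕ → Ω → EuclideanSpace ℝ (Fin N)) : Prop where
  terminal : G M.T = 0
  measurable_surplus : ∀ t ≤ M.T, Measurable[M.priceInfo t] (G t)
  effort : M.IsEffort A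
  measurable_transfer : ∀ t < M.T, Measurable[M.priceInfo (t + 1)] (X t)
  agent : ∀ t < M.T, ∀ᵐ ω ∂μ,
    oceStep (M.priceInfo t) μ (M.Ha t) (fun ω => (X t ω : EReal)) ω = (M.c t (A t ω) : EReal)
  principal : ∀ t < M.T, ∀ᵐ ω ∂μ, oceStep (M.priceInfo t) μ (M.Hp t)
    (fun ω => ((G (t + 1) ω + M.gain t (A t) ω - X t ω : ℝ) : EReal)) ω = (G t ω : EReal)
  socialBound : M.IsSocialBound μ G

/-- One-period sharing is iterated backward from zero surplus; what the induction must carry along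
is that the surplus is known and bounded. -/
theorem exists_isEfficientSharing (hP : ∀ t ≤ M.T, Measurable (M.P t)) {pmin pmax : ℝ}
    (hpmin : 0 < pmin)
    (hPb : ∀ t ≤ M.T, ∀ i : Fin N, ∀ᵐ ω ∂μ, pmin ≤ M.P t ω i ∧ M.P t ω i ≤ pmax)
    (hc : ∀ t < M.T, ConvexOn ℝ Set.univ (M.c t))
    (hc_superlinear : ∀ t < M.T,
      Tendsto (fun a : EuclideanSpace ℝ (Fin N) => M.c t a / ‖a‖)
        (Bornology.cobounded (EuclideanSpace ℝ (Fin N))) atTop)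
    (hHa : ∀ t < M.T, IsCoerciveLoss (M.Ha t)) (hHp : ∀ t < M.T, IsCoerciveLoss (M.Hp t)) :
    ∃ G X A, M.IsEfficientSharing μ G X A := by
  have hstep : ∀ t < M.T, ∀ G : Ω → ℝ,
      (Measurable[M.priceInfo (t + 1)] G ∧ ∃ C, ∀ ω, |G ω| ≤ C) →
      ∃ G' : Ω → ℝ, (Measurable[M.priceInfo t] G' ∧ ∃ C, ∀ ω, |G' ω| ≤ C) ∧
        ∃ (a : Ω → EuclideanSpace ℝ (Fin N)) (X : Ω → ℝ),
          Measurable[M.priceInfo t] a ∧ Measurable[M.priceInfo (t + 1)] X ∧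
          (∀ᵐ ω ∂μ, oceStep (M.priceInfo t) μ (M.Ha t) (fun ω => (X ω : EReal)) ω
            = (M.c t (a ω) : EReal)) ∧
          (∀ᵐ ω ∂μ, oceStep (M.priceInfo t) μ (M.Hp t)
            (fun ω => ((G ω + M.gain t a ω - X ω : ℝ) : EReal)) ω = (G' ω : EReal)) ∧
          ∀ b : Ω → EuclideanSpace ℝ (Fin N), Measurable[M.priceInfo t] b →
            ∀ Y : Ω → EReal, Measurable Y → ∀ᵐ ω ∂μ,
              oceStep (M.priceInfo t) μ (M.Hp t)
                  (fun ω => ((G ω + M.gain t b ω : ℝ) : EReal) - Y ω) ω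
                ≤ ((G' ω + M.c t (b ω) : ℝ) : EReal)
                  - oceStep (M.priceInfo t) μ (M.Ha t) Y ω := by
    intro t ht G hG
    have hκ : ∀ᵐ ω ∂μ,
        ‖M.returns t ω‖ ≤ Real.sqrt (∑ _i : Fin N, ((pmax - pmin) / pmin) ^ 2) := by
      filter_upwards [ae_all_iff.2 (hPb t ht.le), ae_all_iff.2 (hPb (t + 1) ht)] with ω h0 h1
      exact M.norm_returns_le hpmin h0 h1
    obtain ⟨a, X, G', ha, hX, hG', hG'b, h1, h2, h3⟩ := exists_risk_sharing (μ := μ)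
      (M.priceInfo_mono (Nat.le_succ t)) (M.priceInfo_le hP ht) (hHp t ht) (hHa t ht)
      (M.measurable_returns t) hκ (hc t ht) (hc_superlinear t ht) hG.1 hG.2
    simp only [← gain_eq_inner] at h2 h3
    exact ⟨G', ⟨hG', hG'b⟩, a, X, ha, hX, h1, h2, h3⟩
  obtain ⟨G, hGT, hG, h⟩ := exists_backward_recursion M.T (x₀ := (0 : Ω → ℝ))
    (Q := fun t G => Measurable[M.priceInfo t] G ∧ ∃ C, ∀ ω, |G ω| ≤ C)
    ⟨measurable_const, 0, fun ω => by simp⟩ hstep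
  choose! A X h using h
  exact ⟨G, X, A, hGT, fun t ht => (hG t ht).1, fun t ht => (h t ht).1,
    fun t ht => (h t ht).2.1, fun t ht => (h t ht).2.2.1, fun t ht => (h t ht).2.2.2.1,
    fun t ht => (h t ht).2.2.2.2⟩

end

/-! ### The contract built from an efficient sharing -/

namespace IsEfficientSharing

variable {M} {G X : ℕ → Ω → ℝ} {A : ℕ → Ω → EuclideanSpace ℝ (Fin N)}

/-- The Agent's value process when the transfers `X` are paid on top of the reservation utility,
net of the gains that he keeps. -/
noncomputable def value (M : PAModel Ω N) (X : ℕ → Ω → ℝ)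
    (A : ℕ → Ω → EuclideanSpace ℝ (Fin N)) (t : ℕ) (ω : Ω) : ℝ :=
  M.R + ∑ s ∈ Finset.range t, (X s ω - M.gain s (A s) ω)

theorem value_succ (t : ℕ) (ω : Ω) :
    value M X A (t + 1) ω = value M X A t ω + (X t ω - M.gain t (A t) ω) := by
  rw [value, value, Finset.sum_range_succ, add_assoc]

theorem measurable_value (h : M.IsEfficientSharing μ G X A) {t : ℕ} (ht : t ≤ M.T) :
    Measurable[M.priceInfo t] (value M X A t) :=
  measurable_const.add (M.measurable_sum_range fun s hs =>
    (h.measurable_transfer s (by omega)).sub (M.measurable_gain (h.effort s (by omega))))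

variable [IsProbabilityMeasure μ]

theorem agentObjective_value_eq (h : M.IsEfficientSharing μ G X A)
    (hP : ∀ t ≤ M.T, Measurable (M.P t)) (hHa : ∀ t < M.T, IsCoerciveLoss (M.Ha t))
    {t : ℕ} (ht : t < M.T)
    {b : Ω → EuclideanSpace ℝ (Fin N)} (hb : Measurable[M.priceInfo t] b) :
    ∀ᵐ ω ∂μ, M.agentObjective μ t (fun ω => (value M X A (t + 1) ω : EReal)) (fun _ => 1) b ω
      = oceStep (M.priceInfo t) μ (M.Ha t)
          (fun ω => ((X t ω + M.gain t b ω - M.gain t (A t) ω : ℝ) : EReal)) ω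
        + ((value M X A t ω - M.c t (b ω) : ℝ) : EReal) := by
  have hY : Measurable[M.priceInfo (t + 1)]
      fun ω => ((X t ω + M.gain t b ω - M.gain t (A t) ω : ℝ) : EReal) :=
    measurable_coe_real_ereal.comp (((h.measurable_transfer t ht).add (M.measurable_gain hb)).sub
      (M.measurable_gain (h.effort t ht)))
  have e : (fun ω => (value M X A (t + 1) ω : EReal) + ((1 * M.gain t b ω : ℝ) : EReal))
      = fun ω => ((X t ω + M.gain t b ω - M.gain t (A t) ω : ℝ) : EReal)
        + (value M X A t ω : EReal) := by
    ext ω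
    rw [value_succ, ← EReal.coe_add, ← EReal.coe_add]
    congr 1
    ring
  filter_upwards [M.agentObjective_eq (μ := μ) hP hHa ht
      (measurable_coe_real_ereal.comp (h.measurable_value (Nat.succ_le_of_lt ht)))
      (b := fun _ => 1) measurable_const hb,
    oceStep_add (μ := μ) (M.priceInfo_le hP ht.le) (hHa t ht)
      (hY.mono (M.priceInfo_le hP ht) le_rfl) (h.measurable_value ht.le)] with ω h1 h2
  simp only [Function.comp_apply] at h1
  rw [← e] at h2
  refine h1.trans ?_
  rw [h2, sub_eq_add_neg, add_assoc, ← EReal.coe_neg, ← EReal.coe_add, ← sub_eq_add_neg]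

/-- This is where full shares matter. A deviation changes the Agent's payoff by exactly the change
in gains, so the Principal's residual is unchanged and still worth `G t`; the social bound then
limits the Agent's utility from his modified transfer to the cost of the deviation. -/
theorem agentObjective_le_value (h : M.IsEfficientSharing μ G X A)
    (hP : ∀ t ≤ M.T, Measurable (M.P t)) (hHa : ∀ t < M.T, IsCoerciveLoss (M.Ha t))
    {t : ℕ} (ht : t < M.T)
    {b : Ω → EuclideanSpace ℝ (Fin N)} (hb : Measurable[M.priceInfo t] b) :
    M.agentObjective μ t (fun ω => (value M X A (t + 1) ω : EReal)) (fun _ => 1) b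
      ≤ᵐ[μ] fun ω => (value M X A t ω : EReal) := by
  have hY : Measurable fun ω => ((X t ω + M.gain t b ω - M.gain t (A t) ω : ℝ) : EReal) :=
    (measurable_coe_real_ereal.comp (((h.measurable_transfer t ht).add (M.measurable_gain hb)).sub
      (M.measurable_gain (h.effort t ht)))).mono (M.priceInfo_le hP ht) le_rfl
  have e : (fun ω => ((G (t + 1) ω + M.gain t b ω : ℝ) : EReal)
        - ((X t ω + M.gain t b ω - M.gain t (A t) ω : ℝ) : EReal))
      = fun ω => ((G (t + 1) ω + M.gain t (A t) ω - X t ω : ℝ) : EReal) := by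
    ext ω
    rw [← EReal.coe_sub]
    congr 1
    ring
  filter_upwards [h.agentObjective_value_eq hP hHa ht hb, h.principal t ht,
    h.socialBound t ht b hb _ hY] with ω h1 h2 h3
  rw [e, h2] at h3
  have h4 := EReal.le_coe_sub_comm h3
  rw [← EReal.coe_sub, add_sub_cancel_left] at h4
  rw [h1]
  refine (add_le_add_left h4 _).trans_eq ?_
  rw [← EReal.coe_add, add_sub_cancel]

theorem agentObjective_eq_value (h : M.IsEfficientSharing μ G X A)
    (hP : ∀ t ≤ M.T, Measurable (M.P t)) (hHa : ∀ t < M.T, IsCoerciveLoss (M.Ha t))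
    {t : ℕ} (ht : t < M.T) :
    M.agentObjective μ t (fun ω => (value M X A (t + 1) ω : EReal)) (fun _ => 1) (A t)
      =ᵐ[μ] fun ω => (value M X A t ω : EReal) := by
  filter_upwards [h.agentObjective_value_eq hP hHa ht (h.effort t ht), h.agent t ht] with ω h1 h2
  rw [h1]
  simp only [add_sub_cancel_right]
  rw [h2, ← EReal.coe_add, add_sub_cancel]

theorem isAgentValue (h : M.IsEfficientSharing μ G X A)
    (hP : ∀ t ≤ M.T, Measurable (M.P t)) (hHa : ∀ t < M.T, IsCoerciveLoss (M.Ha t)) :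
    M.IsAgentValue μ (value M X A M.T) (fun _ _ => 1)
      fun t ω => (value M X A t ω : EReal) := by
  refine ⟨fun ω => rfl, fun t ht =>
    ⟨measurable_coe_real_ereal.comp (h.measurable_value ht.le), ?_, fun g' _ hg' => ?_⟩⟩
  · rintro _ ⟨b, hb, rfl⟩
    exact h.agentObjective_le_value hP hHa ht hb
  · exact (h.agentObjective_eq_value hP hHa ht).symm.le.trans
      (hg' _ ⟨A t, h.effort t ht, rfl⟩)

theorem agentOptimalUtility_eq (h : M.IsEfficientSharing μ G X A)
    (hP : ∀ t ≤ M.T, Measurable (M.P t)) (hHa : ∀ t < M.T, IsCoerciveLoss (M.Ha t))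
    (hc : ∀ t < M.T, Measurable (M.c t)) :
    M.agentOptimalUtility μ (value M X A M.T) (fun _ _ => 1) =ᵐ[μ] fun _ => (M.R : EReal) := by
  have hV := h.isAgentValue hP hHa
  have hΘ := h.measurable_value le_rfl
  have h0 : (fun ω => (value M X A 0 ω : EReal)) = fun _ => (M.R : EReal) := by
    simp [value]
  rw [← h0]
  refine (hV.agentOptimalUtility_le hP hHa hc hΘ fun _ _ => measurable_const).antisymm ?_
  exact (M.value_le_agentU hP hHa hc hV.1 (fun t ht => hV.measurable hΘ ht)
    (fun _ _ => measurable_const) h.effort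
    fun t ht => (h.agentObjective_eq_value hP hHa ht).symm.le).trans
    ((isEssSup_essSupFamily (M.priceInfo_le hP (Nat.zero_le _)) μ _).le _ ⟨A, h.effort, rfl⟩)

/-- The process `W₀ + G - value` solves the Principal's recursion exactly: each transfer leaves her
the surplus `G t`, and everything else is known cash. -/
theorem principalUtility_eq (h : M.IsEfficientSharing μ G X A)
    (hP : ∀ t ≤ M.T, Measurable (M.P t)) (hHp : ∀ t < M.T, IsCoerciveLoss (M.Hp t)) :
    M.principalUtility μ (value M X A M.T) (fun _ _ => 1) A
      =ᵐ[μ] fun ω => ((M.W₀ + G 0 ω - M.R : ℝ) : EReal) := by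
  let J : ℕ → Ω → EReal := fun t ω => ((M.W₀ + G t ω - value M X A t ω : ℝ) : EReal)
  have hJ : ∀ t ≤ M.T, Measurable (J t) := fun t ht => (measurable_coe_real_ereal.comp
    ((measurable_const.add (h.measurable_surplus t ht)).sub (h.measurable_value ht))).mono
      (M.priceInfo_le hP ht) le_rfl
  have hX : (fun ω => ((M.wealth A M.T ω
      - M.payment (value M X A M.T) (fun _ _ => 1) A ω : ℝ) : EReal)) = J M.T := by
    ext ω
    simp only [J]
    rw [payment_one, h.terminal, Pi.zero_apply]
    congr 1
    ring
  have hstep : ∀ t < M.T, oceStep (M.priceInfo t) μ (M.Hp t) (J (t + 1)) =ᵐ[μ] J t := by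
    intro t ht
    have h1 : J (t + 1) = fun ω => ((G (t + 1) ω + M.gain t (A t) ω - X t ω : ℝ) : EReal)
        + ((M.W₀ - value M X A t ω : ℝ) : EReal) := by
      ext ω
      simp only [J]
      rw [← EReal.coe_add, value_succ]
      congr 1
      ring
    have h2 := oceStep_add (μ := μ) (M.priceInfo_le hP ht.le) (hHp t ht)
      (X := fun ω => ((G (t + 1) ω + M.gain t (A t) ω - X t ω : ℝ) : EReal))
      ((measurable_coe_real_ereal.comp (((h.measurable_surplus (t + 1) ht).add
        (M.measurable_gain (h.effort t ht))).sub (h.measurable_transfer t ht))).mono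
        (M.priceInfo_le hP ht) le_rfl)
      (measurable_const.sub (h.measurable_value ht.le) : Measurable[M.priceInfo t]
        fun ω => M.W₀ - value M X A t ω)
    filter_upwards [h2, h.principal t ht] with ω h2 h3
    rw [h1]
    refine h2.trans ?_
    rw [h3, ← EReal.coe_add]
    simp only [J, Pi.sub_apply]
    congr 1
    ring
  have h0 : J 0 = fun ω => ((M.W₀ + G 0 ω - M.R : ℝ) : EReal) := by
    ext ω
    simp [J, value]
  rw [principalUtility, M.principalU_eq h.effort, hX, ← h0]
  exact (oceUtility_le (fun t ht => M.priceInfo_le hP ht.le) hHp (hJ _ le_rfl) hJ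
    (EventuallyLE.refl _ _) (fun t ht => (hstep t ht).le) (Nat.zero_le _)).antisymm
    (le_oceUtility (fun t ht => M.priceInfo_le hP ht.le) hHp (hJ _ le_rfl) hJ
    (EventuallyLE.refl _ _) (fun t ht => (hstep t ht).symm.le) (Nat.zero_le _))

/-- For a competing contract the Principal gets at most `W₀ + G 0 - V' 0`. Since the Agent's optimal
utility lies between `R` and `V' 0`, this is at most `W₀ + G 0 - R`, which the present contract
achieves. -/
theorem isOptimalContract (h : M.IsEfficientSharing μ G X A)
    (hP : ∀ t ≤ M.T, Measurable (M.P t)) (hHa : ∀ t < M.T, IsCoerciveLoss (M.Ha t))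
    (hHp : ∀ t < M.T, IsCoerciveLoss (M.Hp t)) (hc : ∀ t < M.T, Measurable (M.c t)) :
    M.IsOptimalContract μ (value M X A M.T) (fun _ _ => 1) A where
  incentiveCompatible := ⟨h.measurable_value le_rfl, h.effort, fun _ _ => measurable_const,
    _, h.isAgentValue hP hHa, fun _ ht => h.agentObjective_eq_value hP hHa ht⟩
  individuallyRational := (h.agentOptimalUtility_eq hP hHa hc).symm.le
  optimal := by
    intro Θ' β' A' hIC hIR
    obtain ⟨V', hV', hatt⟩ := hIC.attained
    have hβ' : ∀ t < M.T, Measurable[M.priceInfo t] (β' t) := fun t ht => by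
      rw [← M.principalInfo_eq hIC.effort ht.le]
      exact hIC.share_measurable t ht
    filter_upwards [M.principalUtility_le hP hHa hHp h.terminal h.measurable_surplus h.socialBound
        hV'.1 (fun t ht => hV'.measurable hIC.payment_measurable ht) hβ' hIC.effort hatt,
      hIR, hV'.agentOptimalUtility_le hP hHa hc hIC.payment_measurable hβ',
      h.principalUtility_eq hP hHp] with ω h1 h2 h3 h4
    rw [h4, EReal.coe_sub]
    exact h1.trans (EReal.sub_le_sub le_rfl (h2.trans h3))

end IsEfficientSharing

end PAModel

/-! ### Assembly of the theorem -/

theorem mainTheorem3 {Ω : Type*} [mΩ : MeasurableSpace Ω] (μ : Measure Ω) [IsProbabilityMeasure μ]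
    {N : ℕ} (M : PAModel Ω N)
    (hP_meas : ∀ t ≤ M.T, Measurable (M.P t))
    (pmin pmax : ℝ) (hpmin : 0 < pmin)
    (hP : ∀ t ≤ M.T, ∀ i : Fin N, ∀ᵐ ω ∂μ, pmin ≤ M.P t ω i ∧ M.P t ω i ≤ pmax)
    (hc : ∀ t < M.T, StrictConvexOn ℝ Set.univ (M.c t))
    (hc_superlinear : ∀ t < M.T,
      Tendsto (fun a : EuclideanSpace ℝ (Fin N) => M.c t a / ‖a‖)
        (Bornology.cobounded (EuclideanSpace ℝ (Fin N))) atTop)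
    (hHa : ∀ t < M.T, IsLossFunction (M.Ha t))
    (hHp : ∀ t < M.T, IsLossFunction (M.Hp t))
    (hHa_one : ∀ t < M.T, (1 : ℝ) ∈ interior {y : ℝ | convexConj (M.Ha t) y < ⊤})
    (hHp_one : ∀ t < M.T, (1 : ℝ) ∈ interior {y : ℝ | convexConj (M.Hp t) y < ⊤})
    (hHa_bdd : ∀ t < M.T, ∃ b : ℝ, ∀ s : ℝ, (b : EReal) ≤ M.Ha t s)
    (hHp_bdd : ∀ t < M.T, ∃ b : ℝ, ∀ s : ℝ, (b : EReal) ≤ M.Hp t s) :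
    ∃ (d : (Fin (M.T + 1) → EuclideanSpace ℝ (Fin N)) → ℝ) (Θ : Ω → ℝ)
      (A : ℕ → Ω → EuclideanSpace ℝ (Fin N)),
      Measurable d ∧
      M.IsOptimalContract μ Θ (fun _ _ => 1) A ∧
      (∀ (B : ℕ → Ω → EuclideanSpace ℝ (Fin N)) (ω : Ω),
        M.payment Θ (fun _ _ => 1) B ω =
          M.wealth B M.T ω - d (fun s => M.P (s : ℕ) ω)) ∧
      M.agentOptimalUtility μ Θ (fun _ _ => 1) =ᵐ[μ] (fun _ => (M.R : EReal)) ∧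
      (∀ᵐ ω ∂μ, M.principalUtility μ Θ (fun _ _ => 1) A ω ≠ ⊥ ∧
        M.principalUtility μ Θ (fun _ _ => 1) A ω ≠ ⊤) := by
  have hHa' : ∀ t < M.T, IsCoerciveLoss (M.Ha t) := fun t ht =>
    (hHa t ht).isCoerciveLoss (hHa_one t ht)
  have hHp' : ∀ t < M.T, IsCoerciveLoss (M.Hp t) := fun t ht =>
    (hHp t ht).isCoerciveLoss (hHp_one t ht)
  have hc' : ∀ t < M.T, Measurable (M.c t) := fun t ht =>
    (continuousOn_univ.1 ((hc t ht).convexOn.continuousOn isOpen_univ)).measurable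
  obtain ⟨G, X, A, h⟩ := M.exists_isEfficientSharing (μ := μ) hP_meas hpmin hP
    (fun t ht => (hc t ht).convexOn) hc_superlinear hHa' hHp'
  obtain ⟨d, hd, hΘd⟩ := M.exists_eq_function_of_path (h.measurable_value le_rfl)
  -- With full shares the payment is `Θ + W_T - W₀`, so the derivative left to the Principal is `W₀
  -- - Θ`.
  refine ⟨fun x => M.W₀ - d x, _, A, measurable_const.sub hd,
    h.isOptimalContract hP_meas hHa' hHp' hc', fun B ω => ?_,
    h.agentOptimalUtility_eq hP_meas hHa' hc', ?_⟩
  · rw [M.payment_one, hΘd]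
    ring
  · filter_upwards [h.principalUtility_eq hP_meas hHp'] with ω hω
    rw [hω]
    exact ⟨EReal.coe_ne_bot _, EReal.coe_ne_top _⟩
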